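/- Let $\mathcal C$ be a site, let $$0\longrightarrow A\overset{\imath}{\longrightarrow} L_1\overset{\partial}{\longrightarrow} L_0\overset{p}{\longrightarrow} B\longrightarrow 0$$ be an exact sequence of abelian sheaves on $\mathcal C$, and put $C=\operatorname{Im}\partial$, with $\pi\colon L_1\to C$ the induced epimorphism. Let $\beta\in H^0(B)$ be a global section of $B$ (a morphism $*\to B$). Write $H^i(A)=\operatorname{Ext}^i(\mathbb Z,A)$, the $\operatorname{Ext}$ being taken in abelian sheaves on $\mathcal C$. Let $\mathcal L$ be the stack of pairs $(Q,s)$, where $Q$ is an $L_1$-torsor over an object of $\mathcal C$ and $s\colon Q\to L_0$ is an $L_1$-equivariant map ($L_1$ acting on $L_0$ by translations through $\partial$). Let $\mathcal L_\beta\subset\mathcal L$ be the full substack of the pairs with $p\circ s=\beta$. A section $a$ of $A$ acts on a pair $(Q,s)$ by the translation by $\imath(a)$. A gerbe is a stack in groupoids that is locally non-empty and locally connected. An $A$-gerbe is a gerbe with an identification of the automorphism sheaf of every object with $A$, compatible with restrictions and with all morphisms; equivalences of $A$-gerbes are required to respect these identifications. Then the following hold. 1. $\mathcal L$ is the Picard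 stack of the complex $L_1\to L_0$, as a stack over $B$. That is, $\mathcal L$ is the stack associated with the prestack whose objects over $U$ are the $g\in L_0(U)$ and whose morphisms $g\to g'$ are the $h\in L_1(U)$ with $\partial(h)=g-g'$, and the object of $\mathcal L(U)$ given by $g$ lies over $p(g)\in B(U)$. 2. The fibre $\mathcal L_\beta$ is an $A$-gerbe. It is the stack associated with the prestack whose objects over $U$ are the $g\in L_0(U)$ with $p(g)=\beta|_U$ and whose morphisms $g\to g'$ are the $h\in L_1(U)$ with $\partial(h)=g-g'$, a section $a$ of $A$ acting on $g$ as the automorphism $\imath(a)$. 3. The class of $\mathcal L_\beta$ in $H^2(A)$ exists, is unique, and equals $d^2(\beta)$, where $$d^2\colon H^0(B)\longrightarrow H^1(C)\longrightarrow H^2(A)$$ is the composition of the boundary maps of $0\to C\to L_0\to B\to 0$ and $0\to A\to L_1\to C\to 0$. Here the class of an $A$-gerbe is the class in $H^2(A)$ of the Čech $2$-cocycle $(c_{ijk})$ defined by $\alpha_{ij}\circ\alpha_{jk}=c_{ijk}\circ\alpha_{ik}$, where $x_i$ are objects over a family $(U_i)$ covering the terminal object and $\alpha_{ij}\colon x_j\to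 x_i$ are morphisms over coverings of the products $U_i\times U_j$. The class of $(c_{ijk})$ in $H^2(A)$ is defined as follows. Let $0\to A\to I_0\to I_1\to R\to 0$ be exact with $I_0$ and $I_1$ injective. Suppose that $c_{ijk}=\gamma_{ij}+\gamma_{jk}-\gamma_{ik}$ in $I_0$, that the image of $\gamma_{ij}$ in $I_1$ is $s_j-s_i$, and that the images of the $s_i$ in $R$ are the restrictions of a global section $\rho$ of $R$. Then the class is the iterated boundary of $\rho$ in $H^2(A)$. 4. The fibre $(L_0)_\beta=p^{-1}(\beta)$ is a $C$-torsor. Its lifting gerbe along $\pi$, that is, the stack of pairs $(Q,\lambda)$ of an $L_1$-torsor $Q$ and a $\pi$-equivariant map $\lambda\colon Q\to(L_0)_\beta$, on which a section $a$ of $A$ acts by translation by $\imath(a)$, is an $A$-gerbe. The $A$-gerbe $\mathcal L_\beta$ is equivalent to it as an $A$-gerbe. -/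

import Mathlib

open CategoryTheory Opposite Bicategory Limits

namespace PicardGerbe

section Actions
universe w v u
variable {D : Type u} [Category.{v} D] {K : GrothendieckTopology D}

/-- A sheaf of sets (`carrier`) with an action of the abelian sheaf `G`, written `act g x`. -/
structure ActionSheaf (G : Sheaf K AddCommGrpCat.{w}) where
  carrier : Sheaf K (Type w)
  act {V : Dᵒᵖ} : G.obj.obj V → carrier.obj.obj V → carrier.obj.obj V
  zero_act {V : Dᵒᵖ} (x : carrier.obj.obj V) : act (0 : G.obj.obj V) x = x
  add_act {V : Dᵒᵖ} (g h : G.obj.obj V) (x : carrier.obj.obj V) :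
    act (g + h) x = act g (act h x)
  map_act {V W : Dᵒᵖ} (f : V ⟶ W) (g : G.obj.obj V) (x : carrier.obj.obj V) :
    carrier.obj.map f (act g x) = act (G.obj.map f g) (carrier.obj.map f x)

lemma ActionSheaf.act_comm {G : Sheaf K AddCommGrpCat.{w}} (P : ActionSheaf G) {V : Dᵒᵖ}
    (g h : G.obj.obj V) (x : P.carrier.obj.obj V) :
    P.act g (P.act h x) = P.act h (P.act g x) := by
  rw [← P.add_act, ← P.add_act, add_comm]

/-- A `G`-torsor: the action is simply transitive on sections, and sections exist locally. -/
structure ActionSheaf.IsTorsor {G : Sheaf K AddCommGrpCat.{w}} (P : ActionSheaf G) : Prop where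
  existsUnique_act (V : Dᵒᵖ) (x y : P.carrier.obj.obj V) : ∃! g : G.obj.obj V, P.act g x = y
  locally_nonempty (V : D) : ∃ S ∈ K V, ∀ ⦃W : D⦄ (f : W ⟶ V), S f →
    Nonempty (P.carrier.obj.obj (op W))

/-- Restriction of the action along a morphism `φ : E ⟶ G` of abelian sheaves. -/
def ActionSheaf.res {E G : Sheaf K AddCommGrpCat.{w}} (φ : E ⟶ G) (P : ActionSheaf G) :
    ActionSheaf E where
  carrier := P.carrier
  act e x := P.act (φ.hom.app _ e) x
  zero_act x := by simp [P.zero_act]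
  add_act g h x := by simp [P.add_act]
  map_act f g x := by
    rw [P.map_act]; congr 1; exact (NatTrans.naturality_apply φ.hom f g).symm

/-- A pair `(Q, s)` of an `E`-torsor `Q` and an `E`-equivariant map `s : Q ⟶ X` to a sheaf of sets
with `E`-action. -/
structure TorsorOver {E : Sheaf K AddCommGrpCat.{w}} (X : ActionSheaf E) where
  torsor : ActionSheaf E
  isTorsor : torsor.IsTorsor
  toX : torsor.carrier ⟶ X.carrier
  equivariant {V : Dᵒᵖ} (e : E.obj.obj V) (q : torsor.carrier.obj.obj V) :
    toX.hom.app V (torsor.act e q) = X.act e (toX.hom.app V q)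

namespace TorsorOver
variable {E : Sheaf K AddCommGrpCat.{w}} {X : ActionSheaf E}

/-- Morphisms of pairs: `E`-equivariant maps of torsors compatible with the maps to `X`. -/
@[ext]
structure Hom (Q R : TorsorOver X) where
  hom : Q.torsor.carrier ⟶ R.torsor.carrier
  equivariant {V : Dᵒᵖ} (e : E.obj.obj V) (q : Q.torsor.carrier.obj.obj V) :
    hom.hom.app V (Q.torsor.act e q) = R.torsor.act e (hom.hom.app V q)
  comp_toX {V : Dᵒᵖ} (q : Q.torsor.carrier.obj.obj V) :
    R.toX.hom.app V (hom.hom.app V q) = Q.toX.hom.app V q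

@[simps]
instance : Category (TorsorOver X) where
  Hom := Hom
  id Q := { hom := 𝟙 _, equivariant := by simp, comp_toX := by simp }
  comp f g := 
    { hom := f.hom ≫ g.hom
      equivariant e q := by simp [f.equivariant, g.equivariant]
      comp_toX q := by simp [f.comp_toX, g.comp_toX] }

@[ext]
lemma hom_ext {Q R : TorsorOver X} {f g : Q ⟶ R} 
    (h : ∀ V (q : Q.torsor.carrier.obj.obj V), f.hom.hom.app V q = g.hom.hom.app V q) : f = g := by
  apply Hom.ext
  ext V q
  exact h V q

end TorsorOver
end Actions
set_option linter.unusedVariables false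

section Stack
universe w v u
variable {C : Type u} [Category.{v} C] {J : GrothendieckTopology C}

/-- Restriction of a sheaf with action to the localized site `C/U`. -/
def ActionSheaf.over {E : Sheaf J AddCommGrpCat.{w}} (X : ActionSheaf E) (U : C) :
    ActionSheaf (E.over U) where
  carrier := X.carrier.over U
  act {V} e x := X.act (V := op V.unop.left) e x
  zero_act x := X.zero_act _
  add_act g h x := X.add_act _ _ _
  map_act f g x := X.map_act _ _ _

/-- Pull-back along `f : V ⟶ U` of a sheaf with action on `C/U`. -/
def ActionSheaf.pull {E : Sheaf J AddCommGrpCat.{w}} {U V : C} (f : V ⟶ U)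
    (Q : ActionSheaf (E.over U)) : ActionSheaf (E.over V) where
  carrier := (J.overMapPullback (Type w) f).obj Q.carrier
  act {W} e x := Q.act (V := op ((Over.map f).obj W.unop)) e x
  zero_act x := Q.zero_act _
  add_act g h x := Q.add_act _ _ _
  map_act {W W'} a g x := Q.map_act ((Over.map f).op.map a) _ _

lemma ActionSheaf.IsTorsor.pull {E : Sheaf J AddCommGrpCat.{w}} {U V : C} (f : V ⟶ U)
    {Q : ActionSheaf (E.over U)} (hQ : Q.IsTorsor) : (Q.pull f).IsTorsor where
  existsUnique_act W x y := hQ.existsUnique_act (op ((Over.map f).obj W.unop)) x y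
  locally_nonempty W := by
    obtain ⟨S, hS, h⟩ := hQ.locally_nonempty ((Over.map f).obj W)
    refine ⟨S.functorPullback (Over.map f), ?_, fun W' a ha => h _ ha⟩
    rw [GrothendieckTopology.mem_over_iff] at hS ⊢
    rwa [Sieve.overEquiv_functorPullback_map]

namespace TorsorOver
variable {E : Sheaf J AddCommGrpCat.{w}} (X : ActionSheaf E)

/-- Pull-back of pairs (torsor, equivariant map) along `f : V ⟶ U`. -/
def pull {U V : C} (f : V ⟶ U) : TorsorOver (X.over U) ⥤ TorsorOver (X.over V) where
  obj Q :=
    { torsor := Q.torsor.pull f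
      isTorsor := Q.isTorsor.pull f
      toX := (J.overMapPullback (Type w) f).map Q.toX ≫ (X.carrier.pushforwardOverMapIso f).hom
      equivariant {W} e q := Q.equivariant (V := op ((Over.map f).obj W.unop)) e q }
  map {Q R} φ :=
    { hom := (J.overMapPullback (Type w) f).map φ.hom
      equivariant {W} e q := φ.equivariant (V := op ((Over.map f).obj W.unop)) e q
      comp_toX {W} q := φ.comp_toX (V := op ((Over.map f).obj W.unop)) q }



variable {X} in
/-- An equivariant isomorphism of torsors compatible with the maps to `X` is an isomorphism of
pairs. -/
@[simps]
def isoMk {U : C} {Q R : TorsorOver (X.over U)} (e : Q.torsor.carrier ≅ R.torsor.carrier)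
    (h₁ : ∀ {V : (Over U)ᵒᵖ} (g : (E.over U).obj.obj V) (q : Q.torsor.carrier.obj.obj V),
      e.hom.hom.app V (Q.torsor.act g q) = R.torsor.act g (e.hom.hom.app V q))
    (h₂ : ∀ {V : (Over U)ᵒᵖ} (q : Q.torsor.carrier.obj.obj V),
      R.toX.hom.app V (e.hom.hom.app V q) = Q.toX.hom.app V q) : Q ≅ R where
  hom := { hom := e.hom, equivariant := h₁, comp_toX := h₂ }
  inv :=
    have h (V : (Over U)ᵒᵖ) (x : R.torsor.carrier.obj.obj V) :
        e.hom.hom.app V (e.inv.hom.app V x) = x := by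
      have := congr_arg (fun φ => φ.hom.app V x) e.inv_hom_id
      exact this
    have h' (V : (Over U)ᵒᵖ) (x : Q.torsor.carrier.obj.obj V) :
        e.inv.hom.app V (e.hom.hom.app V x) = x := by
      have := congr_arg (fun φ => φ.hom.app V x) e.hom_inv_id
      exact this
    { hom := e.inv
      equivariant {V} g x := by
        conv_lhs => rw [← h V x, ← h₁, h']
      comp_toX {V} x := by rw [← h₂, h] }
  hom_inv_id := Hom.ext e.hom_inv_id
  inv_hom_id := Hom.ext e.inv_hom_id

/-- Pull-back along the identity. -/
@[simps!]
def pullIdIso (U : C) : pull X (𝟙 U) ≅ 𝟭 _ :=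
  NatIso.ofComponents (fun Q => isoMk ((J.overMapPullbackId (Type w) U).app Q.torsor.carrier)
      (fun {V} g q => by
        refine (Q.torsor.map_act _ _ _).trans ?_
        congr 1
        exact (congr_arg (fun φ => φ.hom g) (E.obj.map_id _)))
      (fun {V} q => by
        refine (NatTrans.naturality_apply Q.toX.hom _ _).trans ?_
        change X.carrier.obj.map (𝟙 _) _ = _
        simp; rfl))
    (fun φ => Hom.ext ((J.overMapPullbackId (Type w) U).hom.naturality φ.hom))

/-- Pull-back along a composition. -/
@[simps!]
def pullCompIso {U V W : C} (f : V ⟶ U) (g : W ⟶ V) : pull X (g ≫ f) ≅ pull X f ⋙ pull X g :=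
  NatIso.ofComponents (fun Q => isoMk ((J.overMapPullbackComp (Type w) g f).symm.app Q.torsor.carrier)
      (fun {T} e q => by
        refine (Q.torsor.map_act _ _ _).trans ?_
        congr 1
        exact (congr_arg (fun φ => φ.hom e) (E.obj.map_id _)))
      (fun {T} q => by
        refine (NatTrans.naturality_apply Q.toX.hom _ _).trans ?_
        change X.carrier.obj.map (𝟙 _) _ = _
        simp; rfl))
    (fun φ => Hom.ext ((J.overMapPullbackComp (Type w) g f).inv.naturality φ.hom))

lemma map_eq_map {U : C} (P : (Over U)ᵒᵖ ⥤ Type w) {V W : (Over U)ᵒᵖ} {a b : V ⟶ W}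
    (h : a.unop.left = b.unop.left) (q : P.obj V) : P.map a q = P.map b q := by
  have : a = b := Quiver.Hom.unop_inj (Over.OverMorphism.ext h)
  rw [this]

lemma eqToHom_app_apply {U V : C} {f g : V ⟶ U} (h : f = g)
    (e : (pull X f).toCatHom = (pull X g).toCatHom) (Q : TorsorOver (X.over U))
    (T : (Over V)ᵒᵖ) (q : ((pull X f).obj Q).torsor.carrier.obj.obj T) :
    ((eqToHom e).toNatTrans.app Q).hom.hom.app T q =
      Q.torsor.carrier.obj.map ((Over.mapCongr _ _ h).inv.app T.unop).op q := by
  subst h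
  have : ((Over.mapCongr f f rfl).inv.app T.unop).op = 𝟙 _ := by
    apply Quiver.Hom.unop_inj
    ext; simp
  rw [this]
  simp
  rfl

end TorsorOver

/-- The fibred category (as a pseudofunctor) whose fibre over `U` is the groupoid of pairs `(Q, s)` with
`Q` an `E`-torsor over `U` and `s : Q ⟶ X` an equivariant map over `U`. -/
def torsorStack {E : Sheaf J AddCommGrpCat.{w}} (X : ActionSheaf E) :
    LocallyDiscrete Cᵒᵖ ⥤ᵖ Cat :=
  LocallyDiscrete.mkPseudofunctor
    (fun U => Cat.of (TorsorOver (X.over U.unop)))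
    (fun f => (TorsorOver.pull X f.unop).toCatHom)
    (fun U => Cat.Hom.isoMk (TorsorOver.pullIdIso X U.unop))
    (fun f g => Cat.Hom.isoMk (TorsorOver.pullCompIso X f.unop g.unop))
    (fun f g h => by 
      apply Cat.Hom₂.ext
      apply NatTrans.ext
      funext Q
      apply TorsorOver.hom_ext
      intro T q
      have h₁ := TorsorOver.eqToHom_app_apply X
        (f := h.unop ≫ g.unop ≫ f.unop) (g := (h.unop ≫ g.unop) ≫ f.unop)
        (Category.assoc _ _ _).symm (by rw [Category.assoc]) Q T q
      refine Eq.trans ?_ h₁.symm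
      change Q.torsor.carrier.obj.map _ (Q.torsor.carrier.obj.map _ (Q.torsor.carrier.obj.map _
        (Q.torsor.carrier.obj.map _ q))) = _
      simp only [← Functor.map_comp_apply]
      refine (Functor.map_comp_apply Q.torsor.carrier.obj _ _ q).symm.trans ?_
      refine TorsorOver.map_eq_map Q.torsor.carrier.obj ?_ q
      simp)
    (fun {U V} f => by
      apply Cat.Hom₂.ext
      apply NatTrans.ext
      funext Q
      apply TorsorOver.hom_ext
      intro T q
      have h₁ := TorsorOver.eqToHom_app_apply X (f := f.unop ≫ 𝟙 (unop U)) (g := f.unop)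
        (Category.comp_id _) (by rw [Category.comp_id]) Q T q
      refine Eq.trans ?_ h₁.symm
      refine (Functor.map_comp_apply Q.torsor.carrier.obj _ _ q).symm.trans ?_
      refine TorsorOver.map_eq_map Q.torsor.carrier.obj ?_ q
      simp)
    (fun {U V} f => by
      apply Cat.Hom₂.ext
      apply NatTrans.ext
      funext Q
      apply TorsorOver.hom_ext
      intro T q
      have h₁ := TorsorOver.eqToHom_app_apply X (f := 𝟙 (unop V) ≫ f.unop) (g := f.unop)
        (Category.id_comp _) (by rw [Category.id_comp]) Q T q
      refine Eq.trans ?_ h₁.symm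
      refine (Functor.map_comp_apply Q.torsor.carrier.obj _ _ q).symm.trans ?_
      refine TorsorOver.map_eq_map Q.torsor.carrier.obj ?_ q
      simp)


/-- `E` acts by translations on the sheaf of sets underlying `G`, through `φ : E ⟶ G`. -/
def ActionSheaf.ofHom {E G : Sheaf J AddCommGrpCat.{w}} (φ : E ⟶ G) : ActionSheaf E where
  carrier := (sheafCompose J (forget AddCommGrpCat.{w})).obj G
  act {V} := fun e (x : G.obj.obj V) => φ.hom.app V e + x
  zero_act {V} := fun (x : G.obj.obj V) => by simp; rfl
  add_act {V} := fun e e' (x : G.obj.obj V) => by simp [add_assoc]; rfl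
  map_act {V W} f e := fun (x : G.obj.obj V) => by
    change G.obj.map f (φ.hom.app V e + x) = φ.hom.app W (E.obj.map f e) + G.obj.map f x
    rw [map_add, NatTrans.naturality_apply φ.hom f e]

/-- Global sections of `B`, i.e. generalized points `* ⟶ B`: compatible families of sections over all
objects of the site. -/
abbrev GlobalSection (B : Sheaf J AddCommGrpCat.{w}) :=
  (B.obj ⋙ forget AddCommGrpCat.{w}).sections

/-- The sections `x` of `L` with `p x = β`. -/
def fiberSubfunctor {L B : Sheaf J AddCommGrpCat.{w}} (p : L ⟶ B) (β : GlobalSection B) :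
    Subfunctor (L.obj ⋙ forget AddCommGrpCat.{w}) where
  obj V := {x | p.hom.app V x = β.1 V}
  map {V W} f x hx := by
    change p.hom.app W (L.obj.map f x) = β.1 W
    rw [NatTrans.naturality_apply p.hom f x, show p.hom.app V x = β.1 V from hx]
    exact β.2 f

/-- The fibre `L_β` of `p : L ⟶ B` over the global section `β`, as a sheaf of sets. -/
def fiberSheaf {L B : Sheaf J AddCommGrpCat.{w}} (p : L ⟶ B) (β : GlobalSection B) :
    Sheaf J (Type w) where
  obj := (fiberSubfunctor p β).toFunctor
  property := by
    rw [isSheaf_iff_isSheaf_of_type, Subfunctor.isSheaf_iff]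
    · intro U s hs
      have hB := (isSheaf_iff_isSheaf_of_type _ _).1
        ((sheafCompose J (forget AddCommGrpCat.{w})).obj B).property
      refine (hB _ hs).isSeparatedFor.ext fun V f hf => ?_
      have h₁ : p.hom.app (op V) (L.obj.map f.op s) = β.1 (op V) := hf
      rw [NatTrans.naturality_apply p.hom f.op s] at h₁
      exact h₁.trans (β.2 f.op).symm
    · exact (isSheaf_iff_isSheaf_of_type _ _).1
        ((sheafCompose J (forget AddCommGrpCat.{w})).obj L).property

/-- The action of `E` by translations, through `φ : E ⟶ L` with `φ ≫ p = 0`, on the fibre `L_β`. -/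
def fiberAction {E L B : Sheaf J AddCommGrpCat.{w}} (φ : E ⟶ L) (p : L ⟶ B) (h : φ ≫ p = 0)
    (β : GlobalSection B) : ActionSheaf E where
  carrier := fiberSheaf p β
  act {V} e x := ⟨(φ.hom.app V e + x.1 : L.obj.obj V), by
    have h₁ : p.hom.app V (φ.hom.app V e) = 0 :=
      congr_arg (fun ψ : E ⟶ B => ψ.hom.app V e) h
    have h₂ : p.hom.app V x.1 = β.1 V := x.2
    change p.hom.app V (φ.hom.app V e + x.1) = β.1 V
    rw [map_add, h₁, h₂, zero_add]⟩
  zero_act x := Subtype.ext (by simp)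
  add_act e e' x := Subtype.ext (by simp [add_assoc])
  map_act {V W} f e x := Subtype.ext (by
    change L.obj.map f (φ.hom.app V e + x.1) = φ.hom.app W (E.obj.map f e) + L.obj.map f x.1
    rw [map_add, NatTrans.naturality_apply φ.hom f e])


/-- Objects over `U` of the prestack of the complex `d : L₁ ⟶ L₀`: sections of `L₀` over `U`. -/
structure PreObj {L₁ L₀ : Sheaf J AddCommGrpCat.{w}} (d : L₁ ⟶ L₀) (U : C) :
    Type (max u v (w + 1)) where
  val : L₀.obj.obj (op U)

namespace PreObj
variable {L₁ L₀ : Sheaf J AddCommGrpCat.{w}} {d : L₁ ⟶ L₀} {U V W : C}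

/-- A morphism `g ⟶ g'` is a section `h` of `L₁` with `d h = g - g'`; composition is addition. -/
@[ext]
structure Hom (g g' : PreObj d U) : Type (max u v w) where
  val : L₁.obj.obj (op U)
  eq : d.hom.app (op U) val = g.val - g'.val

@[simps]
instance : Category (PreObj d U) where
  Hom := Hom
  id g := { val := 0, eq := by simp }
  comp h h' := { val := h.val + h'.val, eq := by rw [map_add, h.eq, h'.eq]; abel }
  id_comp h := Hom.ext (zero_add _)
  comp_id h := Hom.ext (add_zero _)
  assoc h h' h'' := Hom.ext (add_assoc _ _ _)

@[ext]
lemma hom_ext {g g' : PreObj d U} {h h' : g ⟶ g'} (e : h.val = h'.val) : h = h' := Hom.ext e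

/-- Restriction of sections. -/
@[simps]
def restrict (d : L₁ ⟶ L₀) (f : V ⟶ U) : PreObj d U ⥤ PreObj d V where
  obj g := ⟨L₀.obj.map f.op g.val⟩
  map {g g'} h := 
    { val := L₁.obj.map f.op h.val
      eq := by rw [NatTrans.naturality_apply d.hom f.op, h.eq, map_sub] }
  map_id g := Hom.ext (map_zero _)
  map_comp h h' := Hom.ext (map_add _ _ _)

/-- The isomorphism given by the zero section of `L₁`, between equal objects. -/
@[simps]
def isoOfEq {g g' : PreObj d U} (h : g.val = g'.val) : g ≅ g' where
  hom := { val := 0, eq := by simp [h] }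
  inv := { val := 0, eq := by simp [h] }
  hom_inv_id := Hom.ext (add_zero _)
  inv_hom_id := Hom.ext (add_zero _)

lemma eqToHom_val {g g' : PreObj d U} (h : g = g') : (eqToHom h).val = 0 := by
  subst h; rfl

end PreObj

/-- The prestack attached to the complex `d : L₁ ⟶ L₀`. -/
def prestack {L₁ L₀ : Sheaf J AddCommGrpCat.{w}} (d : L₁ ⟶ L₀) :
    LocallyDiscrete Cᵒᵖ ⥤ᵖ Cat.{max u v w, max u v (w + 1)} :=
  LocallyDiscrete.mkPseudofunctor
    (fun U => Cat.of (PreObj d U.unop))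
    (fun f => (PreObj.restrict d f.unop).toCatHom)
    (fun U => Cat.Hom.isoMk (NatIso.ofComponents (fun g => PreObj.isoOfEq (by simp; rfl))))
    (fun f g => Cat.Hom.isoMk (NatIso.ofComponents (fun x => PreObj.isoOfEq (by simp; rfl))))
    (fun f g h => by
      apply Cat.Hom₂.ext
      rw [Cat.Hom₂.eqToHom_toNatTrans]
      ext x
      rw [eqToHom_app]
      apply PreObj.hom_ext
      refine Eq.trans ?_ (PreObj.eqToHom_val _).symm
      change (0 : L₁.obj.obj _) + (L₁.obj.map h 0 + (0 + (0 + 0))) = 0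
      simp)
    (fun f => by
      apply Cat.Hom₂.ext
      rw [Cat.Hom₂.eqToHom_toNatTrans]
      ext x
      rw [eqToHom_app]
      apply PreObj.hom_ext
      refine Eq.trans ?_ (PreObj.eqToHom_val _).symm
      change (0 : L₁.obj.obj _) + (L₁.obj.map f 0 + 0) = 0
      simp)
    (fun f => by
      apply Cat.Hom₂.ext
      rw [Cat.Hom₂.eqToHom_toNatTrans]
      ext x
      rw [eqToHom_app]
      apply PreObj.hom_ext
      refine Eq.trans ?_ (PreObj.eqToHom_val _).symm
      change (0 : L₁.obj.obj _) + (0 + 0) = 0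
      simp)

section Gerbes
universe v' u'
variable (F : LocallyDiscrete Cᵒᵖ ⥤ᵖ Cat.{v', u'})

/-- A gerbe: a stack in groupoids that is locally non-empty and locally connected. -/
structure IsGerbe (J : GrothendieckTopology C) : Prop where
  isStack : F.IsStack J
  isGroupoid (U : C) : IsGroupoid (F.obj (.mk (op U)))
  locally_nonempty (U : C) : ∃ S ∈ J U, ∀ ⦃V : C⦄ (f : V ⟶ U), S f →
    Nonempty (F.obj (.mk (op V)))
  locally_connected (U : C) (x y : F.obj (.mk (op U))) : ∃ S ∈ J U, ∀ ⦃V : C⦄ (f : V ⟶ U), S f →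
    Nonempty ((F.map f.op.toLoc).toFunctor.obj x ⟶ (F.map f.op.toLoc).toFunctor.obj y)

/-- For all objects `x` of `F` over `U`, a map from the sections of `A` over `U` to the endomorphisms
of `x`. -/
abbrev BandData (A : Sheaf J AddCommGrpCat.{w}) :=
  ∀ ⦃U : C⦄ (x : F.obj (.mk (op U))), A.obj.obj (op U) → (x ⟶ x)

variable {F}

/-- The maps `θ x` identify the sheaf `A` with the automorphism sheaves of all objects, compatibly with
all morphisms and with restriction (for `F` fibred in groupoids, endomorphisms are automorphisms). -/
structure BandData.IsBand {A : Sheaf J AddCommGrpCat.{w}} (θ : BandData F A) : Prop where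
  bijective ⦃U : C⦄ (x : F.obj (.mk (op U))) : Function.Bijective (θ x)
  map_add ⦃U : C⦄ (x : F.obj (.mk (op U))) (a b : A.obj.obj (op U)) :
    θ x (a + b) = θ x a ≫ θ x b
  naturality ⦃U : C⦄ {x y : F.obj (.mk (op U))} (φ : x ⟶ y) (a : A.obj.obj (op U)) :
    θ x a ≫ φ = φ ≫ θ y a
  restrict ⦃U V : C⦄ (f : V ⟶ U) (x : F.obj (.mk (op U))) (a : A.obj.obj (op U)) :
    (F.map f.op.toLoc).toFunctor.map (θ x a) =
      θ ((F.map f.op.toLoc).toFunctor.obj x) (A.obj.map f.op a)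

/-- An `A`-gerbe: a gerbe banded by the abelian sheaf `A`. -/
structure IsAbelianGerbe {A : Sheaf J AddCommGrpCat.{w}} (θ : BandData F A) : Prop where
  isGerbe : IsGerbe F J
  isBand : θ.IsBand

/-- A morphism of fibred categories that is compatible with the maps from `A` to automorphisms. -/
def PreservesBand {G : LocallyDiscrete Cᵒᵖ ⥤ᵖ Cat.{v', u'}} {A : Sheaf J AddCommGrpCat.{w}}
    (η : Pseudofunctor.StrongTrans F G) (θ : BandData F A) (θ' : BandData G A) : Prop :=
  ∀ ⦃U : C⦄ (x : F.obj (.mk (op U))) (a : A.obj.obj (op U)),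
    (η.app (.mk (op U))).toFunctor.map (θ x a) = θ' ((η.app (.mk (op U))).toFunctor.obj x) a

/-- Equivalence of `A`-gerbes: a morphism of stacks that is an equivalence over each object of the site
and is compatible with the bands. -/
def AbelianGerbeEquiv {G : LocallyDiscrete Cᵒᵖ ⥤ᵖ Cat.{v', u'}} {A : Sheaf J AddCommGrpCat.{w}}
    (θ : BandData F A) (θ' : BandData G A) : Prop :=
  ∃ η : Pseudofunctor.StrongTrans F G,
    (∀ U : C, (η.app (.mk (op U))).toFunctor.IsEquivalence) ∧ PreservesBand η θ θ'

/-- `η : P ⟶ F` exhibits `F` as the stack associated with `P`: `F` is a stack, `η` is locally faithful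
and locally full (i.e. the `Hom`-sheaves of `F` are the sheafifications of the `Hom`-presheaves of
`P`), and each object of `F` is locally in the essential image of `η`. -/
structure IsAssociatedStack (J : GrothendieckTopology C) {P F : LocallyDiscrete Cᵒᵖ ⥤ᵖ Cat.{v', u'}}
    (η : Pseudofunctor.StrongTrans P F) : Prop where
  isStack : F.IsStack J
  locally_faithful ⦃U : C⦄ {x y : P.obj (.mk (op U))} (φ ψ : x ⟶ y)
    (h : (η.app _).toFunctor.map φ = (η.app _).toFunctor.map ψ) :
    ∃ S ∈ J U, ∀ ⦃V : C⦄ (f : V ⟶ U), S f →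
      (P.map f.op.toLoc).toFunctor.map φ = (P.map f.op.toLoc).toFunctor.map ψ
  locally_full ⦃U : C⦄ {x y : P.obj (.mk (op U))}
    (φ : (η.app _).toFunctor.obj x ⟶ (η.app _).toFunctor.obj y) :
    ∃ S ∈ J U, ∀ ⦃V : C⦄ (f : V ⟶ U), S f →
      ∃ ψ : (P.map f.op.toLoc).toFunctor.obj x ⟶ (P.map f.op.toLoc).toFunctor.obj y,
        (η.app _).toFunctor.map ψ = 
          (η.naturality f.op.toLoc).hom.toNatTrans.app x ≫
            (F.map f.op.toLoc).toFunctor.map φ ≫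
              (η.naturality f.op.toLoc).inv.toNatTrans.app y
  locally_essSurj ⦃U : C⦄ (y : F.obj (.mk (op U))) :
    ∃ S ∈ J U, ∀ ⦃V : C⦄ (f : V ⟶ U), S f → ∃ x : P.obj (.mk (op V)),
      Nonempty ((η.app _).toFunctor.obj x ≅ (F.map f.op.toLoc).toFunctor.obj y)

end Gerbes

section FourTerm

/-- An exact sequence `0 ⟶ A ⟶ L₁ ⟶ L₀ ⟶ B ⟶ 0` of abelian sheaves. -/
structure FourTermExact (A L₁ L₀ B : Sheaf J AddCommGrpCat.{w}) where
  ι : A ⟶ L₁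
  d : L₁ ⟶ L₀
  p : L₀ ⟶ B
  ι_d : ι ≫ d = 0
  d_p : d ≫ p = 0
  mono_ι : Mono ι
  exact₁ : (ShortComplex.mk ι d ι_d).Exact
  exact₂ : (ShortComplex.mk d p d_p).Exact
  epi_p : Epi p

namespace FourTermExact
variable {A L₁ L₀ B : Sheaf J AddCommGrpCat.{w}} (S : FourTermExact A L₁ L₀ B)
  [HasSheafify J AddCommGrpCat.{w}]

/-- The image of `d`. -/
noncomputable abbrev im : Sheaf J AddCommGrpCat.{w} := image S.d

/-- The epimorphism `L₁ ⟶ im d`. -/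
noncomputable abbrev π : L₁ ⟶ S.im := factorThruImage S.d
/-- The inclusion `im d ⟶ L₀`. -/
noncomputable abbrev j : S.im ⟶ L₀ := image.ι S.d

lemma ι_π : S.ι ≫ S.π = 0 := by
  rw [← cancel_mono (image.ι S.d), Category.assoc, image.fac, S.ι_d, zero_comp]

lemma j_p : S.j ≫ S.p = 0 := by
  rw [← cancel_epi (factorThruImage S.d), image.fac_assoc, S.d_p, comp_zero]

/-- `A ⟶ L₁ ⟶ im d`. -/
noncomputable abbrev left : ShortComplex (Sheaf J AddCommGrpCat.{w}) := .mk S.ι S.π S.ι_π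
/-- `im d ⟶ L₀ ⟶ B`. -/
noncomputable abbrev right : ShortComplex (Sheaf J AddCommGrpCat.{w}) := .mk S.j S.p S.j_p

lemma left_shortExact : S.left.ShortExact where
  exact := by
    let φ : S.left ⟶ ShortComplex.mk S.ι S.d S.ι_d :=
      { τ₁ := 𝟙 _, τ₂ := 𝟙 _, τ₃ := S.j }
    exact (ShortComplex.exact_iff_of_epi_of_isIso_of_mono φ).2 S.exact₁
  mono_f := S.mono_ι
  epi_g := inferInstance

lemma right_shortExact : S.right.ShortExact where
  exact := by
    let φ : ShortComplex.mk S.d S.p S.d_p ⟶ S.right :=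
      { τ₁ := S.π, τ₂ := 𝟙 _, τ₃ := 𝟙 _ }
    exact (ShortComplex.exact_iff_of_epi_of_isIso_of_mono φ).1 S.exact₂
  mono_f := inferInstance
  epi_g := S.epi_p

universe t
variable [HasExt.{t} (Sheaf J AddCommGrpCat.{w})]

/-- The iterated boundary `H⁰(B) ⟶ H¹(im d) ⟶ H²(A)` of the short exact sequences
`0 ⟶ im d ⟶ L₀ ⟶ B ⟶ 0` and `0 ⟶ A ⟶ L₁ ⟶ im d ⟶ 0`. -/
noncomputable def iteratedBoundary : Sheaf.H B 0 →+ Sheaf.H A 2 :=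
  (S.left_shortExact.extClass.postcomp _ (show 1 + 1 = 2 from rfl)).comp
    (S.right_shortExact.extClass.postcomp _ (zero_add 1))

end FourTermExact

universe t
/-- A global section of `B` as an element of `H⁰(B) = Ext⁰(ℤ, B)`: the morphism from the constant sheaf
`ℤ` that sends `1` to `β`. -/
noncomputable def GlobalSection.toH {B : Sheaf J AddCommGrpCat.{w}} (β : GlobalSection B)
    [HasSheafify J AddCommGrpCat.{w}] [HasExt.{t} (Sheaf J AddCommGrpCat.{w})] : Sheaf.H B 0 :=
  Abelian.Ext.mk₀ (((sheafificationAdjunction J AddCommGrpCat.{w}).homEquiv _ _).symm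
    { app V := AddCommGrpCat.ofHom ((zmultiplesHom _ (β.1 V)).comp (AddEquiv.ulift.toAddMonoidHom))
      naturality V W f := by
        refine ConcreteCategory.hom_ext _ _ fun (n : ULift.{w} ℤ) => ?_
        let b : B.obj.obj V := β.1 V
        have hb : B.obj.map f b = β.1 W := β.2 f
        change n.down • (show B.obj.obj W from β.1 W) = B.obj.map f (n.down • b)
        rw [map_zsmul, hb] })

/-- Translation by a section `e` of `E` that acts trivially on `X`, as an automorphism of `(Q, s)`. -/
def TorsorOver.translate {E : Sheaf J AddCommGrpCat.{w}} {X : ActionSheaf E} {U : C}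
    (Q : TorsorOver (X.over U)) (e : E.obj.obj (op U))
    (he : ∀ ⦃V : C⦄ (f : V ⟶ U) (x : X.carrier.obj.obj (op V)), X.act (E.obj.map f.op e) x = x) :
    Q ⟶ Q where
  hom := ⟨
    { app V := ↾fun q => Q.torsor.act (V := V) (E.obj.map V.unop.hom.op e) q
      naturality V W f := by
        ext q
        refine Eq.trans ?_ (Q.torsor.map_act f _ q).symm
        change Q.torsor.act (V := W) _ _ = Q.torsor.act (V := W) _ _
        congr 1
        change _ = E.obj.map f.unop.left.op (E.obj.map V.unop.hom.op e)
        rw [← ConcreteCategory.comp_apply, ← E.obj.map_comp, ← op_comp, Over.w] }⟩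
  equivariant {V} g q := Q.torsor.act_comm (V := V) _ g q
  comp_toX {V} q := by
    refine (Q.equivariant (V := V) _ q).trans ?_
    exact he V.unop.hom _

namespace FourTermExact
variable {A L₁ L₀ B : Sheaf J AddCommGrpCat.{w}} (S : FourTermExact A L₁ L₀ B) (β : GlobalSection B)

/-- The Picard stack of the complex `d : L₁ ⟶ L₀`: pairs of an `L₁`-torsor `Q` and an equivariant map
`Q ⟶ L₀`, where `L₁` acts on `L₀` by translations through `d`. -/
abbrev picardStack : LocallyDiscrete Cᵒᵖ ⥤ᵖ Cat := torsorStack (ActionSheaf.ofHom S.d)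

/-- The image of `(Q, s)` under the projection from the Picard stack to `B` is the section `b`. -/
def LiesOver {U : C} (Q : TorsorOver ((ActionSheaf.ofHom S.d).over U)) (b : B.obj.obj (op U)) :
    Prop :=
  ∀ ⦃V : C⦄ (f : V ⟶ U) (q : Q.torsor.carrier.obj.obj (op (Over.mk f))),
    S.p.hom.app (op V) (Q.toX.hom.app (op (Over.mk f)) q) = B.obj.map f.op b

/-- The objects of the Picard stack that the projection to `B` sends to `β`. -/
def fiberProperty : S.picardStack.ObjectProperty where
  prop U Q := S.LiesOver (U := U.as.unop) Q (β.1 U.as)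

instance : (S.fiberProperty β).IsClosedUnderMapObj where
  map_obj {U V Q} hQ f W g q := by
    refine (hQ (g ≫ f.as.unop) q).trans ?_
    refine ((β.2 (g ≫ f.as.unop).op).trans (β.2 g.op).symm)

/-- The fibre of the Picard stack over `β`. -/
abbrev fiber : LocallyDiscrete Cᵒᵖ ⥤ᵖ Cat := (S.fiberProperty β).fullsubcategory

/-- The sections `g` of `L₀` with `p g = β`. -/
def prestackFiberProperty : (prestack S.d).ObjectProperty where
  prop U g := S.p.hom.app U.as g.val = β.1 U.as

instance : (S.prestackFiberProperty β).IsClosedUnderMapObj where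
  map_obj {U V g} hg f := by
    refine (NatTrans.naturality_apply S.p.hom f.as g.val).trans ?_
    exact (congr_arg (B.obj.map f.as) hg).trans (β.2 f.as)

/-- The prestack of sections `g` of `L₀` with `p g = β`, with morphisms `g ⟶ g'` the sections `h` of `L₁`
with `d h = g - g'`. -/
abbrev prestackFiber : LocallyDiscrete Cᵒᵖ ⥤ᵖ Cat := (S.prestackFiberProperty β).fullsubcategory

lemma d_ι_apply {V : Cᵒᵖ} (a : A.obj.obj V) : S.d.hom.app V (S.ι.hom.app V a) = 0 :=
  congr_arg (fun ψ : A ⟶ L₀ => ψ.hom.app V a) S.ι_d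

/-- A section `a` of `A` acts on `g` as the automorphism `ι a`. -/
def prestackBand : BandData (S.prestackFiber β) A := fun U g a =>
  ObjectProperty.homMk
    { val := S.ι.hom.app (op U) a, eq := (S.d_ι_apply a).trans (sub_self _).symm }

/-- A section `a` of `A` acts on `(Q, s)` as the translation by `ι a`. -/
def fiberBand : BandData (S.fiber β) A := fun U Q a =>
  ObjectProperty.homMk (TorsorOver.translate (X := ActionSheaf.ofHom S.d) (U := U) Q.obj (S.ι.hom.app (op U) a)
    (fun V f (x : L₀.obj.obj (op V)) => by
      change S.d.hom.app (op V) (L₁.obj.map f.op (S.ι.hom.app (op U) a)) + x = x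
      rw [← NatTrans.naturality_apply S.ι.hom f.op, d_ι_apply, zero_add]))

variable [HasSheafify J AddCommGrpCat.{w}]

/-- The fibre `(L₀)_β` with its action of `im d` by translations. -/
noncomputable def fiberTorsor : ActionSheaf S.im := fiberAction S.j S.p S.j_p β

end FourTermExact

/-- The lifting gerbe of a `G`-torsor `P` along `π : E ⟶ G`: pairs of an `E`-torsor `Q` and a
`π`-equivariant map `Q ⟶ P`. -/
def liftingGerbe {E G : Sheaf J AddCommGrpCat.{w}} (π : E ⟶ G) (P : ActionSheaf G) :
    LocallyDiscrete Cᵒᵖ ⥤ᵖ Cat := torsorStack (P.res π)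

/-- If `ι ≫ π = 0`, a section `a` of `A` acts on `(Q, s)` as the translation by `ι a`. -/
def liftingBand {A E G : Sheaf J AddCommGrpCat.{w}} (ι : A ⟶ E) (π : E ⟶ G) (h : ι ≫ π = 0)
    (P : ActionSheaf G) : BandData (liftingGerbe π P) A := fun U Q a =>
  TorsorOver.translate (X := P.res π) (U := U) Q (ι.hom.app (op U) a)
    (fun V f x => by
      change P.act (π.hom.app (op V) (E.obj.map f.op (ι.hom.app (op U) a))) x = x
      have h₁ (b : A.obj.obj (op V)) : π.hom.app (op V) (ι.hom.app (op V) b) = 0 :=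
        congr_arg (fun ψ : A ⟶ G => ψ.hom.app (op V) b) h
      rw [← NatTrans.naturality_apply ι.hom f.op, h₁]
      exact P.zero_act (V := op V) x)


end FourTerm

section GerbeClass
universe t v' u'
variable {F : LocallyDiscrete Cᵒᵖ ⥤ᵖ Cat.{v', u'}}

/-- A family `U i` covering the final object, with, for all `i` and `j`, a family of objects covering
`U i × U j` (which need not be representable). -/
structure CechCover (J : GrothendieckTopology C) where
  I : Type (max u v w)
  U : I → C
  coversTop : J.CoversTop U
  K : I → I → Type (max u v w)
  V {i j : I} : K i j → C
  fst {i j : I} (k : K i j) : V k ⟶ U i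
  snd {i j : I} (k : K i j) : V k ⟶ U j
  covers {i j : I} {T : C} (f : T ⟶ U i) (g : T ⟶ U j) :
    ∃ S ∈ J T, ∀ ⦃T' : C⦄ (t : T' ⟶ T), S t →
      ∃ (k : K i j) (m : T' ⟶ V k), m ≫ fst k = t ≫ f ∧ m ≫ snd k = t ≫ g

/-- `ξ` is the class in `H²(A)` of the `A`-gerbe `F` with band `θ`. Choose objects `x i` over a covering
family `U i` and morphisms `α k : x j ⟶ x i` over a covering `V k` of `U i × U j`. They define an
`A`-valued Čech 2-cocycle `c` by `α k ∘ α k' = c ∘ α k''`. The class of `c` in derived functor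
cohomology is computed by dimension shifting, through `0 ⟶ A ⟶ I₀ ⟶ I₁ ⟶ R ⟶ 0` with `I₀` and `I₁`
injective: if `c` is the coboundary of a cochain `γ` in `I₀`, the image of `γ` in `I₁` is the
coboundary of `s`, and the image of `s` in `R` is the global section `ρ`, then it is the iterated
boundary of `ρ`. -/
def IsGerbeClass [HasSheafify J AddCommGrpCat.{w}] [HasExt.{t} (Sheaf J AddCommGrpCat.{w})]
    {A : Sheaf J AddCommGrpCat.{w}} (θ : BandData F A) (ξ : Sheaf.H A 2) : Prop :=
  ∃ (H : CechCover.{w} J)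
    (x : ∀ i, F.obj (.mk (op (H.U i))))
    (α : ∀ ⦃i j : H.I⦄ (k : H.K i j),
      (F.map (H.snd k).op.toLoc).toFunctor.obj (x j) ⟶
        (F.map (H.fst k).op.toLoc).toFunctor.obj (x i))
    (I₀ I₁ R : Sheaf J AddCommGrpCat.{w}) (S : FourTermExact A I₀ I₁ R)
    (γ : ∀ ⦃i j : H.I⦄ (k : H.K i j), I₀.obj.obj (op (H.V k)))
    (s : ∀ i, I₁.obj.obj (op (H.U i))) (ρ : GlobalSection R),
    Injective I₀ ∧ Injective I₁ ∧
    (∀ ⦃i j l : H.I⦄ (k : H.K i j) (k' : H.K j l) (k'' : H.K i l) ⦃T : C⦄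
      (fi : T ⟶ H.U i) (fj : T ⟶ H.U j) (fl : T ⟶ H.U l)
      (m : T ⟶ H.V k) (m' : T ⟶ H.V k') (m'' : T ⟶ H.V k'')
      (h₁ : m ≫ H.fst k = fi) (h₂ : m ≫ H.snd k = fj)
      (h₃ : m' ≫ H.fst k' = fj) (h₄ : m' ≫ H.snd k' = fl)
      (h₅ : m'' ≫ H.fst k'' = fi) (h₆ : m'' ≫ H.snd k'' = fl) (c : A.obj.obj (op T)),
      Pseudofunctor.LocallyDiscreteOpToCat.pullHom (α k') m' fl fj h₄ h₃ ≫ 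
          Pseudofunctor.LocallyDiscreteOpToCat.pullHom (α k) m fj fi h₂ h₁ =
          Pseudofunctor.LocallyDiscreteOpToCat.pullHom (α k'') m'' fl fi h₆ h₅ ≫ θ _ c →
        S.ι.hom.app (op T) c =
          I₀.obj.map m.op (γ k) + I₀.obj.map m'.op (γ k') - I₀.obj.map m''.op (γ k'')) ∧
    (∀ ⦃i j : H.I⦄ (k : H.K i j), S.d.hom.app _ (γ k) =
      I₁.obj.map (H.snd k).op (s j) - I₁.obj.map (H.fst k).op (s i)) ∧
    (∀ i, S.p.hom.app _ (s i) = ρ.1 (op (H.U i))) ∧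
    ξ = S.iteratedBoundary (GlobalSection.toH ρ)

end GerbeClass

end Stack
end PicardGerbe

universe t v u

/-!
Everything rests on a calculus of sections. Write `X` for a sheaf of sets with an action of `E`, and
consider pairs `(Q, s)` of an `E`-torsor `Q` and an equivariant map `s : Q ⟶ X`. A morphism of pairs is
determined by the image of one section, even locally (`TorsorOver.pull_hom_ext`); sections `x` of `Q`
and `y` of `R` with the same image in `X` are matched by a unique morphism
(`TorsorOver.exists_pull_hom`); and every morphism is invertible (`TorsorOver.isIso`). So a pair with a
section over `U` is, over `U`, the trivial torsor with the map `e ↦ e • x`, for a section `x` of `X`.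
All maps between torsors, between descent data and between objects of the stacks are computed on
sections from here on.

*Stacks.* Morphisms of pairs glue because sections of torsors do. A descent datum of pairs is effective:
its compatible families of sections form a sheaf, which is a torsor since it is locally isomorphic to
the given ones (`TorsorOver.isStack_torsorStack`). The condition `p ∘ s = β` is local, so its full
substack is a stack (`isStack_fullsubcategory`).

*Associated stacks.* Sending `g` to the trivial pair of `g` is fully faithful, because a morphism of
trivial pairs is the translation by the image `h` of the section `0`, with `∂ h = g - g'`; it is locally
essentially surjective because torsors have sections locally (`isAssociatedStack_prestackMap`).

*Gerbes.* If `A` is the stabilizer in `E` of every section of `X`, the automorphisms of a pair are the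
translations by sections of `A` (`TorsorOver.isBand_translateBand`). For `E = L₁` this applies to
`X = L₀` and to `X = (L₀)_β`, by exactness at `L₁`. Exactness at `L₀` makes two sections of `(L₀)_β`
locally translates of each other, so objects are locally isomorphic, and `p` being an epimorphism makes
the fibre locally non-empty. A pair with `p ∘ s = β` is the same thing as a pair over `(L₀)_β`, which
identifies the fibre with the lifting gerbe (`FourTermExact.toLiftingGerbe`).

*The class.* Let `0 ⟶ A ⟶ I₀ ⟶ I₁ ⟶ R ⟶ 0` be exact with `I₀` and `I₁` injective. The identity of `A`
extends to a morphism `(φ₁, φ₀, φ)` from `0 ⟶ A ⟶ L₁ ⟶ L₀ ⟶ B ⟶ 0` to this sequence, and naturality of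
the boundary maps gives `d² β = d² (φ β)` (`FourTermExact.iteratedBoundary_map`).

Such a morphism shows that `d² β` is a class of the fibre: for the covering by all local sections `g` of
`(L₀)_β`, with all local `h` such that `∂ h` is the difference of two of them, the data `γ = φ₁ h`,
`s = φ₀ g` and `ρ = φ β` satisfy the required equations
(`FourTermExact.isGerbeClass_iteratedBoundary`).

Conversely, let objects `x i`, morphisms `α` and data `γ`, `s`, `ρ` be given that define a class. On
sections `q` of the `x i`, the morphisms `α` are translations by sections `h` of `L₁`. The difference
`φ₁ h - γ` is a `1`-cocycle with values in the injective sheaf `I₀`, on the presheaf of all sections of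
all the `x i`, and hence of the form `e q' - e q` (`exists_primitive`). Therefore
`φ₀ (s q) - s i - d (e q)`, where the first `s` is the map to `L₀`, does not depend on `q`; it is a
global section `τ` of `I₁` with image `φ β - ρ` in `R`. As `d²` kills the image of `I₁`, the given class
`d² ρ` is `d² (φ β) = d² β` (`FourTermExact.eq_of_isGerbeClass`).
-/

namespace PicardGerbe

/-! ### Sections of sheaves -/

section Sections
universe w
variable {D : Type u} [Category.{v} D] {K : GrothendieckTopology D}

lemma sheaf_ext (F : Sheaf K (Type w)) {V : D} {x y : F.obj.obj (op V)} (Z : Sieve V)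
    (hZ : Z ∈ K V) (h : ∀ ⦃W : D⦄ (f : W ⟶ V), Z f → F.obj.map f.op x = F.obj.map f.op y) :
    x = y :=
  ((isSheaf_iff_isSheaf_of_type _ _).1 F.property _ hZ).isSeparatedFor.ext h

/-- A section that is characterized by a stable property and exists locally exists globally. -/
lemma sheaf_glue (F : Sheaf K (Type w)) {V : D}
    (P : ∀ ⦃W : D⦄, (W ⟶ V) → F.obj.obj (op W) → Prop)
    (hmap : ∀ ⦃W W' : D⦄ (f : W ⟶ V) (g : W' ⟶ W) (y : F.obj.obj (op W)), P f y →
      P (g ≫ f) (F.obj.map g.op y))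
    (huniq : ∀ ⦃W : D⦄ (f : W ⟶ V) (y y' : F.obj.obj (op W)), P f y → P f y' → y = y')
    (Z : Sieve V) (hZ : Z ∈ K V) (hex : ∀ ⦃W : D⦄ (f : W ⟶ V), Z f → ∃ y, P f y) :
    ∃ x : F.obj.obj (op V), ∀ ⦃W : D⦄ (f : W ⟶ V) (y : F.obj.obj (op W)), P f y →
      F.obj.map f.op x = y := by
  choose y hy using hex
  obtain ⟨x, hx, -⟩ := (isSheaf_iff_isSheaf_of_type _ _).1 F.property _ hZ y
    (by
      intro Y₁ Y₂ Y g₁ g₂ f₁ f₂ h₁ h₂ h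
      exact huniq _ _ _ (hmap f₁ g₁ _ (hy f₁ h₁)) (h ▸ hmap f₂ g₂ _ (hy f₂ h₂)))
  refine ⟨x, fun W f z hz => sheaf_ext F (Z.pullback f) (K.pullback_stable f hZ) ?_⟩
  intro W' g hg
  rw [← Functor.map_comp_apply, ← op_comp, hx (g ≫ f) hg]
  exact huniq _ _ _ (hy _ _) (hmap f g z hz)

lemma ab_ext (G : Sheaf K AddCommGrpCat.{w}) {V : D} {x y : G.obj.obj (op V)} (Z : Sieve V)
    (hZ : Z ∈ K V) (h : ∀ ⦃W : D⦄ (f : W ⟶ V), Z f → G.obj.map f.op x = G.obj.map f.op y) :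
    x = y :=
  sheaf_ext ((sheafCompose K (forget AddCommGrpCat.{w})).obj G) Z hZ h

lemma ab_glue (G : Sheaf K AddCommGrpCat.{w}) {V : D}
    (P : ∀ ⦃W : D⦄, (W ⟶ V) → G.obj.obj (op W) → Prop)
    (hmap : ∀ ⦃W W' : D⦄ (f : W ⟶ V) (g : W' ⟶ W) (y : G.obj.obj (op W)), P f y →
      P (g ≫ f) (G.obj.map g.op y))
    (huniq : ∀ ⦃W : D⦄ (f : W ⟶ V) (y y' : G.obj.obj (op W)), P f y → P f y' → y = y')
    (Z : Sieve V) (hZ : Z ∈ K V) (hex : ∀ ⦃W : D⦄ (f : W ⟶ V), Z f → ∃ y, P f y) :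
    ∃ x : G.obj.obj (op V), ∀ ⦃W : D⦄ (f : W ⟶ V) (y : G.obj.obj (op W)), P f y →
      G.obj.map f.op x = y :=
  sheaf_glue ((sheafCompose K (forget AddCommGrpCat.{w})).obj G) P hmap huniq Z hZ hex

lemma ab_map_comp (G : Sheaf K AddCommGrpCat.{w}) {U V W : Dᵒᵖ} (f : U ⟶ V) (g : V ⟶ W)
    (x : G.obj.obj U) : G.obj.map g (G.obj.map f x) = G.obj.map (f ≫ g) x := by
  rw [G.obj.map_comp, ConcreteCategory.comp_apply]

lemma ab_map_id (G : Sheaf K AddCommGrpCat.{w}) {U : Dᵒᵖ} (x : G.obj.obj U) :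
    G.obj.map (𝟙 U) x = x := by
  rw [G.obj.map_id, ConcreteCategory.id_apply]

lemma ab_naturality {G H : Sheaf K AddCommGrpCat.{w}} (φ : G ⟶ H) {U V : Dᵒᵖ} (f : U ⟶ V)
    (x : G.obj.obj U) : φ.hom.app V (G.obj.map f x) = H.obj.map f (φ.hom.app U x) :=
  NatTrans.naturality_apply φ.hom f x

/-- The sieve of the morphisms to `V` over whose source a property that is stable under restriction
holds. -/
def sieveOf (V : D) (P : ∀ ⦃W : D⦄, (W ⟶ V) → Prop)
    (h : ∀ ⦃W W' : D⦄ (f : W ⟶ V) (g : W' ⟶ W), P f → P (g ≫ f)) : Sieve V where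
  arrows _ f := P f
  downward_closed hf g := h _ g hf

end Sections

section ExactSections
variable {C : Type u} [Category.{v} C] {J : GrothendieckTopology C}

section
variable {G H : Sheaf J AddCommGrpCat.{max u v}}

lemma exists_local_preimage (φ : G ⟶ H) [Epi φ] {U : C} (y : H.obj.obj (op U)) :
    ∃ S ∈ J U, ∀ ⦃V : C⦄ (f : V ⟶ U), S f → ∃ x, φ.hom.app (op V) x = H.obj.map f.op y := by
  have h : Sheaf.IsLocallySurjective φ :=
    (Sheaf.isLocallySurjective_iff_epi' AddCommGrpCat.{max u v} φ).2 inferInstance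
  exact ⟨_, h.imageSieve_mem y, fun V f hf => hf⟩

end

/-- Taking sections is left exact. -/
lemma sections_exact {T : ShortComplex (Sheaf J AddCommGrpCat.{max u v})} (hT : T.Exact)
    [Mono T.f] (V : Cᵒᵖ) {x : T.X₂.obj.obj V} (hx : T.g.hom.app V x = 0) :
    ∃ y, T.f.hom.app V y = x := by
  let F := sheafToPresheaf J AddCommGrpCat.{max u v} ⋙ (evaluation _ _).obj V
  have : PreservesFiniteLimits F := inferInstance
  have h := (ShortComplex.ab_exact_iff _).1
    (hT.map_of_mono_of_preservesKernel F inferInstance inferInstance)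
  exact h x hx

lemma sections_injective {G H : Sheaf J AddCommGrpCat.{max u v}} (φ : G ⟶ H) [Mono φ] (V : Cᵒᵖ) :
    Function.Injective (φ.hom.app V) := by
  have : Mono ((sheafToPresheaf J AddCommGrpCat.{max u v} ⋙ (evaluation _ _).obj V).map φ) :=
    inferInstance
  exact (AddCommGrpCat.mono_iff_injective _).1 this

namespace FourTermExact
variable {A L₁ L₀ B : Sheaf J AddCommGrpCat.{max u v}} (S : FourTermExact A L₁ L₀ B)

lemma ι_injective (V : Cᵒᵖ) : Function.Injective (S.ι.hom.app V) :=
  have := S.mono_ι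
  sections_injective S.ι V

lemma exists_ι {V : Cᵒᵖ} {x : L₁.obj.obj V} (hx : S.d.hom.app V x = 0) :
    ∃ a, S.ι.hom.app V a = x :=
  have := S.mono_ι
  sections_exact S.exact₁ V hx

lemma exists_j {V : Cᵒᵖ} {x : L₀.obj.obj V} (hx : S.p.hom.app V x = 0) :
    ∃ c, S.j.hom.app V c = x :=
  sections_exact S.right_shortExact.exact V hx

lemma j_π (V : Cᵒᵖ) (x : L₁.obj.obj V) : S.j.hom.app V (S.π.hom.app V x) = S.d.hom.app V x :=
  congr_arg (fun φ : L₁ ⟶ L₀ => φ.hom.app V x) (image.fac S.d)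

lemma p_d (V : Cᵒᵖ) (x : L₁.obj.obj V) : S.p.hom.app V (S.d.hom.app V x) = 0 :=
  congr_arg (fun φ : L₁ ⟶ B => φ.hom.app V x) S.d_p

lemma exists_local_d {U : C} {x : L₀.obj.obj (op U)} (hx : S.p.hom.app _ x = 0) :
    ∃ Z ∈ J U, ∀ ⦃V : C⦄ (f : V ⟶ U), Z f → ∃ h, S.d.hom.app (op V) h = L₀.obj.map f.op x := by
  obtain ⟨c, rfl⟩ := S.exists_j hx
  obtain ⟨Z, hZ, h⟩ := exists_local_preimage S.π c
  refine ⟨Z, hZ, fun V f hf => ?_⟩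
  obtain ⟨y, hy⟩ := h f hf
  exact ⟨y, by rw [← S.j_π, hy, ab_naturality]⟩

lemma exists_local_p {U : C} (b : B.obj.obj (op U)) :
    ∃ Z ∈ J U, ∀ ⦃V : C⦄ (f : V ⟶ U), Z f → ∃ g, S.p.hom.app (op V) g = B.obj.map f.op b :=
  have := S.epi_p
  exists_local_preimage S.p b

end FourTermExact
end ExactSections

/-! ### Sections of pairs and morphisms of pairs -/

namespace TorsorOver
universe w
variable {C : Type u} [Category.{v} C] {J : GrothendieckTopology C}
  {E : Sheaf J AddCommGrpCat.{w}} {X : ActionSheaf E} {U U₁ U₂ U₃ V W T : C}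

/-- The sections over `f : V ⟶ U` of the torsor of a pair over `U`. -/
abbrev Sec (Q : TorsorOver (X.over U)) (f : V ⟶ U) : Type w :=
  Q.torsor.carrier.obj.obj (op (Over.mk f))

/-- Restriction of sections along `g`. The index `f'` of the restricted section is only required to be
propositionally equal to `g ≫ f`, so that no transport is needed. -/
def res (Q : TorsorOver (X.over U)) {f : V ⟶ U} (g : W ⟶ V) {f' : W ⟶ U} (h : g ≫ f = f')
    (x : Q.Sec f) : Q.Sec f' :=
  Q.torsor.carrier.obj.map (Over.homMk (U := Over.mk f') (V := Over.mk f) g h).op x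

/-- The action on sections. -/
def act (Q : TorsorOver (X.over U)) {f : V ⟶ U} (e : E.obj.obj (op V)) (x : Q.Sec f) : Q.Sec f :=
  Q.torsor.act (V := op (Over.mk f)) e x

/-- The structure map `Q ⟶ X` on sections. -/
def toSec (Q : TorsorOver (X.over U)) {f : V ⟶ U} (x : Q.Sec f) : X.carrier.obj.obj (op V) :=
  Q.toX.hom.app (op (Over.mk f)) x

section
variable (Q : TorsorOver (X.over U)) {f : V ⟶ U}

@[simp]
lemma res_id (x : Q.Sec f) (h : 𝟙 V ≫ f = f) : Q.res (𝟙 V) h x = x := by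
  have : Over.homMk (U := Over.mk f) (V := Over.mk f) (𝟙 V) h = 𝟙 _ := by ext; simp
  simp [res, this]

lemma res_res (x : Q.Sec f) (g : W ⟶ V) {f' : W ⟶ U} (h : g ≫ f = f') (g' : T ⟶ W) {f'' : T ⟶ U}
    (h' : g' ≫ f' = f'') :
    Q.res g' h' (Q.res g h x) = Q.res (g' ≫ g) (by rw [Category.assoc, h, h']) x := by
  dsimp only [res]
  rw [← Functor.map_comp_apply]
  rfl

lemma map_eq_res {T T' : (Over U)ᵒᵖ} (a : T ⟶ T') (q : Q.torsor.carrier.obj.obj T) :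
    Q.torsor.carrier.obj.map a q =
      Q.res (f := T.unop.hom) (f' := T'.unop.hom) a.unop.left (Over.w a.unop) q :=
  rfl

lemma res_eq {g g' : W ⟶ V} (e : g = g') {f' : W ⟶ U} (h : g ≫ f = f') (h' : g' ≫ f = f')
    (x : Q.Sec f) : Q.res g h x = Q.res g' h' x := by
  subst e; rfl

@[simp]
lemma zero_act (x : Q.Sec f) : Q.act 0 x = x := Q.torsor.zero_act (V := op (Over.mk f)) x

lemma add_act (e e' : E.obj.obj (op V)) (x : Q.Sec f) : Q.act (e + e') x = Q.act e (Q.act e' x) :=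
  Q.torsor.add_act (V := op (Over.mk f)) e e' x

lemma act_comm (e e' : E.obj.obj (op V)) (x : Q.Sec f) :
    Q.act e (Q.act e' x) = Q.act e' (Q.act e x) :=
  Q.torsor.act_comm (V := op (Over.mk f)) e e' x

lemma res_act (e : E.obj.obj (op V)) (x : Q.Sec f) (g : W ⟶ V) {f' : W ⟶ U} (h : g ≫ f = f') :
    Q.res g h (Q.act e x) = Q.act (E.obj.map g.op e) (Q.res g h x) :=
  Q.torsor.map_act (V := op (Over.mk f)) _ e x

lemma toSec_res (x : Q.Sec f) (g : W ⟶ V) {f' : W ⟶ U} (h : g ≫ f = f') :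
    Q.toSec (Q.res g h x) = X.carrier.obj.map g.op (Q.toSec x) :=
  NatTrans.naturality_apply Q.toX.hom _ x

lemma toSec_act (e : E.obj.obj (op V)) (x : Q.Sec f) : Q.toSec (Q.act e x) = X.act e (Q.toSec x) :=
  Q.equivariant (V := op (Over.mk f)) e x

lemma exists_act (x y : Q.Sec f) : ∃ e : E.obj.obj (op V), Q.act e x = y :=
  (Q.isTorsor.existsUnique_act (op (Over.mk f)) x y).exists

lemma act_injective (x : Q.Sec f) {e e' : E.obj.obj (op V)} (h : Q.act e x = Q.act e' x) : e = e' :=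
  (Q.isTorsor.existsUnique_act (op (Over.mk f)) x _).unique h rfl

lemma exists_cover (f : V ⟶ U) : ∃ Z ∈ J V, ∀ ⦃W : C⦄ (g : W ⟶ V), Z g → Nonempty (Q.Sec (g ≫ f)) := by
  obtain ⟨S, hS, h⟩ := Q.isTorsor.locally_nonempty (Over.mk f)
  rw [GrothendieckTopology.mem_over_iff] at hS
  refine ⟨_, hS, fun W g hg => ?_⟩
  have : S (Over.homMk (U := Over.mk (g ≫ f)) (V := Over.mk f) g rfl) := by
    simpa using (Sieve.overEquiv_iff S g).1 hg
  exact h _ this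

lemma sec_ext {x y : Q.Sec f} (Z : Sieve V) (hZ : Z ∈ J V)
    (h : ∀ ⦃W : C⦄ (g : W ⟶ V), Z g → Q.res g rfl x = Q.res g rfl y) : x = y := by
  refine sheaf_ext Q.torsor.carrier ((Sieve.overEquiv (Over.mk f)).symm Z) ?_ ?_
  · rw [GrothendieckTopology.mem_over_iff]; simpa using hZ
  · intro W g hg
    have h1 := h g.left ((Sieve.overEquiv_symm_iff Z g).1 hg)
    have key (z : Q.Sec f) : Q.torsor.carrier.obj.map g.op z =
        Q.res (f' := W.hom) (𝟙 _) (by simpa using Over.w g) (Q.res g.left rfl z) := by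
      rw [res_res, map_eq_res]
      exact Q.res_eq (by simp) _ _ _
    rw [key, key, h1]

/-- Gluing of sections of a torsor. -/
lemma sec_glue (f : V ⟶ U) (P : ∀ ⦃W : C⦄ (g : W ⟶ V), Q.Sec (g ≫ f) → Prop)
    (hmap : ∀ ⦃W W' : C⦄ (g : W ⟶ V) (g' : W' ⟶ W) (y : Q.Sec (g ≫ f)), P g y →
      P (g' ≫ g) (Q.res g' (by simp) y))
    (huniq : ∀ ⦃W : C⦄ (g : W ⟶ V) (y y' : Q.Sec (g ≫ f)), P g y → P g y' → y = y')
    (Z : Sieve V) (hZ : Z ∈ J V) (hex : ∀ ⦃W : C⦄ (g : W ⟶ V), Z g → ∃ y, P g y) :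
    ∃ x : Q.Sec f, ∀ ⦃W : C⦄ (g : W ⟶ V) (y : Q.Sec (g ≫ f)), P g y → Q.res g rfl x = y := by
  obtain ⟨x, hx⟩ := sheaf_glue Q.torsor.carrier (V := Over.mk f)
    (fun W g y => P g.left (Q.res (f := W.hom) (𝟙 _) (by simpa using (Over.w g).symm) y))
    (fun W W' g k y hy => by
      have := hmap g.left k.left _ hy
      have e : k.left ≫ g.left = (k ≫ g).left := by simp
      simp only [map_eq_res, res_res] at this ⊢
      convert! this using 1
      exact Q.res_eq (by simp) _ _ _)
    (fun W g y y' hy hy' => by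
      have := congrArg (Q.res (f' := W.hom) (𝟙 _) (by simpa using Over.w g)) (huniq g.left _ _ hy hy')
      simp only [res_res] at this
      simpa using this)
    ((Sieve.overEquiv (Over.mk f)).symm Z) (by
      rw [GrothendieckTopology.mem_over_iff]; simpa using hZ)
    (fun W g hg => by
      obtain ⟨y, hy⟩ := hex g.left ((Sieve.overEquiv_symm_iff Z g).1 hg)
      refine ⟨Q.res (f' := W.hom) (𝟙 _) (by simpa using Over.w g) y, ?_⟩
      simpa only [res_res, Category.comp_id, res_id] using hy)
  refine ⟨x, fun W g y hy => ?_⟩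
  refine hx (Over.homMk (U := Over.mk (g ≫ f)) (V := Over.mk f) g rfl) y ?_
  change P g (Q.res (f' := g ≫ f) (𝟙 W) (Category.id_comp _) y)
  rwa [Q.res_id]

end

section Pull

variable {Q : TorsorOver (X.over U₁)} {R : TorsorOver (X.over U₂)} {P : TorsorOver (X.over U₃)}
  {f₁ : T ⟶ U₁} {f₂ : T ⟶ U₂} {f₃ : T ⟶ U₃}

/-- The map on sections given by a morphism between pull-backs of pairs. -/
def appSec (φ : (pull X f₁).obj Q ⟶ (pull X f₂).obj R) (g : V ⟶ T) (x : Q.Sec (g ≫ f₁)) :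
    R.Sec (g ≫ f₂) :=
  φ.hom.hom.app (op (Over.mk g)) x

lemma appSec_res (φ : (pull X f₁).obj Q ⟶ (pull X f₂).obj R) (g : V ⟶ T) (k : W ⟶ V)
    (x : Q.Sec (g ≫ f₁)) :
    appSec φ (k ≫ g) (Q.res k (by simp) x) = R.res k (by simp) (appSec φ g x) :=
  NatTrans.naturality_apply φ.hom.hom
    (Over.homMk (U := Over.mk (k ≫ g)) (V := Over.mk g) k rfl).op x

/-- The map on sections given by a morphism between pull-backs of pairs, with flexible indices. -/
def pullSec (φ : (pull X f₁).obj Q ⟶ (pull X f₂).obj R) (g : V ⟶ T) {a : V ⟶ U₁} {b : V ⟶ U₂}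
    (ha : g ≫ f₁ = a) (hb : g ≫ f₂ = b) (x : Q.Sec a) : R.Sec b :=
  R.res (f := g ≫ f₂) (𝟙 _) (by simpa using hb)
    (appSec φ g (Q.res (f' := g ≫ f₁) (𝟙 _) (by simpa using ha.symm) x))

/-- The map on sections over `f₁` given by a morphism between pull-backs of pairs. -/
abbrev onSec (φ : (pull X f₁).obj Q ⟶ (pull X f₂).obj R) (x : Q.Sec f₁) : R.Sec f₂ :=
  pullSec φ (𝟙 T) (Category.id_comp _) (Category.id_comp _) x

lemma pullSec_rfl (φ : (pull X f₁).obj Q ⟶ (pull X f₂).obj R) (g : V ⟶ T) (x : Q.Sec (g ≫ f₁)) :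
    pullSec φ g rfl rfl x = appSec φ g x := by
  simp [pullSec]

lemma pullSec_res (φ : (pull X f₁).obj Q ⟶ (pull X f₂).obj R) (g : V ⟶ T) {a : V ⟶ U₁} {b : V ⟶ U₂}
    (ha : g ≫ f₁ = a) (hb : g ≫ f₂ = b) (x : Q.Sec a) (k : W ⟶ V) {a' : W ⟶ U₁} {b' : W ⟶ U₂}
    (ha' : k ≫ a = a') (hb' : k ≫ b = b') {g' : W ⟶ T} (hg : k ≫ g = g') (h₁ : g' ≫ f₁ = a')
    (h₂ : g' ≫ f₂ = b') :
    R.res k hb' (pullSec φ g ha hb x) = pullSec φ g' h₁ h₂ (Q.res k ha' x) := by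
  subst hg ha hb h₁ h₂
  rw [pullSec_rfl, pullSec_rfl]
  have h3 := congrArg (R.res (f' := (k ≫ g) ≫ f₂) (𝟙 _) (by simp)) (appSec_res φ g k x)
  simpa only [res_res, Category.id_comp, res_id] using h3.symm

lemma pullSec_act (φ : (pull X f₁).obj Q ⟶ (pull X f₂).obj R) (g : V ⟶ T) {a : V ⟶ U₁} {b : V ⟶ U₂}
    (ha : g ≫ f₁ = a) (hb : g ≫ f₂ = b) (e : E.obj.obj (op V)) (x : Q.Sec a) :
    pullSec φ g ha hb (Q.act e x) = R.act e (pullSec φ g ha hb x) := by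
  subst ha hb
  rw [pullSec_rfl, pullSec_rfl]
  exact φ.equivariant (V := op (Over.mk g)) e x

lemma toSec_pullSec (φ : (pull X f₁).obj Q ⟶ (pull X f₂).obj R) (g : V ⟶ T) {a : V ⟶ U₁} {b : V ⟶ U₂}
    (ha : g ≫ f₁ = a) (hb : g ≫ f₂ = b) (x : Q.Sec a) :
    R.toSec (pullSec φ g ha hb x) = Q.toSec x := by
  subst ha hb
  rw [pullSec_rfl]
  exact φ.comp_toX (V := op (Over.mk g)) x

lemma pullSec_comp (φ : (pull X f₁).obj Q ⟶ (pull X f₂).obj R)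
    (ψ : (pull X f₂).obj R ⟶ (pull X f₃).obj P) (g : V ⟶ T) {a : V ⟶ U₁} {b : V ⟶ U₂} {c : V ⟶ U₃}
    (ha : g ≫ f₁ = a) (hb : g ≫ f₂ = b) (hc : g ≫ f₃ = c) (x : Q.Sec a) :
    pullSec (φ ≫ ψ) g ha hc x = pullSec ψ g hb hc (pullSec φ g ha hb x) := by
  subst ha hb hc
  rw [pullSec_rfl, pullSec_rfl, pullSec_rfl]
  rfl

lemma pullSec_map {Q' : TorsorOver (X.over U₁)} (φ : Q ⟶ Q') (g : V ⟶ T) {a : V ⟶ U₁}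
    (ha : g ≫ f₁ = a) (x : Q.Sec a) :
    pullSec ((pull X f₁).map φ) g ha ha x = φ.hom.hom.app (op (Over.mk a)) x := by
  subst ha
  rw [pullSec_rfl]
  rfl

/-- A morphism between pull-backs of pairs is determined locally by the image of one section. -/
lemma pull_hom_ext {φ ψ : (pull X f₁).obj Q ⟶ (pull X f₂).obj R} (Z : Sieve T) (hZ : Z ∈ J T)
    (h : ∀ ⦃V : C⦄ (g : V ⟶ T), Z g → ∃ x : Q.Sec (g ≫ f₁),
      pullSec φ g rfl rfl x = pullSec ψ g rfl rfl x) : φ = ψ := by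
  apply hom_ext
  intro V' q
  obtain ⟨V, g, rfl⟩ : ∃ (V : C) (g : V ⟶ T), V' = op (Over.mk g) := ⟨_, V'.unop.hom, rfl⟩
  change Q.Sec (g ≫ f₁) at q
  change appSec φ g q = appSec ψ g q
  rw [← pullSec_rfl, ← pullSec_rfl]
  refine R.sec_ext (Z.pullback g) (J.pullback_stable g hZ) fun W k hk => ?_
  rw [pullSec_res _ _ _ _ _ _ (Category.assoc _ _ _).symm rfl rfl rfl (by simp),
    pullSec_res _ _ _ _ _ _ (Category.assoc _ _ _).symm rfl rfl rfl (by simp)]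
  obtain ⟨x, hx⟩ := h _ hk
  obtain ⟨e, he⟩ := Q.exists_act x (Q.res k (by simp) q)
  rw [← he]
  have key (χ : (pull X f₁).obj Q ⟶ (pull X f₂).obj R) (y : Q.Sec ((k ≫ g) ≫ f₁))
      (hb : (k ≫ g) ≫ f₂ = k ≫ g ≫ f₂) : pullSec χ (k ≫ g) rfl hb y =
      R.res (𝟙 _) (by simp) (pullSec χ (k ≫ g) rfl rfl y) := by
    rw [pullSec_res _ _ _ _ _ _ (Category.id_comp _) (by simp) (Category.id_comp _) rfl hb]
    simp
  rw [key, key, pullSec_act, pullSec_act, hx]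

lemma pull_hom_ext_of_sec {φ ψ : (pull X f₁).obj Q ⟶ (pull X f₂).obj R} (x : Q.Sec f₁)
    (h : onSec φ x = onSec ψ x) : φ = ψ := by
  refine pull_hom_ext ⊤ (J.top_mem _) fun V g _ => ⟨Q.res g rfl x, ?_⟩
  rw [← pullSec_res φ (𝟙 T) (Category.id_comp _) (Category.id_comp _) x g rfl rfl (by simp),
    ← pullSec_res ψ (𝟙 T) (Category.id_comp _) (Category.id_comp _) x g rfl rfl (by simp)]
  exact congrArg _ h

/-- Sections of two pairs with the same image in `X` are identified by a (unique) morphism. -/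
lemma exists_pull_hom (x : Q.Sec f₁) (y : R.Sec f₂) (h : Q.toSec x = R.toSec y) :
    ∃ φ : (pull X f₁).obj Q ⟶ (pull X f₂).obj R,
      onSec φ x = y := by
  choose e he using fun (V : (Over T)ᵒᵖ) (q : Q.Sec (V.unop.hom ≫ f₁)) =>
    Q.exists_act (Q.res V.unop.hom rfl x) q
  have key (V : (Over T)ᵒᵖ) (q : Q.Sec (V.unop.hom ≫ f₁)) (e' : E.obj.obj (op V.unop.left))
      (he' : Q.act e' (Q.res V.unop.hom rfl x) = q) : e V q = e' :=
    Q.act_injective _ ((he V q).trans he'.symm)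
  let φ : (pull X f₁).obj Q ⟶ (pull X f₂).obj R :=
    { hom := ⟨{
        app V := ↾fun (q : Q.Sec (V.unop.hom ≫ f₁)) =>
          (R.act (e V q) (R.res V.unop.hom rfl y) : R.Sec (V.unop.hom ≫ f₂))
        naturality V V' k := by
          ext q
          have hw := Over.w k.unop
          change Q.Sec (V.unop.hom ≫ f₁) at q
          change R.act (e V' (Q.res (f' := V'.unop.hom ≫ f₁) k.unop.left (by simp) q)) _ =
            R.res (f' := V'.unop.hom ≫ f₂) k.unop.left (by simp) (R.act (e V q) _)
          rw [res_act, res_res, key V' _ (E.obj.map k.unop.left.op (e V q))]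
          · congr 1
            exact R.res_eq (by simp) _ _ _
          · conv_rhs => rw [← he V q]
            rw [res_act, res_res]
            congr 1
            exact Q.res_eq (by simp) _ _ _ }⟩
      equivariant := fun {V} (a : E.obj.obj (op V.unop.left)) (q : Q.Sec (V.unop.hom ≫ f₁)) => by
        change R.act (e V (Q.act a q)) _ = R.act a (R.act (e V q) _)
        rw [← add_act, key V _ (a + e V q)]
        rw [add_act, he]
      comp_toX {V} q := by
        change Q.Sec (V.unop.hom ≫ f₁) at q
        change R.toSec (R.act (e V q) _) = Q.toSec q
        conv_rhs => rw [← he V q]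
        rw [toSec_act, toSec_act, toSec_res, toSec_res, h] }
  refine ⟨φ, ?_⟩
  have h0 : e (op (Over.mk (𝟙 T))) (Q.res (f' := 𝟙 T ≫ f₁) (𝟙 T) (by simp) x) = 0 :=
    key _ _ _ (by rw [zero_act]; rfl)
  change R.res (f := 𝟙 T ≫ f₂) _ _ (R.act (e (op (Over.mk (𝟙 T))) _)
    (R.res (f' := 𝟙 T ≫ f₂) (𝟙 T) rfl y)) = y
  rw [h0, zero_act, res_res]
  simp

end Pull

section Iso

variable {Q R : TorsorOver (X.over U)}

/-- Every morphism of pairs is an isomorphism, as an equivariant map of torsors is bijective. -/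
instance isIso (φ : Q ⟶ R) : IsIso φ := by
  have hb (V : (Over U)ᵒᵖ) : Function.Bijective (φ.hom.hom.app V) := by
    constructor
    · intro x y h
      obtain ⟨e, rfl⟩ := (Q.isTorsor.existsUnique_act V x y).exists
      rw [φ.equivariant] at h
      have : e = 0 := (R.isTorsor.existsUnique_act V _ _).unique h.symm (R.torsor.zero_act _)
      rw [this, Q.torsor.zero_act]
    · intro y
      obtain ⟨W, f, rfl⟩ : ∃ (W : C) (f : W ⟶ U), V = op (Over.mk f) := ⟨_, V.unop.hom, rfl⟩
      have inj : ∀ {W' : C} (f : W' ⟶ U) (x x' : Q.Sec f),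
          φ.hom.hom.app (op (Over.mk f)) x = φ.hom.hom.app (op (Over.mk f)) x' → x = x' := by
        intro W' f x x' h
        obtain ⟨e, rfl⟩ := Q.exists_act x x'
        have h2 := h.trans (φ.equivariant (V := op (Over.mk f)) e x)
        have : e = 0 := R.act_injective (φ.hom.hom.app (op (Over.mk f)) x)
          (h2.symm.trans (R.zero_act _).symm)
        rw [this, Q.zero_act]
      have nat : ∀ {W' W : C} {f : W ⟶ U} (g : W' ⟶ W) {f' : W' ⟶ U} (h : g ≫ f = f') (x : Q.Sec f),
          φ.hom.hom.app (op (Over.mk f')) (Q.res g h x) =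
            R.res g h (φ.hom.hom.app (op (Over.mk f)) x) := by
        intro W' W f g f' h x
        exact NatTrans.naturality_apply φ.hom.hom _ x
      obtain ⟨Z, hZ, hne⟩ := Q.exists_cover f
      obtain ⟨x, hx⟩ := Q.sec_glue f
        (fun W' g x => φ.hom.hom.app (op (Over.mk (g ≫ f))) x = R.res g rfl y)
        (fun W W' g g' x hx => by rw [nat, hx, res_res])
        (fun W g x x' hx hx' => inj _ _ _ (hx.trans hx'.symm)) Z hZ
        (fun W' g hg => by
          obtain ⟨x⟩ := hne g hg
          obtain ⟨e, he⟩ := R.exists_act (φ.hom.hom.app (op (Over.mk (g ≫ f))) x) (R.res g rfl y)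
          exact ⟨Q.act e x, (φ.equivariant (V := op (Over.mk (g ≫ f))) e x).trans he⟩)
      refine ⟨x, R.sec_ext Z hZ fun W' g hg => ?_⟩
      obtain ⟨x'⟩ := hne g hg
      obtain ⟨e, he⟩ := R.exists_act (φ.hom.hom.app (op (Over.mk (g ≫ f))) x') (R.res g rfl y)
      have he' := (φ.equivariant (V := op (Over.mk (g ≫ f))) e x').trans he
      rw [← nat, hx g _ he']
      exact he'
  have h1 : IsIso φ.hom.hom := by
    rw [NatTrans.isIso_iff_isIso_app]
    intro V
    exact (isIso_iff_bijective _).2 (hb V)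
  have h2 : IsIso φ.hom := by
    have : IsIso ((sheafToPresheaf _ _).map φ.hom) := h1
    exact isIso_of_reflects_iso φ.hom (sheafToPresheaf _ _)
  exact (isoMk (asIso φ.hom) φ.equivariant φ.comp_toX).isIso_hom

end Iso

end TorsorOver

/-! ### The fibred category of pairs on sections -/

namespace TorsorOver
open Pseudofunctor Pseudofunctor.LocallyDiscreteOpToCat
universe w
variable {C : Type u} [Category.{v} C] {J : GrothendieckTopology C}
  {E : Sheaf J AddCommGrpCat.{w}} {X : ActionSheaf E} {U U₁ U₂ U₃ V W T : C}

lemma toLoc_comp_eq {f : V ⟶ U} {g : W ⟶ V} {fg : W ⟶ U} (h : g ≫ f = fg) :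
    f.op.toLoc ≫ g.op.toLoc = fg.op.toLoc := by
  subst h; rfl

/-- The comparison of the pull-back along a composition with the iterated pull-back. -/
def compHom (f : V ⟶ U) (g : W ⟶ V) (fg : W ⟶ U) (h : g ≫ f = fg)
    (Q : TorsorOver (X.over U)) : (pull X fg).obj Q ⟶ (pull X g).obj ((pull X f).obj Q) :=
  ((torsorStack X).mapComp' f.op.toLoc g.op.toLoc fg.op.toLoc (toLoc_comp_eq h)).hom.toNatTrans.app Q

/-- The comparison of the iterated pull-back with the pull-back along a composition. -/
def compInv (f : V ⟶ U) (g : W ⟶ V) (fg : W ⟶ U) (h : g ≫ f = fg)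
    (Q : TorsorOver (X.over U)) : (pull X g).obj ((pull X f).obj Q) ⟶ (pull X fg).obj Q :=
  ((torsorStack X).mapComp' f.op.toLoc g.op.toLoc fg.op.toLoc (toLoc_comp_eq h)).inv.toNatTrans.app Q

lemma appSec_compHom (f : V ⟶ U) (g : W ⟶ V) (fg : W ⟶ U) (h : g ≫ f = fg)
    (Q : TorsorOver (X.over U)) {T : C} (k : T ⟶ W)
    (x : Q.Sec (k ≫ fg)) :
    appSec (compHom f g fg h Q) k x = Q.res (f' := (k ≫ g) ≫ f) (𝟙 _) (by simp [h]) x := by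
  subst h
  exact congrArg (fun i : (torsorStack X).map (f.op.toLoc ≫ g.op.toLoc) ≅
    (torsorStack X).map f.op.toLoc ≫ (torsorStack X).map g.op.toLoc =>
      appSec (R := (pull X f).obj Q) ((Iso.hom i).toNatTrans.app Q) k x)
    ((torsorStack X).mapComp'_eq_mapComp f.op.toLoc g.op.toLoc)

lemma appSec_compInv (f : V ⟶ U) (g : W ⟶ V) (fg : W ⟶ U) (h : g ≫ f = fg)
    (Q : TorsorOver (X.over U)) {T : C} (k : T ⟶ W)
    (x : Q.Sec ((k ≫ g) ≫ f)) :
    appSec (compInv f g fg h Q) k x = Q.res (f' := k ≫ fg) (𝟙 _) (by simp [h]) x := by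
  subst h
  exact congrArg (fun i : (torsorStack X).map (f.op.toLoc ≫ g.op.toLoc) ≅
    (torsorStack X).map f.op.toLoc ≫ (torsorStack X).map g.op.toLoc =>
      appSec (Q := (pull X f).obj Q) ((Iso.inv i).toNatTrans.app Q) k x)
    ((torsorStack X).mapComp'_eq_mapComp f.op.toLoc g.op.toLoc)

lemma pullSec_compHom (f : V ⟶ U) (g : W ⟶ V) (fg : W ⟶ U) (h : g ≫ f = fg)
    (Q : TorsorOver (X.over U)) {T : C} (k : T ⟶ W) {a : T ⟶ U} {b : T ⟶ V} (ha : k ≫ fg = a)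
    (hb : k ≫ g = b) (x : Q.Sec a) :
    pullSec (R := (pull X f).obj Q) (compHom f g fg h Q) k ha hb x =
      Q.res (f' := b ≫ f) (𝟙 _) (by simp [← ha, ← hb, h]) x := by
  subst ha hb
  rw [pullSec_rfl, appSec_compHom _ _ _ h]

lemma pullSec_compInv (f : V ⟶ U) (g : W ⟶ V) (fg : W ⟶ U) (h : g ≫ f = fg)
    (Q : TorsorOver (X.over U)) {T : C} (k : T ⟶ W) {a : T ⟶ V} {b : T ⟶ U} (ha : k ≫ g = a)
    (hb : k ≫ fg = b) (x : Q.Sec (a ≫ f)) :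
    pullSec (Q := (pull X f).obj Q) (compInv f g fg h Q) k ha hb x =
      Q.res (f' := b) (𝟙 _) (by simp [← ha, ← hb, h]) x := by
  subst ha hb
  exact (pullSec_rfl (Q := (pull X f).obj Q) (compInv f g fg h Q) k x).trans
    (appSec_compInv _ _ _ h _ _ _)

section
variable {Q : TorsorOver (X.over U₁)} {R : TorsorOver (X.over U₂)}
  {f₁ : T ⟶ U₁} {f₂ : T ⟶ U₂}

/-- The pull-back of a morphism between pull-backs of pairs. -/
abbrev pullPull (φ : (pull X f₁).obj Q ⟶ (pull X f₂).obj R)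
    (g : V ⟶ T) (gf₁ : V ⟶ U₁) (gf₂ : V ⟶ U₂) (hgf₁ : g ≫ f₁ = gf₁) (hgf₂ : g ≫ f₂ = gf₂) :
    (pull X gf₁).obj Q ⟶ (pull X gf₂).obj R :=
  pullHom (F := torsorStack X) φ g gf₁ gf₂ hgf₁ hgf₂

lemma pullSec_pullPull (φ : (pull X f₁).obj Q ⟶ (pull X f₂).obj R)
    (g : V ⟶ T) (gf₁ : V ⟶ U₁) (gf₂ : V ⟶ U₂) (hgf₁ : g ≫ f₁ = gf₁) (hgf₂ : g ≫ f₂ = gf₂)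
    (k : W ⟶ V) {a : W ⟶ U₁} {b : W ⟶ U₂} (ha : k ≫ gf₁ = a) (hb : k ≫ gf₂ = b)
    (x : Q.Sec a) :
    pullSec (pullPull φ g gf₁ gf₂ hgf₁ hgf₂) k ha hb x =
      pullSec φ (k ≫ g) (by rw [← ha, ← hgf₁, Category.assoc])
        (by rw [← hb, ← hgf₂, Category.assoc]) x := by
  subst hgf₁ hgf₂ ha hb
  rw [pullSec_rfl]
  have h₁ := appSec_compHom (X := X) f₁ g (g ≫ f₁) rfl Q k x
  have h₂ := appSec_compInv (X := X) f₂ g (g ≫ f₂) rfl R k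
    (appSec φ (k ≫ g) (Q.res (𝟙 _) (by simp) x))
  refine Eq.trans ?_ h₂
  rw [← h₁]
  rfl

end

section Descent
variable {ι : Type t} {S : C} {Y : ι → C} {p : ∀ i, Y i ⟶ S} (D : (torsorStack X).DescentData p)

/-- The pairs of a descent datum. -/
abbrev descObj (i : ι) : TorsorOver (X.over (Y i)) := D.obj i

/-- The comparison maps of a descent datum, on sections. -/
def tr {i j : ι} (f : T ⟶ Y i) (g : T ⟶ Y j) (h : f ≫ p i = g ≫ p j) (x : (descObj D i).Sec f) :
    (descObj D j).Sec g :=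
  onSec (f₁ := f) (f₂ := g) (D.hom (f ≫ p i) f g rfl h.symm) x

variable {D}

lemma pullSec_descent {i j : ι} (q : T ⟶ S) (f : T ⟶ Y i) (g : T ⟶ Y j) (hf : f ≫ p i = q)
    (hg : g ≫ p j = q) (k : V ⟶ T) {a : V ⟶ Y i} {b : V ⟶ Y j} (ha : k ≫ f = a) (hb : k ≫ g = b)
    (h : a ≫ p i = b ≫ p j) (x : (descObj D i).Sec a) :
    pullSec (f₁ := f) (f₂ := g) (Q := descObj D i) (R := descObj D j) (D.hom q f g hf hg) k ha hb x =
      tr D a b h x := by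
  have := D.pullHom_hom k q (a ≫ p i) (by rw [← ha, Category.assoc, hf]) f g hf hg a b ha hb
  dsimp only [tr]
  rw [← this]
  refine Eq.trans ?_ (pullSec_pullPull (f₁ := f) (f₂ := g) (Q := descObj D i) (R := descObj D j)
    (D.hom q f g hf hg) k a b ha hb (𝟙 V) (Category.id_comp _) (Category.id_comp _) x).symm
  have e : k = 𝟙 V ≫ k := (Category.id_comp _).symm
  congr 1

lemma tr_tr {i j l : ι} (f : T ⟶ Y i) (g : T ⟶ Y j) (k : T ⟶ Y l) (h : f ≫ p i = g ≫ p j)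
    (h' : g ≫ p j = k ≫ p l) (x : (descObj D i).Sec f) :
    tr D g k h' (tr D f g h x) = tr D f k (h.trans h') x := by
  dsimp only [tr]
  rw [← D.hom_comp (f ≫ p i) f g k rfl h.symm (h.trans h').symm]
  refine Eq.trans ?_ (pullSec_comp (Q := descObj D i) (R := descObj D j) (P := descObj D l)
    (f₁ := f) (f₂ := g) (f₃ := k) _ _ (𝟙 T) _ (Category.id_comp _) _ x).symm
  have key (q q' : T ⟶ S) (e : q = q') (h₁ : g ≫ p j = q) (h₂ : k ≫ p l = q) (y) :
      onSec (Q := descObj D j) (R := descObj D l) (f₁ := g) (f₂ := k) (D.hom q g k h₁ h₂) y =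
        onSec (Q := descObj D j) (R := descObj D l) (f₁ := g) (f₂ := k)
          (D.hom q' g k (h₁.trans e) (h₂.trans e)) y := by
    subst e; rfl
  exact key _ _ h.symm _ _ _

lemma tr_res {i j : ι} (f : T ⟶ Y i) (g : T ⟶ Y j) (h : f ≫ p i = g ≫ p j)
    (x : (descObj D i).Sec f) (k : V ⟶ T) {f' : V ⟶ Y i} {g' : V ⟶ Y j} (hf : k ≫ f = f')
    (hg : k ≫ g = g') (h' : f' ≫ p i = g' ≫ p j) :
    tr D f' g' h' ((descObj D i).res k hf x) = (descObj D j).res k hg (tr D f g h x) := by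
  rw [← pullSec_descent (f ≫ p i) f g rfl h.symm k hf hg]
  exact (pullSec_res (f₁ := f) (f₂ := g) (Q := descObj D i) (R := descObj D j)
    (D.hom (f ≫ p i) f g rfl h.symm) (𝟙 T) (Category.id_comp _) (Category.id_comp _) x k hf hg
    (Category.comp_id _) _ _).symm

lemma tr_act {i j : ι} (f : T ⟶ Y i) (g : T ⟶ Y j) (h : f ≫ p i = g ≫ p j)
    (e : E.obj.obj (op T)) (x : (descObj D i).Sec f) :
    tr D f g h ((descObj D i).act e x) = (descObj D j).act e (tr D f g h x) :=
  pullSec_act (f₁ := f) (f₂ := g) (Q := descObj D i) (R := descObj D j) _ _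
    (Category.id_comp _) (Category.id_comp _) _ _

lemma toSec_tr {i j : ι} (f : T ⟶ Y i) (g : T ⟶ Y j) (h : f ≫ p i = g ≫ p j)
    (x : (descObj D i).Sec f) :
    (descObj D j).toSec (tr D f g h x) = (descObj D i).toSec x :=
  toSec_pullSec (f₁ := f) (f₂ := g) (Q := descObj D i) (R := descObj D j) _ _
    (Category.id_comp _) (Category.id_comp _) _

/-- The comparison maps of the descent datum of a pair are the identity on sections, up to the choice of
indices. -/
lemma tr_ofObj (Q : TorsorOver (X.over S)) {i j : ι} (f : T ⟶ Y i) (g : T ⟶ Y j)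
    (h : f ≫ p i = g ≫ p j)
    (x : Q.Sec (f ≫ p i)) :
    tr (D := .ofObj (F := torsorStack X) (f := p) Q) f g h x =
      Q.res (f' := g ≫ p j) (𝟙 _) (by rw [h, Category.id_comp]) x := by
  have h₁ := pullSec_comp (Q := (pull X (p i)).obj Q) (f₁ := f) (f₂ := f ≫ p i) (f₃ := g)
    (R := Q) (P := (pull X (p j)).obj Q)
    (compInv (p i) f (f ≫ p i) rfl Q) (compHom (p j) g (f ≫ p i) h.symm Q) (𝟙 T)
    (Category.id_comp _) (Category.id_comp _) (Category.id_comp _) x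
  refine h₁.trans ?_
  rw [pullSec_compHom, pullSec_compInv, res_res]
  exact Q.res_eq (by simp) _ _ _

end Descent
end TorsorOver

/-! ### Descent for pairs -/

namespace TorsorOver
open Pseudofunctor Pseudofunctor.LocallyDiscreteOpToCat
variable {C : Type u} [Category.{v} C] {J : GrothendieckTopology C}
  {E : Sheaf J AddCommGrpCat.{max u v}} {X : ActionSheaf E} {U V W T S : C}

/-- A morphism of pairs, on sections. -/
def homSec {Q R : TorsorOver (X.over U)} (φ : Q ⟶ R) (f : V ⟶ U) (x : Q.Sec f) : R.Sec f :=
  φ.hom.hom.app (op (Over.mk f)) x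

/-- A morphism of pairs can be given by a functional relation between sections that is compatible with
restriction, with the action and with the maps to `X`. -/
lemma exists_hom_of_rel {Q R : TorsorOver (X.over U)}
    (P : ∀ ⦃V : C⦄ (f : V ⟶ U), Q.Sec f → R.Sec f → Prop)
    (hP : ∀ ⦃V : C⦄ (f : V ⟶ U) (x : Q.Sec f), ∃! y, P f x y)
    (hres : ∀ ⦃V W : C⦄ (f : V ⟶ U) (g : W ⟶ V) (f' : W ⟶ U) (h : g ≫ f = f') (x : Q.Sec f)
      (y : R.Sec f), P f x y → P f' (Q.res g h x) (R.res g h y))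
    (hact : ∀ ⦃V : C⦄ (f : V ⟶ U) (e : E.obj.obj (op V)) (x : Q.Sec f) (y : R.Sec f), P f x y →
      P f (Q.act e x) (R.act e y))
    (hsec : ∀ ⦃V : C⦄ (f : V ⟶ U) (x : Q.Sec f) (y : R.Sec f), P f x y → R.toSec y = Q.toSec x) :
    ∃ φ : Q ⟶ R, ∀ ⦃V : C⦄ (f : V ⟶ U) (x : Q.Sec f), P f x (homSec φ f x) := by
  choose y hy huniq using fun V f x => hP (V := V) f x
  refine ⟨
    { hom := ⟨{
        app V := ↾fun (q : Q.Sec V.unop.hom) => (y _ V.unop.hom q : R.Sec V.unop.hom)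
        naturality V V' k := by
          ext q
          exact (huniq _ _ _ _ (hres V.unop.hom k.unop.left V'.unop.hom (Over.w k.unop) _ _
            (hy _ _ _))).symm }⟩
      equivariant := fun {V} (a : E.obj.obj (op V.unop.left)) (q : Q.Sec V.unop.hom) =>
        (huniq _ _ _ _ (hact V.unop.hom a q _ (hy _ _ _))).symm
      comp_toX := fun {V} (q : Q.Sec V.unop.hom) => hsec V.unop.hom q _ (hy _ _ _) }, ?_⟩
  intro V f x
  exact hy V f x

lemma hom_ext_of_pull {Q R : TorsorOver (X.over U)} {φ ψ : Q ⟶ R} (Z : Sieve U) (hZ : Z ∈ J U)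
    (h : ∀ ⦃V : C⦄ (f : V ⟶ U), Z f → (pull X f).map φ = (pull X f).map ψ) : φ = ψ := by
  apply hom_ext
  intro V' q
  obtain ⟨V, f, rfl⟩ : ∃ (V : C) (f : V ⟶ U), V' = op (Over.mk f) := ⟨_, V'.unop.hom, rfl⟩
  refine R.sec_ext (Z.pullback f) (J.pullback_stable f hZ) fun W g hg => ?_
  have nat (χ : Q ⟶ R) : R.res g rfl (χ.hom.hom.app (op (Over.mk f)) q) =
      χ.hom.hom.app (op (Over.mk (g ≫ f))) (Q.res g rfl q) :=
    (NatTrans.naturality_apply χ.hom.hom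
      (Over.homMk (U := Over.mk (g ≫ f)) (V := Over.mk f) g rfl).op q).symm
  rw [nat, nat, ← pullSec_map φ (𝟙 W) (Category.id_comp _), h _ hg,
    pullSec_map ψ (𝟙 W) (Category.id_comp _)]

section
variable {ι : Type (max u v)} {Y : ι → C} {p : ∀ i, Y i ⟶ S}

variable (p) in
lemma exists_cover_of_cover (hp : Sieve.ofArrows Y p ∈ J S) (f : V ⟶ S) :
    ∃ Z ∈ J V, ∀ ⦃W : C⦄ (g : W ⟶ V), Z g → ∃ (i : ι) (k : W ⟶ Y i), k ≫ p i = g ≫ f := by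
  refine ⟨_, J.pullback_stable f hp, fun W g hg => ?_⟩
  obtain ⟨_, k, _, ⟨i⟩, h⟩ := hg
  exact ⟨i, k, h⟩

/-- Morphisms of pairs glue: the morphism to be found sends `x` to the section `y` that is, over each
`Y i`, the image of `x` under the given morphism. -/
lemma exists_hom_of_descent (hp : Sieve.ofArrows Y p ∈ J S) {M N : TorsorOver (X.over S)}
    (χ : ((torsorStack X).toDescentData p).obj M ⟶ ((torsorStack X).toDescentData p).obj N) :
    ∃ φ : M ⟶ N, ((torsorStack X).toDescentData p).map φ = χ := by
  let c (i : ι) : (pull X (p i)).obj M ⟶ (pull X (p i)).obj N := χ.hom i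
  -- the commutation of `χ` with the comparison maps says that its value does not depend on `i`
  have hc {V : C} {a : V ⟶ S} (i j : ι) (k : V ⟶ Y i) (l : V ⟶ Y j) (hk : k ≫ p i = a)
      (hl : l ≫ p j = a) (z : M.Sec a) : pullSec (c i) k hk hk z = pullSec (c j) l hl hl z := by
    subst hk
    have h₀ := χ.comm (k ≫ p i) k l rfl hl
    have h₁ := congrArg (fun m => onSec (Q := (pull X (p i)).obj M) (R := (pull X (p j)).obj N)
      (f₁ := k) (f₂ := l) m z) h₀
    have h₂ := pullSec_comp (Q := (pull X (p i)).obj M) (R := (pull X (p i)).obj N)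
      (P := (pull X (p j)).obj N) (f₁ := k) (f₂ := k) (f₃ := l) ((pull X k).map (c i))
      ((DescentData.ofObj (F := torsorStack X) (f := p) N).hom (k ≫ p i) k l rfl hl) (𝟙 V)
      (Category.id_comp _) (Category.id_comp _) (Category.id_comp _) z
    have h₃ := pullSec_comp (Q := (pull X (p i)).obj M) (R := (pull X (p j)).obj M)
      (P := (pull X (p j)).obj N) (f₁ := k) (f₂ := l) (f₃ := l)
      ((DescentData.ofObj (F := torsorStack X) (f := p) M).hom (k ≫ p i) k l rfl hl)
      ((pull X l).map (c j)) (𝟙 V) (Category.id_comp _) (Category.id_comp _) (Category.id_comp _) z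
    have h₅ : onSec (Q := (pull X (p i)).obj M) (R := (pull X (p i)).obj N)
        ((pull X k).map (c i)) z = appSec (c i) k z :=
      pullSec_map (f₁ := k) (c i) (𝟙 V) (Category.id_comp _) z
    have h₆ (y : M.Sec (l ≫ p j)) : onSec (Q := (pull X (p j)).obj M) (R := (pull X (p j)).obj N)
        ((pull X l).map (c j)) y = appSec (c j) l y :=
      pullSec_map (f₁ := l) (c j) (𝟙 V) (Category.id_comp _) y
    have h₇ : N.res (f' := l ≫ p j) (𝟙 _) (by simp [hl]) (appSec (c i) k z) =
        appSec (c j) l (M.res (f' := l ≫ p j) (𝟙 _) (by simp [hl]) z) := by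
      rw [← h₅, ← h₆]
      refine ((tr_ofObj N k l hl.symm _).symm.trans (h₂.symm.trans (h₁.trans h₃))).trans ?_
      exact congrArg (fun y => onSec (Q := (pull X (p j)).obj M) (R := (pull X (p j)).obj N)
        ((pull X l).map (c j)) y) (tr_ofObj M k l hl.symm z)
    rw [pullSec_rfl]
    dsimp only [pullSec]
    rw [← h₇, res_res]
    simp
  obtain ⟨φ, hφ⟩ := exists_hom_of_rel (Q := M) (R := N)
    (fun V f x y => ∀ ⦃W : C⦄ (g : W ⟶ V) (i : ι) (k : W ⟶ Y i) (h : k ≫ p i = g ≫ f),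
      N.res g rfl y = pullSec (c i) k h h (M.res g rfl x))
    (fun V f x => by
      obtain ⟨Z, hZ, hex⟩ := exists_cover_of_cover p hp f
      obtain ⟨y, hy⟩ := N.sec_glue f
        (fun W g y => ∃ (i : ι) (k : W ⟶ Y i) (h : k ≫ p i = g ≫ f),
          y = pullSec (c i) k h h (M.res g rfl x))
        (by
          rintro W W' g g' y ⟨i, k, h, rfl⟩
          refine ⟨i, g' ≫ k, by simp [h], ?_⟩
          rw [pullSec_res _ _ _ _ _ _ (Category.assoc _ _ _).symm _ rfl (by simp [h])
            (by simp [h]), res_res])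
        (by
          rintro W g y y' ⟨i, k, h, rfl⟩ ⟨j, l, h', rfl⟩
          exact hc i j k l h h' _)
        Z hZ (fun W g hg => by
          obtain ⟨i, k, h⟩ := hex g hg
          exact ⟨_, i, k, h, rfl⟩)
      refine ⟨y, fun W g i k h => hy g _ ⟨i, k, h, rfl⟩,
        fun y' hy' => N.sec_ext Z hZ fun W g hg => ?_⟩
      obtain ⟨i, k, h⟩ := hex g hg
      rw [hy' g i k h, hy g _ ⟨i, k, h, rfl⟩])
    (fun V W f g f' h x y hxy W' g' i k hk => by
      subst h
      have := congrArg (N.res (f' := g' ≫ g ≫ f) (𝟙 _) (by simp))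
        (hxy (g' ≫ g) i k (by simp [hk]))
      rw [pullSec_res _ _ _ _ _ _ (by simp) _ (Category.id_comp _) hk hk] at this
      simpa only [res_res, Category.id_comp] using this)
    (fun V f e x y hxy W g i k hk => by
      rw [res_act, res_act, pullSec_act, hxy g i k hk])
    (fun V f x y hxy => by
      obtain ⟨Z, hZ, hex⟩ := exists_cover_of_cover p hp f
      refine sheaf_ext X.carrier Z hZ fun W g hg => ?_
      obtain ⟨i, k, h⟩ := hex g hg
      rw [← N.toSec_res y g rfl, ← M.toSec_res x g rfl, hxy g i k h, toSec_pullSec])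
  refine ⟨φ, DescentData.hom_ext fun i => ?_⟩
  change (pull X (p i)).map φ = c i
  apply hom_ext
  intro V' q
  obtain ⟨V, k, rfl⟩ : ∃ (V : C) (k : V ⟶ Y i), V' = op (Over.mk k) := ⟨_, V'.unop.hom, rfl⟩
  change M.Sec (k ≫ p i) at q
  change homSec φ (k ≫ p i) q = appSec (c i) k q
  have h := hφ (k ≫ p i) q (𝟙 V) i k (by simp)
  replace h := congrArg (N.res (f' := k ≫ p i) (𝟙 _) (by simp)) h
  dsimp only [pullSec] at h
  simpa only [res_res, Category.comp_id, res_id] using h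

end
end TorsorOver

namespace TorsorOver
open Pseudofunctor Pseudofunctor.LocallyDiscreteOpToCat
variable {C : Type u} [Category.{v} C] {J : GrothendieckTopology C}
  {E : Sheaf J AddCommGrpCat.{max u v}} {X : ActionSheaf E} {U V W T S : C}

lemma pull_hom_ext_of_pullSec {U₁ U₂ : C} {Q : TorsorOver (X.over U₁)} {R : TorsorOver (X.over U₂)}
    {f₁ : T ⟶ U₁} {f₂ : T ⟶ U₂} {φ ψ : (pull X f₁).obj Q ⟶ (pull X f₂).obj R}
    (h : ∀ ⦃V : C⦄ (g : V ⟶ T) (x : Q.Sec (g ≫ f₁)),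
      pullSec φ g rfl rfl x = pullSec ψ g rfl rfl x) : φ = ψ := by
  apply hom_ext
  intro V q
  have h' := h V.unop.hom q
  exact (pullSec_rfl φ V.unop.hom q).symm.trans (h'.trans (pullSec_rfl ψ V.unop.hom q))

section Glue
variable {ι : Type (max u v)} {Y : ι → C} {p : ∀ i, Y i ⟶ S} (D : (torsorStack X).DescentData p)

/-- The sections over `f : T ⟶ S` of the pair obtained by gluing a descent datum: compatible families
of sections of the pairs `D.obj i` over all objects that map to `T` and to some `Y i`. -/
@[ext]
structure GlueSec (f : T ⟶ S) : Type (max u v) where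
  sec ⦃V : C⦄ (k : V ⟶ T) (i : ι) (a : V ⟶ Y i) (h : a ≫ p i = k ≫ f) : (descObj D i).Sec a
  res ⦃V W : C⦄ (k : V ⟶ T) (i : ι) (a : V ⟶ Y i) (h : a ≫ p i = k ≫ f) (g : W ⟶ V) :
    (descObj D i).res g rfl (sec k i a h) = sec (g ≫ k) i (g ≫ a) (by simp [h])
  tr ⦃V : C⦄ (k : V ⟶ T) (i j : ι) (a : V ⟶ Y i) (b : V ⟶ Y j) (h : a ≫ p i = k ≫ f)
    (h' : b ≫ p j = k ≫ f) : TorsorOver.tr D a b (h.trans h'.symm) (sec k i a h) = sec k j b h'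

namespace GlueSec
variable {D}

lemma sec_congr {f : T ⟶ S} (s : GlueSec D f) {V : C} {k k' : V ⟶ T} (e : k = k') {i : ι}
    (a : V ⟶ Y i) (h : a ≫ p i = k ≫ f) : s.sec k i a h = s.sec k' i a (e ▸ h) := by
  subst e; rfl

lemma res_sec {f : T ⟶ S} (s : GlueSec D f) ⦃V W : C⦄ (k : V ⟶ T) (i : ι) (a : V ⟶ Y i)
    (h : a ≫ p i = k ≫ f) (g : W ⟶ V) {a' : W ⟶ Y i} (ha : g ≫ a = a') {k' : W ⟶ T}
    (hk : g ≫ k = k') (h' : a' ≫ p i = k' ≫ f) :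
    (descObj D i).res g ha (s.sec k i a h) = s.sec k' i a' h' := by
  subst ha hk
  exact s.res k i a h g

/-- Restriction of glued sections. -/
def restrict {f : T ⟶ S} (s : GlueSec D f) {T' : C} (g : T' ⟶ T) {f' : T' ⟶ S} (hg : g ≫ f = f') :
    GlueSec D f' where
  sec V k i a h := s.sec (k ≫ g) i a (by rw [h, Category.assoc, hg])
  res V W k i a h g' := s.res_sec _ _ _ _ _ _ (by simp) _
  tr V k i j a b h h' := s.tr _ _ _ _ _ _ _

/-- The action on glued sections. -/
def act {f : T ⟶ S} (e : E.obj.obj (op T)) (s : GlueSec D f) : GlueSec D f where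
  sec V k i a h := (descObj D i).act (E.obj.map k.op e) (s.sec k i a h)
  res V W k i a h g := by rw [res_act, s.res, ab_map_comp, ← op_comp]
  tr V k i j a b h h' := by rw [tr_act, s.tr]

end GlueSec

variable {D} in
lemma GlueSec.ext_of_cover {f : T ⟶ S} {s t : GlueSec D f} (Z : Sieve T) (hZ : Z ∈ J T)
    (h : ∀ ⦃V : C⦄ (k : V ⟶ T), Z k → ∀ (i : ι) (a : V ⟶ Y i) (h : a ≫ p i = k ≫ f),
      s.sec k i a h = t.sec k i a h) : s = t := by
  ext V k i a hk
  refine (descObj D i).sec_ext (Z.pullback k) (J.pullback_stable k hZ) fun W g hg => ?_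
  rw [s.res, t.res]
  exact h _ hg _ _ _

/-- A section of one of the pairs of a descent datum extends to a glued section. -/
def GlueSec.ofSec {i : ι} (a : T ⟶ Y i) (x : (descObj D i).Sec a) {f : T ⟶ S} (hf : a ≫ p i = f) :
    GlueSec D f where
  sec V k j b h :=
    TorsorOver.tr D (k ≫ a) b (by rw [h, Category.assoc, hf]) ((descObj D i).res k rfl x)
  res V W k j b h g := by
    rw [← tr_res _ _ _ _ _ (Category.assoc _ _ _).symm rfl (by simp [h, hf]), res_res]
  tr V k j l b c h h' := by rw [tr_tr]

/-- The presheaf of glued sections. -/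
def gluePresheaf : (Over S)ᵒᵖ ⥤ Type (max u v) where
  obj T := GlueSec D T.unop.hom
  map g := ↾fun s => s.restrict g.unop.left (Over.w g.unop)
  map_id T := by
    refine ConcreteCategory.hom_ext _ _ fun (s : GlueSec D T.unop.hom) => ?_
    refine GlueSec.ext (funext fun V => funext fun k => funext fun i => funext fun a =>
      funext fun h => ?_)
    exact s.sec_congr (by simp) _ _
  map_comp f g := by
    refine ConcreteCategory.hom_ext _ _ fun (s : GlueSec D _) => ?_
    refine GlueSec.ext (funext fun V => funext fun k => funext fun i => funext fun a =>
      funext fun h => ?_)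
    exact s.sec_congr (by simp) _ _

/-- Given glued sections over the members of a covering sieve of `T`, the component of the section to be
found at `k : V ⟶ T` and `a : V ⟶ Y i` is glued from the components of the given ones over the
pulled back sieve of `V`. -/
lemma isSheaf_gluePresheaf : Presheaf.IsSheaf (J.over S) (gluePresheaf D) := by
  rw [isSheaf_iff_isSheaf_of_type]
  intro T Z hZ x hx
  obtain ⟨T, f, rfl⟩ : ∃ (T' : C) (f : T' ⟶ S), T = Over.mk f := ⟨_, T.hom, rfl⟩
  have hx' := hx.to_sieveCompatible
  rw [GrothendieckTopology.mem_over_iff] at hZ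
  let Z' : Sieve T := Sieve.overEquiv (Over.mk f) Z
  -- the given section over a member `k` of the covering sieve of `T`
  let m {V : C} (k : V ⟶ T) : Over.mk (k ≫ f) ⟶ Over.mk f := Over.homMk k rfl
  have hm {V : C} {k : V ⟶ T} (hk : Z' k) : Z (m k) := (Sieve.overEquiv_iff Z k).1 hk
  let y {V : C} (k : V ⟶ T) (hk : Z' k) : GlueSec D (k ≫ f) := x (m k) (hm hk)
  have hy {V W : C} (k : V ⟶ T) (hk : Z' k) (g : W ⟶ V) (hgk : Z' (g ≫ k)) :
      y (g ≫ k) hgk = (y k hk).restrict g (by simp) := by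
    have h₁ := hx' (m k)
      (Over.homMk (U := Over.mk ((g ≫ k) ≫ f)) (V := Over.mk (k ≫ f)) g (by simp)) (hm hk)
    refine Eq.trans ?_ h₁
    dsimp only [y]
    congr 1
  have hy' {V : C} {k k' : V ⟶ T} (e : k = k') (hk : Z' k) {W : C} (l : W ⟶ V) {i : ι} (a : W ⟶ Y i)
      (h : a ≫ p i = l ≫ k ≫ f) :
      (y k hk).sec l i a h = (y k' (e ▸ hk)).sec l i a (e ▸ h) := by
    subst e; rfl
  have glue ⦃V : C⦄ (k : V ⟶ T) (i : ι) (a : V ⟶ Y i) (h : a ≫ p i = k ≫ f) :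
      ∃ z : (descObj D i).Sec a, ∀ ⦃W : C⦄ (g : W ⟶ V) (hg : Z' (g ≫ k)),
        (descObj D i).res g rfl z = (y (g ≫ k) hg).sec (𝟙 W) i (g ≫ a) (by simp [h]) := by
    obtain ⟨z, hz⟩ := (descObj D i).sec_glue a
      (fun W g z => ∃ hg : Z' (g ≫ k), z = (y (g ≫ k) hg).sec (𝟙 W) i (g ≫ a) (by simp [h]))
      (by
        rintro W W' g g' z ⟨hg, rfl⟩
        have hg' : Z' (g' ≫ g ≫ k) := Z'.downward_closed hg g'
        refine ⟨by simpa using hg', ?_⟩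
        rw [hy' (Category.assoc g' g k) (by simpa using hg'), hy (g ≫ k) hg g' hg']
        exact GlueSec.res_sec _ _ _ _ _ _ _ (by simp) _)
      (by rintro W g z z' ⟨hg, rfl⟩ ⟨hg', rfl⟩; rfl)
      (Z'.pullback k) (J.pullback_stable k hZ) (fun W g hg => ⟨_, hg, rfl⟩)
    exact ⟨z, fun W g hg => hz g _ ⟨hg, rfl⟩⟩
  choose z hz using glue
  let t : GlueSec D f :=
    { sec := z
      res := fun V W k i a h g => by
        refine (descObj D i).sec_ext (Z'.pullback (g ≫ k)) (J.pullback_stable _ hZ) fun W' l hl => ?_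
        have hl' : Z' ((l ≫ g) ≫ k) := by simpa using hl
        have := congrArg ((descObj D i).res (f' := l ≫ g ≫ a) (𝟙 _) (by simp)) (hz k i a h (l ≫ g) hl')
        rw [hz (g ≫ k) i (g ≫ a) _ l hl, res_res]
        rw [res_res, GlueSec.res_sec (h' := by simp [h]) (hk := Category.comp_id _)] at this
        rw [hy' (Category.assoc l g k) hl'] at this
        rw [← this]
        exact (descObj D i).res_eq (by simp) _ _ _
      tr := fun V k i j a b h h' => by
        refine (descObj D j).sec_ext (Z'.pullback k) (J.pullback_stable _ hZ) fun W' l hl => ?_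
        rw [← tr_res _ _ _ _ _ rfl rfl (by simp [h, h']), hz _ _ _ _ l hl, hz _ _ _ _ l hl]
        exact (y _ hl).tr _ _ _ _ _ _ _ }
  have ht {V : C} (k : V ⟶ T) (hk : Z' k) : t.restrict k rfl = y k hk := by
    refine GlueSec.ext (funext fun W => funext fun l => funext fun i => funext fun a => funext fun h => ?_)
    have hl := Z'.downward_closed hk l
    have h₁ := hz (l ≫ k) i a (by simp [h]) (𝟙 W) (by simpa using hl)
    have h₂ := congrArg ((descObj D i).res (f' := a) (𝟙 _) (by simp)) h₁
    rw [res_res, GlueSec.res_sec (h' := by simp [h]) (hk := Category.comp_id _),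
      hy' (Category.id_comp _) (by simpa using hl), hy k hk l hl] at h₂
    simp only [Category.comp_id, res_id] at h₂
    refine h₂.trans ?_
    exact (y k hk).sec_congr (by simp) _ _
  refine ⟨t, fun V g hg => ?_, fun t' ht' => ?_⟩
  · obtain ⟨V, h, rfl⟩ := V.mk_surjective
    obtain ⟨k, hk, rfl⟩ : ∃ (k : V ⟶ T) (hk : k ≫ f = h), g = Over.homMk k hk :=
      ⟨g.left, Over.w g, by ext; rfl⟩
    subst hk
    exact ht k ((Sieve.overEquiv_iff Z k).2 hg)
  · refine GlueSec.ext_of_cover Z' hZ fun V k hk i a h => ?_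
    have h₁ : GlueSec.restrict (show GlueSec D f from t') k rfl = y k hk := ht' (m k) (hm hk)
    have h₂ := congrArg (fun s : GlueSec D (k ≫ f) => s.sec (𝟙 V) i a (by simp [h]))
      (h₁.trans (ht k hk).symm)
    have e : 𝟙 V ≫ k = k := Category.id_comp _
    exact (GlueSec.sec_congr (show GlueSec D f from t') e.symm a h).trans
      (h₂.trans (t.sec_congr e _ _))

/-- The sheaf of glued sections, with its action. -/
def glueAction : ActionSheaf (E.over S) where
  carrier := ⟨gluePresheaf D, isSheaf_gluePresheaf D⟩
  act {V} e s := GlueSec.act (f := V.unop.hom) e s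
  zero_act {V} s := by
    refine GlueSec.ext (funext fun W => funext fun k => funext fun i => funext fun a =>
      funext fun h => ?_)
    change (descObj D i).act (E.obj.map k.op 0) _ = _
    rw [map_zero, zero_act]
  add_act {V} e e' s := by
    refine GlueSec.ext (funext fun W => funext fun k => funext fun i => funext fun a =>
      funext fun h => ?_)
    refine Eq.trans ?_ (add_act _ _ _ _)
    exact congrArg (fun e => (descObj D i).act e _) (map_add (E.obj.map k.op).hom _ _)
  map_act := fun {V V'} g (e : E.obj.obj (op V.unop.left)) (s : GlueSec D V.unop.hom) => by
    refine GlueSec.ext (funext fun W => funext fun k => funext fun i => funext fun a =>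
      funext fun h => ?_)
    exact congrArg (fun e => (descObj D i).act e (s.sec (k ≫ g.unop.left) i a _))
      (ab_map_comp E g.unop.left.op k.op e).symm

/-- The torsor property on the localized site, in terms of the objects of the site itself. -/
lemma isTorsor_of_cover {P : ActionSheaf (E.over S)}
    (h₁ : ∀ ⦃V : C⦄ (f : V ⟶ S) (x y : P.carrier.obj.obj (op (Over.mk f))),
      ∃! e : E.obj.obj (op V), P.act (V := op (Over.mk f)) e x = y)
    (h₂ : ∀ ⦃V : C⦄ (f : V ⟶ S), ∃ Z ∈ J V, ∀ ⦃W : C⦄ (g : W ⟶ V), Z g →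
      Nonempty (P.carrier.obj.obj (op (Over.mk (g ≫ f))))) : P.IsTorsor where
  existsUnique_act V x y := h₁ V.unop.hom x y
  locally_nonempty V := by
    obtain ⟨V, f, rfl⟩ := V.mk_surjective
    obtain ⟨Z, hZ, h⟩ := h₂ f
    refine ⟨(Sieve.overEquiv (Over.mk f)).symm Z, ?_, fun W g hg => ?_⟩
    · rw [GrothendieckTopology.mem_over_iff]; simpa using hZ
    · obtain ⟨x⟩ := h g.left ((Sieve.overEquiv_symm_iff Z g).1 hg)
      exact ⟨P.carrier.obj.map (Over.homMk (𝟙 _) (by simpa using Over.w g) :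
        W ⟶ Over.mk (g.left ≫ f)).op x⟩

/-- Two glued sections differ by a unique section of `E`, which is glued from those that translate their
components into each other. -/
lemma glueAction_isTorsor (hp : Sieve.ofArrows Y p ∈ J S) : (glueAction D).IsTorsor := by
  refine isTorsor_of_cover (fun V f (s t : GlueSec D f) => ?_) fun V f => ?_
  · obtain ⟨Z, hZ, hex⟩ := exists_cover_of_cover p hp f
    have uniq {W : C} (k : W ⟶ V) (e e' : E.obj.obj (op W))
        (h : ∃ i a h, (descObj D i).act e (s.sec k i a h) = t.sec k i a h)
        (h' : ∃ i a h, (descObj D i).act e' (s.sec k i a h) = t.sec k i a h) : e = e' := by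
      obtain ⟨i, a, h, he⟩ := h
      obtain ⟨j, b, h', he'⟩ := h'
      refine (descObj D j).act_injective (s.sec k j b h') (Eq.trans ?_ he'.symm)
      rw [← s.tr k i j a b h h', ← tr_act, he, t.tr]
    obtain ⟨e, he⟩ := ab_glue E (V := V)
      (fun W k e => ∃ i a h, (descObj D i).act e (s.sec k i a h) = t.sec k i a h)
      (by
        rintro W W' k g e ⟨i, a, h, he⟩
        refine ⟨i, g ≫ a, by simp [h], ?_⟩
        rw [← s.res k i a h g, ← res_act, he, t.res])
      (fun W k e e' h h' => uniq k e e' h h') Z hZ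
      (fun W k hk => by
        obtain ⟨i, a, h⟩ := hex k hk
        obtain ⟨e, he⟩ := (descObj D i).exists_act (s.sec k i a h) (t.sec k i a h)
        exact ⟨e, i, a, h, he⟩)
    refine ⟨e, ?_, fun e' he' => ab_ext E Z hZ fun W k hk => ?_⟩
    · refine GlueSec.ext_of_cover Z hZ fun W k hk i a h => ?_
      obtain ⟨e', he'⟩ := (descObj D i).exists_act (s.sec k i a h) (t.sec k i a h)
      change (descObj D i).act (E.obj.map k.op e) (s.sec k i a h) = _
      rw [he k e' ⟨i, a, h, he'⟩, he']
    · obtain ⟨i, a, h⟩ := hex k hk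
      refine (he k _ ⟨i, a, h, ?_⟩).symm
      exact congrArg (fun s : GlueSec D f => s.sec k i a h) he'
  · obtain ⟨Z, hZ, hex⟩ := exists_cover_of_cover p hp f
    refine ⟨⟨fun W g => Nonempty (GlueSec D (g ≫ f)), ?_⟩, ?_, fun W g hg => hg⟩
    · rintro W W' g ⟨s⟩ k
      exact ⟨s.restrict k (by simp)⟩
    · refine J.transitive hZ _ fun W g hg => ?_
      obtain ⟨i, a, h⟩ := hex g hg
      obtain ⟨Z', hZ', hne⟩ := (descObj D i).exists_cover a
      refine J.superset_covering (fun W' k hk => ?_) hZ'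
      obtain ⟨x⟩ := hne k hk
      exact ⟨GlueSec.ofSec D (k ≫ a) x (by simp [h])⟩

/-- The maps of the pairs `D.obj i` to `X` glue to a map from the sheaf of glued sections. -/
lemma exists_glue_toX (hp : Sieve.ofArrows Y p ∈ J S) {f : T ⟶ S} (s : GlueSec D f) :
    ∃! x : X.carrier.obj.obj (op T), ∀ ⦃V : C⦄ (k : V ⟶ T) (i : ι) (a : V ⟶ Y i)
      (h : a ≫ p i = k ≫ f), X.carrier.obj.map k.op x = (descObj D i).toSec (s.sec k i a h) := by
  obtain ⟨Z, hZ, hex⟩ := exists_cover_of_cover p hp f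
  obtain ⟨x, hx⟩ := sheaf_glue X.carrier (V := T)
    (fun V k x => ∃ i a h, x = (descObj D i).toSec (s.sec k i a h))
    (by
      rintro V V' k g x ⟨i, a, h, rfl⟩
      exact ⟨i, g ≫ a, by simp [h], by rw [← s.res k i a h g, toSec_res]⟩)
    (by
      rintro V k x x' ⟨i, a, h, rfl⟩ ⟨j, b, h', rfl⟩
      rw [← s.tr k i j a b h h', toSec_tr]) Z hZ
    (fun V k hk => by
      obtain ⟨i, a, h⟩ := hex k hk
      exact ⟨_, i, a, h, rfl⟩)
  refine ⟨x, fun V k i a h => hx k _ ⟨i, a, h, rfl⟩, fun x' hx' => ?_⟩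
  refine sheaf_ext X.carrier Z hZ fun V k hk => ?_
  obtain ⟨i, a, h⟩ := hex k hk
  rw [hx' k i a h, hx k _ ⟨i, a, h, rfl⟩]

/-- Descent data of pairs are effective. -/
lemma exists_iso_of_descent (hp : Sieve.ofArrows Y p ∈ J S) (D : (torsorStack X).DescentData p) :
    ∃ Q : TorsorOver (X.over S), Nonempty (((torsorStack X).toDescentData p).obj Q ≅ D) := by
  choose y hy huniq using fun {T : C} {f : T ⟶ S} (s : GlueSec D f) => exists_glue_toX D hp s
  let Q : TorsorOver (X.over S) :=
    { torsor := glueAction D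
      isTorsor := glueAction_isTorsor D hp
      toX := ⟨{
        app V := ↾fun (s : GlueSec D V.unop.hom) => (y s : X.carrier.obj.obj (op V.unop.left))
        naturality V V' g := by
          refine ConcreteCategory.hom_ext _ _ fun (s : GlueSec D V.unop.hom) => ?_
          refine (huniq (s.restrict g.unop.left (Over.w g.unop)) _ fun W k i a h => ?_).symm
          change X.carrier.obj.map k.op (X.carrier.obj.map g.unop.left.op (y s)) = _
          rw [← Functor.map_comp_apply]
          exact hy s _ _ _ _ }⟩
      equivariant := fun {V} (e : E.obj.obj (op V.unop.left)) (s : GlueSec D V.unop.hom) => by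
        refine (huniq (s.act e) _ fun W k i a h => ?_).symm
        refine (X.map_act (V := op V.unop.left) k.op e (y s)).trans ?_
        refine Eq.trans ?_ (toSec_act _ _ _).symm
        congr 1
        exact hy s _ _ _ _ }
  have hQ (i : ι) : ∃ φ : (pull X (p i)).obj Q ⟶ descObj D i, ∀ ⦃V : C⦄ (k : V ⟶ Y i)
      (s : GlueSec D (k ≫ p i)),
        homSec (Q := (pull X (p i)).obj Q) φ k s = s.sec (𝟙 V) i k (by simp) := by
    obtain ⟨φ, hφ⟩ := exists_hom_of_rel (Q := (pull X (p i)).obj Q) (R := descObj D i)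
      (fun V f (s : GlueSec D (f ≫ p i)) x => x = s.sec (𝟙 V) i f (by simp))
      (fun V f s => ⟨_, rfl, fun _ h => h⟩)
      (by
        rintro V W f g f' rfl s x rfl
        refine (GlueSec.res_sec _ _ _ _ _ _ _ (Category.comp_id g) (by simp)).trans ?_
        exact GlueSec.sec_congr (show GlueSec D (f ≫ p i) from s) (Category.id_comp g).symm _ _)
      (by
        rintro V f e s x rfl
        change _ = (descObj D i).act (E.obj.map (𝟙 (op V)) e) _
        rw [ab_map_id])
      (by
        rintro V f s x rfl
        refine (hy _ (𝟙 V) i f (by simp)).symm.trans ?_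
        change X.carrier.obj.map (𝟙 _) _ = _
        rw [Functor.map_id_apply]
        rfl)
    exact ⟨φ, fun V k s => hφ k s⟩
  choose φ hφ using hQ
  refine ⟨Q, ⟨DescentData.isoMk (fun i => @asIso _ _ _ _ (φ i) (isIso (φ i))) ?_⟩⟩
  intro V q i j a b ha hb
  refine pull_hom_ext_of_pullSec (Q := (pull X (p i)).obj Q) (R := descObj D j) (f₁ := a) (f₂ := b)
    fun W g x => ?_
  have h₁ := pullSec_comp (Q := (pull X (p i)).obj Q) (R := descObj D i) (P := descObj D j) (f₁ := a)
    (f₂ := a) (f₃ := b) ((pull X a).map (φ i)) (D.hom q a b ha hb) g rfl rfl rfl x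
  have h₂ := pullSec_comp (Q := (pull X (p i)).obj Q) (R := (pull X (p j)).obj Q) (P := descObj D j)
    (f₁ := a) (f₂ := b) (f₃ := b) ((DescentData.ofObj (F := torsorStack X) (f := p) Q).hom q a b ha hb)
    ((pull X b).map (φ j)) g rfl rfl rfl x
  have e : (g ≫ a) ≫ p i = (g ≫ b) ≫ p j := by rw [Category.assoc, Category.assoc, ha, hb]
  have h₃ := (pullSec_descent (D := DescentData.ofObj (F := torsorStack X) (f := p) Q) q a b ha hb
    g rfl rfl e x).trans (tr_ofObj Q (g ≫ a) (g ≫ b) e x)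
  refine h₁.trans (Eq.trans ?_ h₂.symm)
  have h₄ : pullSec (Q := (pull X (p i)).obj Q) (R := descObj D i) ((pull X a).map (φ i)) g rfl rfl x =
      GlueSec.sec (show GlueSec D ((g ≫ a) ≫ p i) from x) (𝟙 W) i (g ≫ a) (by simp) :=
    (pullSec_map (φ i) g rfl x).trans (hφ i _ _)
  refine (congrArg (pullSec (Q := descObj D i) (R := descObj D j) (f₁ := a) (f₂ := b)
    (D.hom q a b ha hb) g rfl rfl) h₄).trans ?_
  refine Eq.trans ?_ (congrArg (pullSec (Q := (pull X (p j)).obj Q) (R := descObj D j)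
    ((pull X b).map (φ j)) g rfl rfl) h₃).symm
  refine Eq.trans ?_ ((pullSec_map (φ j) g rfl _).trans (hφ j _ _)).symm
  refine (pullSec_descent q a b ha hb g rfl rfl e _).trans ?_
  have h₅ := GlueSec.tr (show GlueSec D ((g ≫ a) ≫ p i) from x) (𝟙 W) i j (g ≫ a) (g ≫ b) (by simp)
    (by rw [← e, Category.id_comp])
  exact h₅.trans (GlueSec.sec_congr (show GlueSec D ((g ≫ a) ≫ p i) from x)
    (Category.comp_id _).symm _ _)

end Glue

/-- Pairs of a torsor and an equivariant map form a stack. -/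
lemma isStack_torsorStack (X : ActionSheaf E) : (torsorStack X).IsStack J := by
  have hcov {S : C} (R : Sieve S) (hR : R ∈ J S) :
      Sieve.ofArrows _ (fun f : R.arrows.category => f.obj.hom) ∈ J S := by
    rwa [Sieve.ofArrows_category', Sieve.generate_sieve]
  refine IsStack.of_isStackFor fun S R hR => (isStackFor_iff _ _).2 ?_
  refine @Functor.IsEquivalence.mk _ _ _ _ _ ⟨?_⟩ ⟨?_⟩ ⟨fun D => exists_iso_of_descent (hcov R hR) D⟩
  · intro M N φ ψ h
    exact hom_ext_of_pull R hR fun V f hf =>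
      congrArg (fun χ => DescentData.Hom.hom χ ⟨Over.mk f, hf⟩) h
  · intro M N χ
    exact exists_hom_of_descent (hcov R hR) χ

end TorsorOver

/-! ### Full subcategories of stacks -/

section FullSubcategory
open Pseudofunctor Pseudofunctor.LocallyDiscreteOpToCat
universe v' u'
variable {C : Type u} [Category.{v} C] {J : GrothendieckTopology C}
  {F : LocallyDiscrete Cᵒᵖ ⥤ᵖ Cat.{v', u'}} (P : F.ObjectProperty) [P.IsClosedUnderMapObj]

lemma fullsubcategory_mapComp'_hom_app {X Y Z : LocallyDiscrete Cᵒᵖ} (f : X ⟶ Y) (g : Y ⟶ Z) (fg : X ⟶ Z)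
    (h : f ≫ g = fg) (M : P.fullsubcategory.obj X) :
    ((P.fullsubcategory.mapComp' f g fg h).hom.toNatTrans.app M).hom =
      (F.mapComp' f g fg h).hom.toNatTrans.app M.obj := by
  subst h
  rw [mapComp'_eq_mapComp, mapComp'_eq_mapComp]
  rfl

lemma fullsubcategory_mapComp'_inv_app {X Y Z : LocallyDiscrete Cᵒᵖ} (f : X ⟶ Y) (g : Y ⟶ Z) (fg : X ⟶ Z)
    (h : f ≫ g = fg) (M : P.fullsubcategory.obj X) :
    ((P.fullsubcategory.mapComp' f g fg h).inv.toNatTrans.app M).hom =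
      (F.mapComp' f g fg h).inv.toNatTrans.app M.obj := by
  subst h
  rw [mapComp'_eq_mapComp, mapComp'_eq_mapComp]
  rfl

lemma fullsubcategory_pullHom ⦃X₁ X₂ : C⦄ ⦃M₁ : P.fullsubcategory.obj (.mk (op X₁))⦄
    ⦃M₂ : P.fullsubcategory.obj (.mk (op X₂))⦄
    ⦃Y : C⦄ ⦃f₁ : Y ⟶ X₁⦄ ⦃f₂ : Y ⟶ X₂⦄
    (φ : (P.fullsubcategory.map f₁.op.toLoc).toFunctor.obj M₁ ⟶
      (P.fullsubcategory.map f₂.op.toLoc).toFunctor.obj M₂) ⦃Y' : C⦄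
    (g : Y' ⟶ Y) (gf₁ : Y' ⟶ X₁) (gf₂ : Y' ⟶ X₂) (hgf₁ : g ≫ f₁ = gf₁) (hgf₂ : g ≫ f₂ = gf₂) :
    (pullHom φ g gf₁ gf₂ hgf₁ hgf₂).hom =
      pullHom (F := F) (M₁ := M₁.obj) (M₂ := M₂.obj) φ.hom g gf₁ gf₂ hgf₁ hgf₂ := by
  dsimp only [pullHom]
  rw [← fullsubcategory_mapComp'_hom_app, ← fullsubcategory_mapComp'_inv_app]
  rfl

variable {P} {ι : Type t} {S : C} {Y : ι → C} {p : ∀ i, Y i ⟶ S}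

/-- A descent datum in a full subcategory, as a descent datum in the ambient fibred category. -/
def descentDataOfFull (D : P.fullsubcategory.DescentData p) : F.DescentData p where
  obj i := (D.obj i).obj
  hom V q i j f g hf hg := (D.hom q f g hf hg).hom
  pullHom_hom V' V g q q' hq i j f₁ f₂ hf₁ hf₂ gf₁ gf₂ hgf₁ hgf₂ := by
    rw [← D.pullHom_hom g q q' hq f₁ f₂ hf₁ hf₂ gf₁ gf₂ hgf₁ hgf₂]
    exact (fullsubcategory_pullHom P _ _ _ _ _ _).symm
  hom_self V q i g hg := by
    rw [D.hom_self q g hg]; rfl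
  hom_comp V q i j k f₁ f₂ f₃ hf₁ hf₂ hf₃ := by
    rw [← D.hom_comp q f₁ f₂ f₃ hf₁ hf₂ hf₃]; rfl

lemma descentDataOfFull_ofObj_hom (M : P.fullsubcategory.obj (.mk (op S))) ⦃V : C⦄ (q : V ⟶ S)
    ⦃i j : ι⦄ (f : V ⟶ Y i) (g : V ⟶ Y j) (hf : f ≫ p i = q) (hg : g ≫ p j = q) :
    ((DescentData.ofObj (F := P.fullsubcategory) (f := p) M).hom q f g hf hg).hom =
      (DescentData.ofObj (F := F) (f := p) M.obj).hom q f g hf hg := by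
  dsimp only [DescentData.ofObj]
  rw [← fullsubcategory_mapComp'_hom_app, ← fullsubcategory_mapComp'_inv_app]
  rfl

variable (P) in
/-- The full subcategory of the objects of a stack with a local property is a stack. -/
lemma isStack_fullsubcategory [F.IsStack J]
    (hloc : ∀ ⦃S : C⦄ (M : F.obj (.mk (op S))) (R : Sieve S), R ∈ J S →
      (∀ ⦃V : C⦄ (f : V ⟶ S), R f → ∃ N : F.obj (.mk (op V)), P.prop _ N ∧
        Nonempty (N ≅ (F.map f.op.toLoc).toFunctor.obj M)) → P.prop _ M) :
    P.fullsubcategory.IsStack J := by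
  refine IsStack.of_isStackFor fun S R hR => (isStackFor_iff _ _).2 ?_
  have hF := (isStackFor_iff _ _).1 (F.isStackFor' R hR)
  refine @Functor.IsEquivalence.mk _ _ _ _ _ ⟨?_⟩ ⟨?_⟩ ⟨fun D => ?_⟩
  · intro M N φ ψ h
    apply ObjectProperty.hom_ext
    apply (F.toDescentData fun f : R.arrows.category => f.obj.hom).map_injective
    apply DescentData.hom_ext
    intro i
    exact congrArg (fun χ :
      (P.fullsubcategory.toDescentData fun f : R.arrows.category => f.obj.hom).obj M ⟶
      (P.fullsubcategory.toDescentData fun f : R.arrows.category => f.obj.hom).obj N =>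
      InducedCategory.Hom.hom (χ.hom i)) h
  · intro M N χ
    let χ' : (F.toDescentData fun f : R.arrows.category => f.obj.hom).obj M.obj ⟶
        (F.toDescentData fun f : R.arrows.category => f.obj.hom).obj N.obj :=
      { hom i := (χ.hom i).hom
        comm V q i j f g hf hg := by
          have := congrArg InducedCategory.Hom.hom (χ.comm q f g hf hg)
          refine Eq.trans ?_ (this.trans ?_)
          · exact congrArg (fun m => (F.map f.op.toLoc).toFunctor.map (χ.hom i).hom ≫ m)
              (descentDataOfFull_ofObj_hom N q f g hf hg).symm
          · exact congrArg (fun m => m ≫ (F.map g.op.toLoc).toFunctor.map (χ.hom j).hom)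
              (descentDataOfFull_ofObj_hom M q f g hf hg) }
    obtain ⟨φ, hφ⟩ := (F.toDescentData fun f : R.arrows.category => f.obj.hom).map_surjective χ'
    refine ⟨ObjectProperty.homMk φ, DescentData.hom_ext fun i => ObjectProperty.hom_ext _ ?_⟩
    exact congrArg (fun χ => DescentData.Hom.hom χ i) hφ
  · let D' := descentDataOfFull D
    let M := (F.toDescentData fun f : R.arrows.category => f.obj.hom).objPreimage D'
    let e : _ ≅ D' := (F.toDescentData fun f : R.arrows.category => f.obj.hom).objObjPreimageIso D'
    let e' (i : R.arrows.category) : (F.map i.obj.hom.op.toLoc).toFunctor.obj M ≅ (D.obj i).obj :=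
      { hom := e.hom.hom i
        inv := e.inv.hom i
        hom_inv_id := congrArg (fun χ => DescentData.Hom.hom χ i) e.hom_inv_id
        inv_hom_id := congrArg (fun χ => DescentData.Hom.hom χ i) e.inv_hom_id }
    have hM : P.prop _ M := hloc M R hR fun V f hf =>
      ⟨_, (D.obj ⟨Over.mk f, hf⟩).property, ⟨(e' ⟨Over.mk f, hf⟩).symm⟩⟩
    refine ⟨⟨M, hM⟩, ⟨DescentData.isoMk (fun i => ObjectProperty.isoMk _ (e' i)) ?_⟩⟩
    intro V q i j f g hf hg
    apply ObjectProperty.hom_ext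
    refine (e.hom.comm q f g hf hg).trans ?_
    exact congrArg (fun m => m ≫ (F.map g.op.toLoc).toFunctor.map (e.hom.hom j))
      (descentDataOfFull_ofObj_hom ⟨M, hM⟩ q f g hf hg).symm

end FullSubcategory

/-! ### Automorphisms of pairs -/

namespace TorsorOver
variable {C : Type u} [Category.{v} C] {J : GrothendieckTopology C}
  {E : Sheaf J AddCommGrpCat.{max u v}} {X : ActionSheaf E} {U V W T S : C}

lemma homSec_ext {Q R : TorsorOver (X.over U)} {φ ψ : Q ⟶ R}
    (h : ∀ ⦃V : C⦄ (f : V ⟶ U) (x : Q.Sec f), homSec φ f x = homSec ψ f x) : φ = ψ :=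
  hom_ext fun V q => h V.unop.hom q

section
variable {Q R : TorsorOver (X.over U)} (φ : Q ⟶ R) {f : V ⟶ U}

lemma homSec_act (e : E.obj.obj (op V)) (x : Q.Sec f) :
    homSec φ f (Q.act e x) = R.act e (homSec φ f x) :=
  φ.equivariant (V := op (Over.mk f)) e x

lemma toSec_homSec (x : Q.Sec f) : R.toSec (homSec φ f x) = Q.toSec x :=
  φ.comp_toX (V := op (Over.mk f)) x

lemma homSec_res (g : W ⟶ V) {f' : W ⟶ U} (h : g ≫ f = f') (x : Q.Sec f) :
    homSec φ f' (Q.res g h x) = R.res g h (homSec φ f x) :=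
  NatTrans.naturality_apply φ.hom.hom (Over.homMk (U := Over.mk f') (V := Over.mk f) g h).op x

end

variable {A : Sheaf J AddCommGrpCat.{max u v}} (i : A ⟶ E)

/-- If `A` acts trivially on `X` through `i : A ⟶ E`, its sections act by translations on pairs. -/
def translateBand (h : ∀ ⦃V : Cᵒᵖ⦄ (a : A.obj.obj V) (x : X.carrier.obj.obj V),
    X.act (i.hom.app V a) x = x) : BandData (torsorStack X) A := fun U Q a =>
  translate (X := X) (U := U) Q (i.hom.app (op U) a)
    (fun V f x => by rw [← ab_naturality]; exact h _ x)

/-- If `A` is the stabilizer in `E` of each section of `X`, the automorphisms of a pair are the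
translations by sections of `A`. -/
lemma isBand_translateBand
    (h : ∀ ⦃V : Cᵒᵖ⦄ (a : A.obj.obj V) (x : X.carrier.obj.obj V), X.act (i.hom.app V a) x = x)
    (hi : ∀ V, Function.Injective (i.hom.app V))
    (hstab : ∀ ⦃V : Cᵒᵖ⦄ (e : E.obj.obj V) (x : X.carrier.obj.obj V), X.act e x = x →
      ∃ a, i.hom.app V a = e) : (translateBand (X := X) i h).IsBand where
  bijective U Q := by
    change TorsorOver (X.over U) at Q
    have hi' {V : C} {f : V ⟶ U} (x : Q.Sec f) {a a' : A.obj.obj (op V)}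
        (haa : Q.act (i.hom.app _ a) x = Q.act (i.hom.app _ a') x) : a = a' :=
      hi _ (Q.act_injective x haa)
    constructor
    · intro a a' haa
      obtain ⟨Z, hZ, hex⟩ := Q.exists_cover (𝟙 U)
      refine ab_ext A Z hZ fun V f hf => ?_
      obtain ⟨x⟩ := hex f hf
      have h₁ := congrArg (fun φ => homSec φ (f ≫ 𝟙 U) x) haa
      refine hi' x ?_
      rw [ab_naturality, ab_naturality, show f.op = (f ≫ 𝟙 U).op by simp]
      exact h₁
    · intro φ
      change Q ⟶ Q at φ
      have ex {V : C} (f : V ⟶ U) (x : Q.Sec f) :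
          ∃ a, homSec φ f x = Q.act (i.hom.app (op V) a) x := by
        obtain ⟨e, he⟩ := Q.exists_act x (homSec φ f x)
        obtain ⟨a, rfl⟩ := hstab e (Q.toSec x) (by rw [← toSec_act, he, toSec_homSec])
        exact ⟨a, he.symm⟩
      obtain ⟨Z, hZ, hne⟩ := Q.exists_cover (𝟙 U)
      obtain ⟨a, ha⟩ := ab_glue A (V := U)
        (fun V f a => ∃ x : Q.Sec f, homSec φ f x = Q.act (i.hom.app (op V) a) x)
        (by
          rintro V V' f g a ⟨x, hx⟩
          exact ⟨Q.res g rfl x, by rw [homSec_res, hx, res_act, ab_naturality]⟩)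
        (by
          rintro V f a a' ⟨x, hx⟩ ⟨x', hx'⟩
          obtain ⟨e, rfl⟩ := Q.exists_act x x'
          refine hi' (Q.act e x) ?_
          rw [← hx', homSec_act, hx, act_comm])
        Z hZ (fun V f hf => by
          obtain ⟨x⟩ := hne f hf
          obtain ⟨a, ha⟩ := ex f (Q.res (𝟙 V) (by simp) x)
          exact ⟨a, _, ha⟩)
      refine ⟨a, homSec_ext fun V f x => ?_⟩
      obtain ⟨a', ha'⟩ := ex f x
      rw [ha', ← ha f a' ⟨x, ha'⟩, ab_naturality]
      rfl
  map_add U Q a b := by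
    change TorsorOver (X.over U) at Q
    refine homSec_ext fun V f x => ?_
    change Q.act (E.obj.map f.op (i.hom.app _ (a + b))) x =
      Q.act (E.obj.map f.op (i.hom.app _ b)) (Q.act (E.obj.map f.op (i.hom.app _ a)) x)
    rw [map_add, map_add, add_comm, add_act]
  naturality U Q R φ a := homSec_ext fun V f x => homSec_act φ _ x
  restrict U V f Q a := by
    change TorsorOver (X.over U) at Q
    refine homSec_ext fun W g x => ?_
    change Q.act (E.obj.map (g ≫ f).op (i.hom.app _ a)) x =
      Q.act (E.obj.map g.op (i.hom.app _ (A.obj.map f.op a))) x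
    rw [ab_naturality, ab_map_comp, ← op_comp]

/-- Two pairs over `U` are locally isomorphic if their images in `X` lie locally in one orbit. -/
lemma exists_local_hom {Q R : TorsorOver (X.over U)}
    (h : ∀ ⦃V : C⦄ (f : V ⟶ U) (x : Q.Sec f) (y : R.Sec f), ∃ Z ∈ J V, ∀ ⦃W : C⦄ (g : W ⟶ V), Z g →
      ∃ e : E.obj.obj (op W), X.carrier.obj.map g.op (R.toSec y) =
        X.act e (X.carrier.obj.map g.op (Q.toSec x))) :
    ∃ Z ∈ J U, ∀ ⦃V : C⦄ (f : V ⟶ U), Z f → Nonempty ((pull X f).obj Q ⟶ (pull X f).obj R) := by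
  refine ⟨sieveOf U (fun V f => ∃ (x : Q.Sec f) (y : R.Sec f), Q.toSec x = R.toSec y) ?_, ?_, ?_⟩
  · rintro V W f g ⟨x, y, hxy⟩
    exact ⟨Q.res g rfl x, R.res g rfl y, by rw [toSec_res, toSec_res, hxy]⟩
  · obtain ⟨Z, hZ, hex⟩ := Q.exists_cover (𝟙 U)
    refine J.transitive hZ _ fun V f hf => ?_
    obtain ⟨x⟩ := hex f hf
    obtain ⟨Z', hZ', hex'⟩ := R.exists_cover (f ≫ 𝟙 U)
    refine J.transitive hZ' _ fun W g hg => ?_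
    obtain ⟨y⟩ := hex' g hg
    obtain ⟨Z'', hZ'', h''⟩ := h (g ≫ f ≫ 𝟙 U) (Q.res g rfl x) y
    refine J.superset_covering (fun W' k hk => ?_) hZ''
    obtain ⟨e, he⟩ := h'' k hk
    refine ⟨Q.act e (Q.res (f' := (k ≫ g) ≫ f) k (by simp) (Q.res g rfl x)), R.res k (by simp) y, ?_⟩
    rw [toSec_act, Q.toSec_res _ k, R.toSec_res, he]
  · rintro V f ⟨x, y, hxy⟩
    exact ⟨(exists_pull_hom x y hxy).choose⟩

end TorsorOver

/-! ### Trivial pairs and the map from the prestack of a complex -/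

namespace TorsorOver
variable {C : Type u} [Category.{v} C] {J : GrothendieckTopology C}
  {E : Sheaf J AddCommGrpCat.{max u v}} {X : ActionSheaf E} {U V W T S : C}

/-- The trivial torsor over `U` with the equivariant map that sends `0` to the section `x` of `X`. -/
def trivialPair (x : X.carrier.obj.obj (op U)) : TorsorOver (X.over U) where
  torsor := (ActionSheaf.ofHom (𝟙 E)).over U
  isTorsor :=
    { existsUnique_act := fun V (y z : E.obj.obj (op V.unop.left)) =>
        ⟨(z - y : E.obj.obj (op V.unop.left)), sub_add_cancel z y,
          fun (e : E.obj.obj (op V.unop.left)) (he : e + y = z) => eq_sub_of_add_eq he⟩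
      locally_nonempty := fun V => ⟨⊤, (J.over U).top_mem _, fun W _ _ =>
        ⟨(0 : E.obj.obj (op W.left))⟩⟩ }
  toX := ⟨{
    app V := ↾fun (e : E.obj.obj (op V.unop.left)) =>
      (X.act e (X.carrier.obj.map V.unop.hom.op x) : X.carrier.obj.obj (op V.unop.left))
    naturality V V' g := by
      refine ConcreteCategory.hom_ext _ _ fun (e : E.obj.obj (op V.unop.left)) => ?_
      refine Eq.trans ?_ (X.map_act g.unop.left.op e _).symm
      change X.act (E.obj.map g.unop.left.op e) _ = X.act (E.obj.map g.unop.left.op e) _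
      rw [← Functor.map_comp_apply, ← op_comp, Over.w] }⟩
  equivariant := fun {V} (e c : E.obj.obj (op V.unop.left)) => X.add_act e c _

/-- A section of a trivial pair, given as a section of the group. -/
def trivSec (x : X.carrier.obj.obj (op U)) {f : V ⟶ U} (c : E.obj.obj (op V)) :
    (trivialPair x).Sec f := c

/-- The translation by a section `e` of `E` with `e • y = x`, from the trivial pair of `x` to that of
`y`. -/
def trivialPairHom {x y : X.carrier.obj.obj (op U)} (e : E.obj.obj (op U)) (he : X.act e y = x) :
    trivialPair x ⟶ trivialPair y where
  hom := ⟨{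
    app V := ↾fun (c : E.obj.obj (op V.unop.left)) =>
      (c + E.obj.map V.unop.hom.op e : E.obj.obj (op V.unop.left))
    naturality V V' g := by
      refine ConcreteCategory.hom_ext _ _ fun (c : E.obj.obj (op V.unop.left)) => ?_
      change E.obj.map g.unop.left.op c + _ = E.obj.map g.unop.left.op (c + _)
      rw [map_add, ab_map_comp, ← op_comp, Over.w] }⟩
  equivariant := fun {V} (a c : E.obj.obj (op V.unop.left)) => add_assoc a c _
  comp_toX := fun {V} (c : E.obj.obj (op V.unop.left)) => by
    change X.act (c + _) _ = X.act c _
    rw [X.add_act, ← X.map_act, he]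

/-- Trivial pairs are compatible with pull-back. -/
def trivialPairPull (x : X.carrier.obj.obj (op U)) (f : V ⟶ U) {y : X.carrier.obj.obj (op V)}
    (h : X.carrier.obj.map f.op x = y) :
    trivialPair y ≅ (pull X f).obj (trivialPair x) :=
  isoMk ((ActionSheaf.ofHom (𝟙 E)).carrier.pushforwardOverMapIso f).symm
    (fun _ _ => rfl) (fun {W} (c : E.obj.obj (op W.unop.left)) => by
      subst h
      change X.act c (X.carrier.obj.map (W.unop.hom ≫ f).op x) =
        X.act c (X.carrier.obj.map W.unop.hom.op (X.carrier.obj.map f.op x))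
      rw [← Functor.map_comp_apply]
      rfl)

lemma hom_ext_of_sec {Q R : TorsorOver (X.over U)} {φ ψ : Q ⟶ R} (x : Q.Sec (𝟙 U))
    (h : homSec φ (𝟙 U) x = homSec ψ (𝟙 U) x) : φ = ψ := by
  refine homSec_ext fun V f y => ?_
  obtain ⟨e, rfl⟩ := Q.exists_act (Q.res f (Category.comp_id f) x) y
  rw [homSec_act, homSec_act, homSec_res, homSec_res, h]

/-- Every morphism between trivial pairs is the translation by the image of the section `0`. -/
lemma exists_trivialPairHom {x y : X.carrier.obj.obj (op U)} (φ : trivialPair x ⟶ trivialPair y) :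
    ∃ (e : E.obj.obj (op U)) (he : X.act e y = x), trivialPairHom e he = φ := by
  let e : E.obj.obj (op U) := homSec φ (𝟙 U) (trivSec x 0)
  have h₁ : X.act e (X.carrier.obj.map (𝟙 U).op y) = X.act 0 (X.carrier.obj.map (𝟙 U).op x) :=
    toSec_homSec φ (trivSec x (f := 𝟙 U) 0)
  rw [op_id, Functor.map_id_apply, Functor.map_id_apply, X.zero_act] at h₁
  refine ⟨e, h₁, hom_ext_of_sec (trivSec x 0) ?_⟩
  change (0 : E.obj.obj (op U)) + E.obj.map (𝟙 (op U)) e = e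
  rw [zero_add, ab_map_id]

/-- A section of a pair trivializes it. -/
lemma exists_trivialPair_iso (Q : TorsorOver (X.over U)) {f : V ⟶ U} (x : Q.Sec f) :
    Nonempty (trivialPair (Q.toSec x) ≅ (pull X f).obj Q) := by
  obtain ⟨φ, -⟩ := exists_pull_hom (Q := trivialPair (Q.toSec x)) (R := Q) (f₁ := 𝟙 V) (f₂ := f)
    (trivSec (Q.toSec x) 0) x (by
      change X.act 0 (X.carrier.obj.map (𝟙 (op V)) (Q.toSec x)) = _
      rw [Functor.map_id_apply, X.zero_act])
  exact ⟨trivialPairPull (Q.toSec x) (𝟙 V) (by rw [op_id, Functor.map_id_apply]) ≪≫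
    @asIso _ _ _ _ φ (isIso φ)⟩

end TorsorOver

section PrestackMap
variable {C : Type u} [Category.{v} C] {J : GrothendieckTopology C}
  {L₁ L₀ : Sheaf J AddCommGrpCat.{max u v}} (d : L₁ ⟶ L₀)
open TorsorOver

/-- The functor that sends a section `g` of `L₀` to the trivial pair of `g`. -/
def prestackFunctor (U : C) : PreObj d U ⥤ TorsorOver ((ActionSheaf.ofHom d).over U) where
  obj g := trivialPair (X := ActionSheaf.ofHom d) (U := U) g.val
  map {g g'} h := trivialPairHom (X := ActionSheaf.ofHom d) h.val (by
    change d.hom.app (op U) h.val + g'.val = g.val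
    rw [h.eq, sub_add_cancel])
  map_id g := homSec_ext fun V f (c : L₁.obj.obj (op V)) => by
    change c + L₁.obj.map f.op 0 = c
    rw [map_zero, add_zero]
  map_comp {g g' g''} h h' := homSec_ext fun V f (c : L₁.obj.obj (op V)) => by
    change c + L₁.obj.map f.op (h.val + h'.val) = c + L₁.obj.map f.op h.val + L₁.obj.map f.op h'.val
    rw [map_add, add_assoc]

/-- The morphism from the prestack of the complex `d : L₁ ⟶ L₀` to the stack of pairs. -/
def prestackMap : Pseudofunctor.StrongTrans (prestack d) (torsorStack (ActionSheaf.ofHom d)) where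
  app U := (prestackFunctor d U.as.unop).toCatHom
  naturality {U V} f := Cat.Hom.isoMk (NatIso.ofComponents
    (fun (g : PreObj d U.as.unop) => trivialPairPull (X := ActionSheaf.ofHom d) g.val f.as.unop rfl)
    (fun {g g'} h => homSec_ext fun W k (c : L₁.obj.obj (op W)) => by
      change c + L₁.obj.map k.op (L₁.obj.map f.as h.val) = c + L₁.obj.map (k ≫ f.as.unop).op h.val
      rw [ab_map_comp]
      rfl))
  naturality_naturality {U V f g} η := by
    obtain rfl := LocallyDiscrete.eq_of_hom η
    obtain rfl : η = 𝟙 f := Subsingleton.elim _ _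
    simp only [PrelaxFunctor.map₂_id]
    exact (Bicategory.id_whiskerRight _ _ =≫ _).trans ((Category.id_comp _).trans
      ((Category.comp_id _).symm.trans (_ ≫= (Bicategory.whiskerLeft_id _ _).symm)))
  naturality_id U := by
    apply Cat.Hom₂.ext
    refine NatTrans.ext (funext fun (g : PreObj d U.as.unop) => ?_)
    refine homSec_ext fun W k (c : L₁.obj.obj (op W)) => ?_
    change L₁.obj.map (𝟙 _) c = c + L₁.obj.map k.op 0
    rw [map_zero, add_zero, ab_map_id]
  naturality_comp {U V W} f g := by
    apply Cat.Hom₂.ext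
    refine NatTrans.ext (funext fun (x : PreObj d U.as.unop) => ?_)
    refine homSec_ext fun T k (c : L₁.obj.obj (op T)) => ?_
    change L₁.obj.map (𝟙 _) c = c + L₁.obj.map k.op 0
    rw [map_zero, add_zero, ab_map_id]

lemma isAssociatedStack_prestackMap : IsAssociatedStack J (prestackMap d) where
  isStack := isStack_torsorStack _
  locally_faithful U g g' φ ψ h := by
    have h₂ : (0 : L₁.obj.obj (op U)) + L₁.obj.map (𝟙 (op U)) φ.val =
        0 + L₁.obj.map (𝟙 (op U)) ψ.val :=
      congrArg (fun m => homSec (Q := trivialPair (X := ActionSheaf.ofHom d) g.val)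
        (R := trivialPair (X := ActionSheaf.ofHom d) g'.val) m (𝟙 U) (trivSec _ 0)) h
    rw [zero_add, zero_add, ab_map_id, ab_map_id] at h₂
    have : φ = ψ := PreObj.hom_ext h₂
    exact ⟨⊤, J.top_mem _, fun V f _ => by rw [this]⟩
  locally_full U g g' φ := by
    refine ⟨⊤, J.top_mem _, fun V f _ => ?_⟩
    generalize ((prestackMap d).naturality f.op.toLoc).hom.toNatTrans.app g ≫ _ = χ
    obtain ⟨e, he, h⟩ := exists_trivialPairHom (X := ActionSheaf.ofHom d)
      (x := L₀.obj.map f.op g.val) (y := L₀.obj.map f.op g'.val) χ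
    exact ⟨{ val := e, eq := eq_sub_of_add_eq he }, h⟩
  locally_essSurj U Q := by
    obtain ⟨Z, hZ, hex⟩ := TorsorOver.exists_cover Q (𝟙 U)
    refine ⟨Z, hZ, fun V f hf => ?_⟩
    obtain ⟨x⟩ := hex f hf
    let x' : TorsorOver.Sec Q f := TorsorOver.res Q (𝟙 V) (by simp) x
    exact ⟨⟨TorsorOver.toSec Q x'⟩, exists_trivialPair_iso Q x'⟩

end PrestackMap

/-! ### Restriction of morphisms to full subcategories -/

section Restrict
universe w₁ v₁ u₁ v' u'
variable {B : Type u₁} [Bicategory.{w₁, v₁} B] {F G : B ⥤ᵖ Cat.{v', u'}}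

/-- The restriction of a strong transformation to full subcategories. -/
def restrictTrans (η : Pseudofunctor.StrongTrans F G) (P : F.ObjectProperty) (P' : G.ObjectProperty)
    [P.IsClosedUnderMapObj] [P'.IsClosedUnderMapObj]
    (h : ∀ (X : B) (M : F.obj X), P.prop X M → P'.prop X ((η.app X).toFunctor.obj M)) :
    Pseudofunctor.StrongTrans P.fullsubcategory P'.fullsubcategory where
  app X := ((P'.prop X).lift ((P.prop X).ι ⋙ (η.app X).toFunctor) (fun M => h X _ M.2)).toCatHom
  naturality {X Y} f := Cat.Hom.isoMk (NatIso.ofComponents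
    (fun M : P.Obj X => ObjectProperty.isoMk _ ((Cat.Hom.toNatIso (η.naturality f)).app M.obj))
    (fun {M N} φ => ObjectProperty.hom_ext _
      ((Cat.Hom.toNatIso (η.naturality f)).hom.naturality φ.hom)))
  naturality_naturality {X Y f g} α := by
    apply Cat.Hom₂.ext
    refine NatTrans.ext (funext fun (M : P.Obj X) => ObjectProperty.hom_ext _ ?_)
    exact congrArg (fun m => m.toNatTrans.app M.obj) (η.naturality_naturality α)
  naturality_id X := by
    apply Cat.Hom₂.ext
    refine NatTrans.ext (funext fun (M : P.Obj X) => ObjectProperty.hom_ext _ ?_)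
    exact congrArg (fun m => m.toNatTrans.app M.obj) (η.naturality_id X)
  naturality_comp {X Y Z} f g := by
    apply Cat.Hom₂.ext
    refine NatTrans.ext (funext fun (M : P.Obj X) => ObjectProperty.hom_ext _ ?_)
    exact congrArg (fun m => m.toNatTrans.app M.obj) (η.naturality_comp f g)

end Restrict

/-! ### The fibre of the Picard stack and the lifting gerbe -/

section FiberGerbe
variable {C : Type u} [Category.{v} C] {J : GrothendieckTopology C}
  {A L₁ L₀ B : Sheaf J AddCommGrpCat.{max u v}} (S : FourTermExact A L₁ L₀ B) (β : GlobalSection B)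
open TorsorOver

namespace FourTermExact

lemma liesOver_trivialPair {U : C} (g : L₀.obj.obj (op U)) :
    S.LiesOver (trivialPair (X := ActionSheaf.ofHom S.d) (U := U) g) (S.p.hom.app (op U) g) := by
  intro V f (c : L₁.obj.obj (op V))
  change S.p.hom.app (op V) (S.d.hom.app (op V) c + L₀.obj.map f.op g) = _
  rw [map_add, p_d, zero_add, ab_naturality]

/-- Lying over a section of `B` is a local property of pairs. -/
lemma liesOver_of_local {U : C} (Q : TorsorOver ((ActionSheaf.ofHom S.d).over U))
    (b : B.obj.obj (op U)) (R : Sieve U) (hR : R ∈ J U)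
    (h : ∀ ⦃V : C⦄ (f : V ⟶ U), R f → ∃ N : TorsorOver ((ActionSheaf.ofHom S.d).over V),
      S.LiesOver N (B.obj.map f.op b) ∧
        Nonempty (N ≅ (pull (ActionSheaf.ofHom S.d) f).obj Q)) : S.LiesOver Q b := by
  intro V f (q : Q.Sec f)
  refine ab_ext B (R.pullback f) (J.pullback_stable f hR) fun W g hg => ?_
  obtain ⟨N, hN, ⟨e⟩⟩ := h (g ≫ f) hg
  let q' : ((pull (ActionSheaf.ofHom S.d) (g ≫ f)).obj Q).Sec (𝟙 W) :=
    Q.res (f' := 𝟙 W ≫ g ≫ f) g (by simp) q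
  have h₁ := hN (𝟙 W) (homSec e.inv (𝟙 W) q')
  have h₂ : N.toSec (homSec e.inv (𝟙 W) q') = L₀.obj.map g.op (Q.toSec q) :=
    (toSec_homSec e.inv q').trans (Q.toSec_res q g _)
  have h₃ : S.p.hom.app (op W) (L₀.obj.map g.op (Q.toSec q)) =
      B.obj.map (𝟙 W).op (B.obj.map (g ≫ f).op b) := by
    rw [← h₂]; exact h₁
  rw [op_id, ab_map_id] at h₃
  rw [ab_map_comp, ← op_comp, ← h₃]
  exact (ab_naturality S.p g.op _).symm

lemma isStack_fiber : (S.fiber β).IsStack J := by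
  have := isStack_torsorStack (ActionSheaf.ofHom S.d)
  refine isStack_fullsubcategory (S.fiberProperty β) fun U M R hR h => ?_
  refine S.liesOver_of_local (U := U) M _ R hR fun V f hf => ?_
  obtain ⟨N, hN, ⟨e⟩⟩ := h f hf
  refine ⟨N, ?_, ⟨e⟩⟩
  rw [show B.obj.map f.op (β.1 (op U)) = β.1 (op V) from β.2 f.op]
  exact hN

/-- The object of the fibre over `β` given by a section of `(L₀)_β`. -/
def fiberTrivial {U : C} (g : L₀.obj.obj (op U)) (hg : S.p.hom.app (op U) g = β.1 (op U)) :
    (S.fiber β).obj (.mk (op U)) :=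
  ⟨trivialPair (X := ActionSheaf.ofHom S.d) (U := U) g, by
    change S.LiesOver (U := U) (trivialPair (X := ActionSheaf.ofHom S.d) g) (β.1 (op U))
    rw [← hg]
    exact S.liesOver_trivialPair g⟩

/-- Sections of `A` act trivially on `L₀`. -/
lemma ofHom_act_ι ⦃V : Cᵒᵖ⦄ (a : A.obj.obj V) (x : L₀.obj.obj V) :
    (ActionSheaf.ofHom S.d).act (S.ι.hom.app V a) x = x := by
  change S.d.hom.app V (S.ι.hom.app V a) + x = x
  rw [d_ι_apply, zero_add]

lemma isBand_translateBand_ofHom :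
    (translateBand (X := ActionSheaf.ofHom S.d) S.ι S.ofHom_act_ι).IsBand :=
  isBand_translateBand _ _ S.ι_injective fun V e (x : L₀.obj.obj V) h =>
    S.exists_ι (add_eq_right.1 (show S.d.hom.app V e + x = x from h))

lemma isBand_fiberBand : (S.fiberBand β).IsBand where
  bijective U Q := by
    have h := S.isBand_translateBand_ofHom.bijective Q.obj
    refine ⟨fun a b hab => h.1 (congrArg InducedCategory.Hom.hom hab), fun φ => ?_⟩
    obtain ⟨a, ha⟩ := h.2 φ.hom
    exact ⟨a, ObjectProperty.hom_ext _ ha⟩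
  map_add U Q a b := ObjectProperty.hom_ext _ (S.isBand_translateBand_ofHom.map_add Q.obj a b)
  naturality U Q R φ a :=
    ObjectProperty.hom_ext _ (S.isBand_translateBand_ofHom.naturality φ.hom a)
  restrict U V f Q a := ObjectProperty.hom_ext _ (S.isBand_translateBand_ofHom.restrict f Q.obj a)

lemma isGerbe_fiber : IsGerbe (S.fiber β) J where
  isStack := S.isStack_fiber β
  isGroupoid U := ⟨fun {M N} φ => by
    have : IsIso φ.hom := TorsorOver.isIso (X := ActionSheaf.ofHom S.d) (U := U) φ.hom
    exact (ObjectProperty.isIso_hom_iff _).1 this⟩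
  locally_nonempty U := by
    obtain ⟨Z, hZ, h⟩ := S.exists_local_p (β.1 (op U))
    refine ⟨Z, hZ, fun V f hf => ?_⟩
    obtain ⟨g, hg⟩ := h f hf
    exact ⟨S.fiberTrivial β g (hg.trans (β.2 f.op))⟩
  locally_connected U M N := by
    obtain ⟨Z, hZ, h⟩ := exists_local_hom (X := ActionSheaf.ofHom S.d) (U := U) (Q := M.obj)
      (R := N.obj) (fun V f x y => by
        have hx : S.p.hom.app (op V) (TorsorOver.toSec (X := ActionSheaf.ofHom S.d) (U := U) M.obj x) =
          B.obj.map f.op (β.1 (op U)) := M.2 f x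
        have hy : S.p.hom.app (op V) (TorsorOver.toSec (X := ActionSheaf.ofHom S.d) (U := U) N.obj y) =
          B.obj.map f.op (β.1 (op U)) := N.2 f y
        generalize TorsorOver.toSec (X := ActionSheaf.ofHom S.d) (U := U) M.obj x = m at hx ⊢
        generalize TorsorOver.toSec (X := ActionSheaf.ofHom S.d) (U := U) N.obj y = n at hy ⊢
        change L₀.obj.obj (op V) at m n
        obtain ⟨Z, hZ, h⟩ := S.exists_local_d (x := n - m) (by rw [map_sub, hx, hy, sub_self])
        refine ⟨Z, hZ, fun W g hg => ?_⟩
        obtain ⟨e, he⟩ := h g hg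
        refine ⟨e, ?_⟩
        change L₀.obj.map g.op n = S.d.hom.app _ e + L₀.obj.map g.op m
        rw [he, map_sub, sub_add_cancel])
    exact ⟨Z, hZ, fun V f hf => (h f hf).map ObjectProperty.homMk⟩

lemma isAbelianGerbe_fiberBand : IsAbelianGerbe (S.fiberBand β) :=
  ⟨S.isGerbe_fiber β, S.isBand_fiberBand β⟩

/-- The morphism from the prestack of the sections `g` of `L₀` with `p g = β` to the fibre over `β`. -/
def prestackFiberMap : Pseudofunctor.StrongTrans (S.prestackFiber β) (S.fiber β) :=
  restrictTrans (prestackMap S.d) (S.prestackFiberProperty β) (S.fiberProperty β)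
    fun U g hg => (S.fiberTrivial β (U := U.as.unop) g.val hg).2

lemma isAssociatedStack_prestackFiberMap : IsAssociatedStack J (S.prestackFiberMap β) where
  isStack := S.isStack_fiber β
  locally_faithful U g g' φ ψ h := by
    obtain ⟨Z, hZ, h'⟩ := (isAssociatedStack_prestackMap S.d).locally_faithful φ.hom ψ.hom
      (congrArg (fun m : ((S.prestackFiberMap β).app _).toFunctor.obj g ⟶
        ((S.prestackFiberMap β).app _).toFunctor.obj g' => InducedCategory.Hom.hom m) h)
    exact ⟨Z, hZ, fun V f hf => ObjectProperty.hom_ext _ (h' f hf)⟩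
  locally_full U g g' φ := by
    obtain ⟨Z, hZ, h'⟩ := (isAssociatedStack_prestackMap S.d).locally_full (x := g.obj) (y := g'.obj)
      φ.hom
    refine ⟨Z, hZ, fun V f hf => ?_⟩
    obtain ⟨ψ, hψ⟩ := h' f hf
    exact ⟨ObjectProperty.homMk ψ, ObjectProperty.hom_ext _ hψ⟩
  locally_essSurj U Q := by
    obtain ⟨Z, hZ, hex⟩ := TorsorOver.exists_cover (X := ActionSheaf.ofHom S.d) (U := U) Q.obj (𝟙 U)
    refine ⟨Z, hZ, fun V f hf => ?_⟩
    obtain ⟨x⟩ := hex f hf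
    let x' : TorsorOver.Sec (X := ActionSheaf.ofHom S.d) (U := U) Q.obj f :=
      TorsorOver.res (X := ActionSheaf.ofHom S.d) (U := U) Q.obj (𝟙 V) (by simp) x
    obtain ⟨e⟩ := exists_trivialPair_iso (X := ActionSheaf.ofHom S.d) (U := U) Q.obj x'
    exact ⟨⟨⟨TorsorOver.toSec (X := ActionSheaf.ofHom S.d) (U := U) Q.obj x'⟩,
      (Q.2 f x').trans (β.2 f.op)⟩, ⟨ObjectProperty.isoMk _ e⟩⟩

lemma preservesBand_prestackFiberMap :
    PreservesBand (S.prestackFiberMap β) (S.prestackBand β) (S.fiberBand β) := by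
  intro U g a
  refine ObjectProperty.hom_ext _ ?_
  refine homSec_ext (X := ActionSheaf.ofHom S.d) (U := U)
    (Q := trivialPair (X := ActionSheaf.ofHom S.d) g.obj.val)
    (R := trivialPair (X := ActionSheaf.ofHom S.d) g.obj.val) fun V f (c : L₁.obj.obj (op V)) => ?_
  exact add_comm c _

lemma isTorsor_fiberTorsor : (S.fiberTorsor β).IsTorsor where
  existsUnique_act V := by
    rintro ⟨x, hx⟩ ⟨y, hy⟩
    change L₀.obj.obj V at x y
    change S.p.hom.app V x = β.1 V at hx
    change S.p.hom.app V y = β.1 V at hy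
    obtain ⟨c, hc⟩ := S.exists_j (x := y - x) (by rw [map_sub, hx, hy, sub_self])
    refine ⟨c, Subtype.ext ?_, fun c' hc' => sections_injective S.j V ?_⟩
    · change S.j.hom.app V c + x = y
      rw [hc, sub_add_cancel]
    · rw [hc]
      exact eq_sub_of_add_eq (congrArg Subtype.val hc')
  locally_nonempty U := by
    obtain ⟨Z, hZ, h⟩ := S.exists_local_p (β.1 (op U))
    refine ⟨Z, hZ, fun V f hf => ?_⟩
    obtain ⟨g, hg⟩ := h f hf
    exact ⟨⟨g, hg.trans (β.2 f.op)⟩⟩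

end FourTermExact
end FiberGerbe

section LiftingGerbe
variable {C : Type u} [Category.{v} C] {J : GrothendieckTopology C}
  {A L₁ L₀ B : Sheaf J AddCommGrpCat.{max u v}} (S : FourTermExact A L₁ L₀ B) (β : GlobalSection B)
open TorsorOver

namespace FourTermExact

lemma isBand_liftingBand : (liftingBand S.ι S.π S.ι_π (S.fiberTorsor β)).IsBand := by
  refine isBand_translateBand (X := (S.fiberTorsor β).res S.π) S.ι (fun V a x => ?_) S.ι_injective
    (fun V e x h => ?_)
  · have h : S.π.hom.app V (S.ι.hom.app V a) = 0 :=
      congr_arg (fun ψ : A ⟶ S.im => ψ.hom.app V a) S.ι_π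
    change (S.fiberTorsor β).act (S.π.hom.app V (S.ι.hom.app V a)) x = x
    rw [h]
    exact (S.fiberTorsor β).zero_act x
  · obtain ⟨x, hx⟩ := x
    change L₀.obj.obj V at x
    have h₁ : S.j.hom.app V (S.π.hom.app V e) + x = x := congrArg Subtype.val h
    refine S.exists_ι ?_
    rw [← S.j_π]
    exact add_eq_right.1 h₁

lemma isGerbe_liftingGerbe : IsGerbe (liftingGerbe S.π (S.fiberTorsor β)) J where
  isStack := isStack_torsorStack _
  isGroupoid U := ⟨fun {M N} φ => TorsorOver.isIso (X := (S.fiberTorsor β).res S.π) (U := U) φ⟩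
  locally_nonempty U := by
    obtain ⟨Z, hZ, h⟩ := (S.isTorsor_fiberTorsor β).locally_nonempty U
    exact ⟨Z, hZ, fun V f hf =>
      (h f hf).map (trivialPair (X := (S.fiberTorsor β).res S.π) (U := V))⟩
  locally_connected U M N := by
    refine exists_local_hom (X := (S.fiberTorsor β).res S.π) (U := U) (Q := M) (R := N)
      (fun V f m n => ?_)
    generalize TorsorOver.toSec (X := (S.fiberTorsor β).res S.π) (U := U) M m = x
    generalize TorsorOver.toSec (X := (S.fiberTorsor β).res S.π) (U := U) N n = y
    obtain ⟨x, hx⟩ := x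
    obtain ⟨y, hy⟩ := y
    change L₀.obj.obj (op V) at x y
    change S.p.hom.app (op V) x = β.1 (op V) at hx
    change S.p.hom.app (op V) y = β.1 (op V) at hy
    obtain ⟨Z, hZ, h⟩ := S.exists_local_d (x := y - x) (by rw [map_sub, hx, hy, sub_self])
    refine ⟨Z, hZ, fun W g hg => ?_⟩
    obtain ⟨e, he⟩ := h g hg
    refine ⟨e, Subtype.ext ?_⟩
    change L₀.obj.map g.op y = S.j.hom.app _ (S.π.hom.app _ e) + L₀.obj.map g.op x
    rw [j_π, he, map_sub, sub_add_cancel]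

lemma isAbelianGerbe_liftingBand :
    IsAbelianGerbe (liftingBand S.ι S.π S.ι_π (S.fiberTorsor β)) :=
  ⟨S.isGerbe_liftingGerbe β, S.isBand_liftingBand β⟩

variable {β} in
/-- A pair `(Q, s)` with `p ∘ s = β` as a pair over the torsor `(L₀)_β`. -/
noncomputable def corestrict {U : C} (Q : TorsorOver ((ActionSheaf.ofHom S.d).over U))
    (hQ : S.LiesOver Q (β.1 (op U))) : TorsorOver (((S.fiberTorsor β).res S.π).over U) where
  torsor := Q.torsor
  isTorsor := Q.isTorsor
  toX := ⟨{
    app V := ↾fun q => (⟨Q.toX.hom.app V q, (hQ V.unop.hom q).trans (β.2 V.unop.hom.op)⟩ :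
      {x : L₀.obj.obj (op V.unop.left) // S.p.hom.app (op V.unop.left) x = β.1 (op V.unop.left)})
    naturality V W g := by
      refine ConcreteCategory.hom_ext _ _ fun q => Subtype.ext ?_
      exact NatTrans.naturality_apply Q.toX.hom g q }⟩
  equivariant {V} e q := Subtype.ext ((Q.equivariant (V := V) e q).trans
    (congrArg (fun y : L₀.obj.obj (op V.unop.left) =>
      y + (show L₀.obj.obj (op V.unop.left) from Q.toX.hom.app V q)) (S.j_π (op V.unop.left) e).symm))

variable {β} in
/-- The pair over `L₀` underlying a pair over the torsor `(L₀)_β`. -/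
noncomputable def extendPair {U : C} (Q : TorsorOver (((S.fiberTorsor β).res S.π).over U)) :
    TorsorOver ((ActionSheaf.ofHom S.d).over U) where
  torsor := Q.torsor
  isTorsor := Q.isTorsor
  toX := ⟨{
    app V := ↾fun q => (Subtype.val (p := fun x : L₀.obj.obj (op V.unop.left) =>
        S.p.hom.app (op V.unop.left) x = β.1 (op V.unop.left)) (Q.toX.hom.app V q) :
          L₀.obj.obj (op V.unop.left))
    naturality V W g := by
      ext q
      exact congrArg Subtype.val (NatTrans.naturality_apply Q.toX.hom g q) }⟩
  equivariant {V} e q := (congrArg Subtype.val (Q.equivariant (V := V) e q)).trans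
    (congrArg (· + (Subtype.val (p := fun x : L₀.obj.obj (op V.unop.left) =>
        S.p.hom.app (op V.unop.left) x = β.1 (op V.unop.left)) (Q.toX.hom.app V q)))
      (S.j_π (op V.unop.left) e))

/-- The comparison of the fibre over `β` with the lifting gerbe, over one object of the site. -/
noncomputable def toLiftingFunctor (U : C) : (S.fiber β).obj (.mk (op U)) ⥤
    TorsorOver (((S.fiberTorsor β).res S.π).over U) where
  obj Q := S.corestrict (U := U) Q.obj Q.property
  map {Q R} φ :=
    let φ' : TorsorOver.Hom (X := (ActionSheaf.ofHom S.d).over U) Q.obj R.obj := φ.hom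
    { hom := φ'.hom
      equivariant := φ'.equivariant
      comp_toX q := Subtype.ext (φ'.comp_toX q) }

instance (U : C) : (S.toLiftingFunctor β U).IsEquivalence where
  faithful := ⟨fun {Q R φ ψ} h => ObjectProperty.hom_ext _
    (TorsorOver.Hom.ext (X := (ActionSheaf.ofHom S.d).over U)
      (congrArg (fun m : (S.toLiftingFunctor β U).obj Q ⟶ (S.toLiftingFunctor β U).obj R =>
        TorsorOver.Hom.hom m) h))⟩
  full := ⟨fun {Q R} φ => ⟨ObjectProperty.homMk
    { hom := φ.hom
      equivariant := φ.equivariant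
      comp_toX q := congrArg Subtype.val (φ.comp_toX q) }, rfl⟩⟩
  essSurj := ⟨fun Q => ⟨⟨S.extendPair Q, fun V f q => Subtype.prop (p := fun x : L₀.obj.obj (op V) =>
      S.p.hom.app (op V) x = β.1 (op V)) (Q.toX.hom.app (op (Over.mk f)) q) |>.trans (β.2 f.op).symm⟩,
    ⟨isoMk (Iso.refl _) (fun _ _ => rfl) (fun _ => rfl)⟩⟩⟩

/-- The comparison of the fibre over `β` with the lifting gerbe. -/
noncomputable def toLiftingGerbe :
    Pseudofunctor.StrongTrans (S.fiber β) (liftingGerbe S.π (S.fiberTorsor β)) where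
  app U := (S.toLiftingFunctor β U.as.unop).toCatHom
  naturality {U V} f := Cat.Hom.isoMk (NatIso.ofComponents
    (fun Q => isoMk (Iso.refl _) (fun _ _ => rfl) (fun _ => rfl))
    (fun {Q R} φ => rfl))
  naturality_naturality {U V f g} η := by
    obtain rfl := LocallyDiscrete.eq_of_hom η
    obtain rfl : η = 𝟙 f := Subsingleton.elim _ _
    simp only [PrelaxFunctor.map₂_id]
    exact (Bicategory.id_whiskerRight _ _ =≫ _).trans ((Category.id_comp _).trans
      ((Category.comp_id _).symm.trans (_ ≫= (Bicategory.whiskerLeft_id _ _).symm)))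
  naturality_id U := by
    apply Cat.Hom₂.ext
    refine NatTrans.ext (funext fun Q => ?_)
    rfl
  naturality_comp {U V W} f g := by
    apply Cat.Hom₂.ext
    refine NatTrans.ext (funext fun Q => ?_)
    rfl

lemma abelianGerbeEquiv_liftingBand : AbelianGerbeEquiv (S.fiberBand β)
    (liftingBand S.ι S.π S.ι_π (S.fiberTorsor β)) :=
  ⟨S.toLiftingGerbe β, fun U => inferInstanceAs (S.toLiftingFunctor β U).IsEquivalence,
    fun _ _ _ => rfl⟩

end FourTermExact
end LiftingGerbe

/-! ### Iterated boundary maps -/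

section Boundary
variable {C : Type u} [Category.{v} C] {J : GrothendieckTopology C}

instance : EnoughInjectives (Sheaf J AddCommGrpCat.{max u v}) := by
  have : EssentiallySmall.{max u v} C := by
    rw [essentiallySmall_iff]
    exact ⟨inferInstance, inferInstance⟩
  have := Sheaf.isGrothendieckAbelian_of_essentiallySmall.{max u v} J AddCommGrpCat.{max u v}
  exact IsGrothendieckAbelian.enoughInjectives.{max u v}

variable {B B' : Sheaf J AddCommGrpCat.{max u v}}

/-- The image of a global section under a morphism of sheaves. -/
def GlobalSection.map (φ : B ⟶ B') (β : GlobalSection B) : GlobalSection B' :=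
  ⟨fun V => φ.hom.app V (β.1 V : B.obj.obj V), fun {V W} f => by
    have h : B.obj.map f (β.1 V : B.obj.obj V) = β.1 W := β.2 f
    exact (ab_naturality φ f _).symm.trans (congrArg (φ.hom.app W) h)⟩

/-- The beginning of an injective resolution of an abelian sheaf. -/
lemma exists_injective_resolution (A : Sheaf J AddCommGrpCat.{max u v}) :
    ∃ (I₀ I₁ R : Sheaf J AddCommGrpCat.{max u v}) (_ : FourTermExact A I₀ I₁ R),
      Injective I₀ ∧ Injective I₁ := by
  let i := Injective.ι A
  let k := Injective.ι (cokernel i)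
  let d := cokernel.π i ≫ k
  refine ⟨_, _, cokernel d,
    { ι := i
      d := d
      p := cokernel.π d
      ι_d := by simp [d]
      d_p := cokernel.condition d
      mono_ι := inferInstance
      exact₁ := ?_
      exact₂ := ShortComplex.exact_cokernel d
      epi_p := inferInstance }, inferInstance, inferInstance⟩
  let φ : ShortComplex.mk i (cokernel.π i) (cokernel.condition i) ⟶
    ShortComplex.mk i d (by simp [d]) := { τ₁ := 𝟙 _, τ₂ := 𝟙 _, τ₃ := k }
  have : Mono φ.τ₃ := inferInstanceAs (Mono k)
  exact (ShortComplex.exact_iff_of_epi_of_isIso_of_mono φ).1 (ShortComplex.exact_cokernel i)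

namespace FourTermExact
variable {A L₁ L₀ L₁' L₀' : Sheaf J AddCommGrpCat.{max u v}} (S : FourTermExact A L₁ L₀ B)
  (S' : FourTermExact A L₁' L₀' B')

/-- Every exact sequence `0 ⟶ A ⟶ L₁ ⟶ L₀ ⟶ B ⟶ 0` maps to each one with injective middle terms. -/
lemma exists_map_of_injective [Injective L₁'] [Injective L₀'] :
    ∃ (φ₁ : L₁ ⟶ L₁') (φ₀ : L₀ ⟶ L₀') (φ : B ⟶ B'), S.ι ≫ φ₁ = S'.ι ∧ S.d ≫ φ₀ = φ₁ ≫ S'.d ∧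
      S.p ≫ φ = φ₀ ≫ S'.p := by
  have := S.mono_ι
  have := S.epi_p
  let φ₁ : L₁ ⟶ L₁' := Injective.factorThru S'.ι S.ι
  have h₁ : S.ι ≫ φ₁ = S'.ι := Injective.comp_factorThru _ _
  have : Epi S.left.g := inferInstanceAs (Epi S.π)
  let ψ : S.im ⟶ L₀' := S.left_shortExact.exact.desc (φ₁ ≫ S'.d) (by
    change S.ι ≫ φ₁ ≫ S'.d = 0
    rw [reassoc_of% h₁, S'.ι_d])
  have hψ : S.π ≫ ψ = φ₁ ≫ S'.d := S.left_shortExact.exact.g_desc _ _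
  let φ₀ : L₀ ⟶ L₀' := Injective.factorThru ψ S.j
  have h₀ : S.j ≫ φ₀ = ψ := Injective.comp_factorThru _ _
  have h₀' : S.d ≫ φ₀ = φ₁ ≫ S'.d := by
    rw [← hψ, ← h₀, ← Category.assoc, image.fac]
  refine ⟨φ₁, φ₀, S.exact₂.desc (φ₀ ≫ S'.p) ?_, h₁, h₀', S.exact₂.g_desc _ _⟩
  change S.d ≫ φ₀ ≫ S'.p = 0
  rw [reassoc_of% h₀', S'.d_p, comp_zero]

end FourTermExact

variable [HasExt.{t} (Sheaf J AddCommGrpCat.{max u v})]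

/-- A global section as a morphism from the constant presheaf `ℤ`. -/
def GlobalSection.constHom (β : GlobalSection B) :
    (Functor.const Cᵒᵖ).obj (AddCommGrpCat.of (ULift.{max u v} ℤ)) ⟶
      (sheafToPresheaf J AddCommGrpCat.{max u v}).obj B where
  app V := AddCommGrpCat.ofHom
    ((zmultiplesHom (B.obj.obj V) (β.1 V)).comp AddEquiv.ulift.toAddMonoidHom)
  naturality V W f := by
    refine ConcreteCategory.hom_ext _ _ fun (n : ULift ℤ) => ?_
    have hb : B.obj.map f (β.1 V : B.obj.obj V) = β.1 W := β.2 f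
    exact (congrArg (n.down • ·) hb).symm.trans
      (map_zsmul (B.obj.map f).hom n.down (β.1 V : B.obj.obj V)).symm

lemma GlobalSection.toH_eq (β : GlobalSection B) : GlobalSection.toH β = Abelian.Ext.mk₀
    (((sheafificationAdjunction J AddCommGrpCat.{max u v}).homEquiv _ _).symm
      (GlobalSection.constHom β)) :=
  rfl

lemma GlobalSection.toH_map (φ : B ⟶ B') (β : GlobalSection B) :
    GlobalSection.toH (GlobalSection.map φ β) =
      (GlobalSection.toH β).comp (Abelian.Ext.mk₀ φ) (zero_add 0) := by
  rw [toH_eq, toH_eq]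
  refine Eq.trans ?_ (Abelian.Ext.mk₀_comp_mk₀ _ _).symm
  refine congrArg Abelian.Ext.mk₀ ?_
  refine Eq.trans ?_ (Adjunction.homEquiv_naturality_right_symm _ _ _)
  refine congrArg ((sheafificationAdjunction J AddCommGrpCat.{max u v}).homEquiv _ _).symm ?_
  refine NatTrans.ext (funext fun V => ConcreteCategory.hom_ext _ _ fun (n : ULift ℤ) => ?_)
  exact (map_zsmul (φ.hom.app V).hom n.down (β.1 V : B.obj.obj V)).symm

lemma GlobalSection.toH_add (α β γ : GlobalSection B)
    (h : ∀ V, (γ.1 V : B.obj.obj V) = (α.1 V : B.obj.obj V) + (β.1 V : B.obj.obj V)) :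
    GlobalSection.toH γ = GlobalSection.toH α + GlobalSection.toH β := by
  rw [toH_eq, toH_eq, toH_eq]
  refine Eq.trans ?_ (Abelian.Ext.mk₀_add _ _)
  refine congrArg Abelian.Ext.mk₀ ?_
  refine Eq.trans ?_
    (map_add ((sheafificationAdjunction J AddCommGrpCat.{max u v}).homAddEquiv _ _).symm _ _)
  refine congrArg ((sheafificationAdjunction J AddCommGrpCat.{max u v}).homEquiv _ _).symm ?_
  refine NatTrans.ext (funext fun V => ConcreteCategory.hom_ext _ _ fun (n : ULift ℤ) => ?_)
  change n.down • (γ.1 V : B.obj.obj V) =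
    n.down • (α.1 V : B.obj.obj V) + n.down • (β.1 V : B.obj.obj V)
  rw [h, smul_add]

namespace FourTermExact
variable {A L₁ L₀ L₁' L₀' : Sheaf J AddCommGrpCat.{max u v}} (S : FourTermExact A L₁ L₀ B)
  (S' : FourTermExact A L₁' L₀' B')

lemma iteratedBoundary_apply (x : Sheaf.H B 0) : S.iteratedBoundary x =
    (x.comp S.right_shortExact.extClass (zero_add 1)).comp S.left_shortExact.extClass rfl :=
  rfl

/-- A morphism of exact sequences that is the identity on `A` commutes with the iterated boundaries. -/
lemma iteratedBoundary_map (φ₁ : L₁ ⟶ L₁') (φ₀ : L₀ ⟶ L₀') (φ : B ⟶ B') (hι : S.ι ≫ φ₁ = S'.ι)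
    (hd : S.d ≫ φ₀ = φ₁ ≫ S'.d) (hp : S.p ≫ φ = φ₀ ≫ S'.p) (x : Sheaf.H B 0) :
    S'.iteratedBoundary (x.comp (Abelian.Ext.mk₀ φ) (zero_add 0)) = S.iteratedBoundary x := by
  let sq : Arrow.mk S.d ⟶ Arrow.mk S'.d := Arrow.homMk φ₁ φ₀ hd.symm
  let ψ : S.im ⟶ S'.im := image.map sq
  have h₁ : S.π ≫ ψ = φ₁ ≫ S'.π := image.factor_map sq
  have h₂ : ψ ≫ S'.j = S.j ≫ φ₀ := image.map_ι sq
  let f : S.left ⟶ S'.left := { τ₁ := 𝟙 _, τ₂ := φ₁, τ₃ := ψ }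
  let g : S.right ⟶ S'.right := { τ₁ := ψ, τ₂ := φ₀, τ₃ := φ }
  have hf := ShortComplex.ShortExact.extClass_naturality S.left_shortExact S'.left_shortExact f
  have hg := ShortComplex.ShortExact.extClass_naturality S.right_shortExact S'.right_shortExact g
  rw [Abelian.Ext.comp_mk₀_id] at hf
  rw [iteratedBoundary_apply, iteratedBoundary_apply]
  rw [hf, Abelian.Ext.comp_assoc_of_second_deg_zero x, ← hg,
    ← Abelian.Ext.comp_assoc_of_third_deg_zero, Abelian.Ext.comp_assoc_of_second_deg_zero]

/-- The iterated boundary vanishes on the sections that lift to `L₀`, by the long exact sequence of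
`0 ⟶ im d ⟶ L₀ ⟶ B ⟶ 0`. -/
lemma iteratedBoundary_comp_p (x : Sheaf.H L₀ 0) :
    S.iteratedBoundary (x.comp (Abelian.Ext.mk₀ S.p) (zero_add 0)) = 0 := by
  rw [iteratedBoundary_apply]
  have h := S.right_shortExact.comp_extClass
  rw [Abelian.Ext.comp_assoc_of_second_deg_zero x, h, Abelian.Ext.comp_zero, Abelian.Ext.zero_comp]

end FourTermExact

end Boundary

/-! ### Cocycles with values in injective sheaves -/

section Primitive
variable {C : Type u} [Category.{v} C] {J : GrothendieckTopology C}

/-- The presheaf of families of sections of `I`, indexed by the sections of `P`: over `U`, the families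
of sections `x f q` of `I` over `T`, for `f : T ⟶ U` and `q` a section of `P` over `T`. -/
def familyPresheaf (I : Sheaf J AddCommGrpCat.{max u v}) (P : Cᵒᵖ ⥤ Type (max u v)) :
    Cᵒᵖ ⥤ AddCommGrpCat.{max u v} where
  obj U := AddCommGrpCat.of (∀ (T : C) (_ : T ⟶ U.unop) (_ : P.obj (op T)), I.obj.obj (op T))
  map g := AddCommGrpCat.ofHom
    { toFun := fun x T f q => x T (f ≫ g.unop) q
      map_zero' := rfl
      map_add' := fun _ _ => rfl }
  map_id U := by
    refine ConcreteCategory.hom_ext _ _ fun x => ?_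
    funext T f q
    change x T (f ≫ 𝟙 _) q = x T f q
    rw [Category.comp_id]
  map_comp {U V W} g h := by
    refine ConcreteCategory.hom_ext _ _ fun x => ?_
    funext T f q
    change x T (f ≫ h.unop ≫ g.unop) q = x T ((f ≫ h.unop) ≫ g.unop) q
    rw [Category.assoc]

/-- The family of the restrictions of a section. -/
def toFamilyPresheaf (I : Sheaf J AddCommGrpCat.{max u v}) (P : Cᵒᵖ ⥤ Type (max u v)) :
    I.obj ⟶ familyPresheaf I P where
  app U := AddCommGrpCat.ofHom
    { toFun := fun a T f _ => I.obj.map f.op a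
      map_zero' := by funext T f q; exact map_zero _
      map_add' := fun a b => by funext T f q; exact map_add _ _ _ }
  naturality U V g := by
    refine ConcreteCategory.hom_ext _ _ fun a => ?_
    funext T f q
    exact ab_map_comp I g f.op a

/-- A `1`-cocycle with values in an injective sheaf, on the sections of a presheaf of sets that has
sections locally, is a coboundary. -/
lemma exists_primitive (I : Sheaf J AddCommGrpCat.{max u v}) [Injective I]
    (P : Cᵒᵖ ⥤ Type (max u v))
    (hP : ∀ U, ∃ Z ∈ J U, ∀ ⦃V : C⦄ (f : V ⟶ U), Z f → Nonempty (P.obj (op V)))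
    (n : ∀ ⦃V : C⦄, P.obj (op V) → P.obj (op V) → I.obj.obj (op V))
    (hmap : ∀ ⦃V W : C⦄ (f : W ⟶ V) (q q' : P.obj (op V)),
      n (P.map f.op q) (P.map f.op q') = I.obj.map f.op (n q q'))
    (hadd : ∀ ⦃V : C⦄ (q q' q'' : P.obj (op V)), n q q' + n q' q'' = n q q'') :
    ∃ e : ∀ ⦃V : C⦄, P.obj (op V) → I.obj.obj (op V),
      (∀ ⦃V W : C⦄ (f : W ⟶ V) (q : P.obj (op V)), e (P.map f.op q) = I.obj.map f.op (e q)) ∧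
      ∀ ⦃V : C⦄ (q q' : P.obj (op V)), n q q' = e q' - e q := by
  have : Injective ((sheafToPresheaf J AddCommGrpCat.{max u v}).obj I) :=
    Injective.injective_of_adjoint (sheafificationAdjunction J AddCommGrpCat.{max u v}) I
  have : Injective I.obj := this
  -- `I` is injective as a presheaf too, so that its embedding into the presheaf of families splits
  have hm : ∀ U, Mono ((toFamilyPresheaf I P).app U) := fun U => by
    rw [AddCommGrpCat.mono_iff_injective]
    intro a b hab
    obtain ⟨Z, hZ, h⟩ := hP U.unop
    refine ab_ext I Z hZ fun V f hf => ?_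
    obtain ⟨q⟩ := h f hf
    exact congrFun (congrFun (congrFun hab V) f) q
  have : Mono (toFamilyPresheaf I P) := NatTrans.mono_of_mono_app _
  let r : familyPresheaf I P ⟶ I.obj := Injective.factorThru (𝟙 _) (toFamilyPresheaf I P)
  have hr (U : Cᵒᵖ) (a : I.obj.obj U) : r.app U ((toFamilyPresheaf I P).app U a) = a :=
    congrArg (fun φ : I.obj ⟶ I.obj => φ.app U a)
      (Injective.comp_factorThru (𝟙 _) (toFamilyPresheaf I P))
  -- `n q q'` is a primitive in the variable `q'`, for each fixed `q`; the retraction of the family of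
  -- these primitives, for all `q` at once, is a primitive that depends on no choice of `q`
  let fam ⦃V : C⦄ (q' : P.obj (op V)) : (familyPresheaf I P).obj (op V) :=
    fun T f q => n q (P.map f.op q')
  refine ⟨fun V q' => r.app (op V) (fam q'), fun V W f q' => ?_, fun V q q' => ?_⟩
  · rw [← NatTrans.naturality_apply r f.op (fam q')]
    refine congrArg (r.app (op W)) ?_
    funext T g q
    change n q (P.map g.op (P.map f.op q')) = n q (P.map (g ≫ f).op q')
    rw [← Functor.map_comp_apply]
    rfl
  · rw [← map_sub, ← hr (op V) (n q q')]
    refine congrArg (r.app (op V)) ?_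
    funext T f y
    change I.obj.map f.op (n q q') = n y (P.map f.op q') - n y (P.map f.op q)
    rw [← hmap, ← hadd y (P.map f.op q), add_sub_cancel_left]

end Primitive

section LocalCocycle
variable {C : Type u} [Category.{v} C] {J : GrothendieckTopology C}

/-- A form of `exists_primitive` for a cocycle that is only given locally, by a relation `r z z' y`
(`y` is a value of the cocycle at `z` and `z'`). -/
lemma exists_primitive_of_local (I : Sheaf J AddCommGrpCat.{max u v}) [Injective I]
    (P : Cᵒᵖ ⥤ Type (max u v))
    (hP : ∀ U, ∃ Z ∈ J U, ∀ ⦃V : C⦄ (f : V ⟶ U), Z f → Nonempty (P.obj (op V)))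
    (r : ∀ ⦃V : C⦄, P.obj (op V) → P.obj (op V) → I.obj.obj (op V) → Prop)
    (hmap : ∀ ⦃V W : C⦄ (f : W ⟶ V) (z z' : P.obj (op V)) (y : I.obj.obj (op V)),
      r z z' y → r (P.map f.op z) (P.map f.op z') (I.obj.map f.op y))
    (hadd : ∀ ⦃V : C⦄ (z z' z'' : P.obj (op V)) (y y' y'' : I.obj.obj (op V)),
      r z z' y → r z' z'' y' → r z z'' y'' → y + y' = y'')
    (hex : ∀ ⦃V : C⦄ (z z' : P.obj (op V)), ∃ Z ∈ J V, ∀ ⦃W : C⦄ (f : W ⟶ V), Z f →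
      ∃ y, r (P.map f.op z) (P.map f.op z') y) :
    ∃ e : ∀ ⦃V : C⦄, P.obj (op V) → I.obj.obj (op V),
      (∀ ⦃V W : C⦄ (f : W ⟶ V) (q : P.obj (op V)), e (P.map f.op q) = I.obj.map f.op (e q)) ∧
      ∀ ⦃V : C⦄ (z z' : P.obj (op V)) (y : I.obj.obj (op V)), r z z' y → y = e z' - e z := by
  have huniq ⦃V : C⦄ (z z' : P.obj (op V)) (y y' : I.obj.obj (op V)) (h : r z z' y)
      (h' : r z z' y') : y = y' := by
    obtain ⟨Z, hZ, h₀⟩ := hex z z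
    refine ab_ext I Z hZ fun W f hf => ?_
    obtain ⟨y₀, hy₀⟩ := h₀ f hf
    rw [← hadd _ _ _ _ _ _ hy₀ (hmap f _ _ _ h) (hmap f _ _ _ h),
      ← hadd _ _ _ _ _ _ hy₀ (hmap f _ _ _ h) (hmap f _ _ _ h')]
  have hn ⦃V : C⦄ (z z' : P.obj (op V)) := ab_glue I (V := V)
    (fun W f y => r (P.map f.op z) (P.map f.op z') y)
    (fun W W' f g y h => by
      have := hmap g _ _ _ h
      rwa [← Functor.map_comp_apply, ← Functor.map_comp_apply, ← op_comp] at this)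
    (fun W f y y' => huniq _ _ _ _) (hex z z').choose (hex z z').choose_spec.1
    (hex z z').choose_spec.2
  choose n hn using hn
  have hn' ⦃V : C⦄ (z z' : P.obj (op V)) (y : I.obj.obj (op V)) (h : r z z' y) : n z z' = y := by
    have := hn z z' (𝟙 V) y (by rwa [op_id, Functor.map_id_apply, Functor.map_id_apply])
    rwa [op_id, ab_map_id] at this
  have hnm ⦃V W : C⦄ (f : W ⟶ V) (z z' : P.obj (op V)) :
      n (P.map f.op z) (P.map f.op z') = I.obj.map f.op (n z z') := by
    obtain ⟨Z, hZ, h⟩ := hex (P.map f.op z) (P.map f.op z')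
    refine ab_ext I Z hZ fun T g hg => ?_
    obtain ⟨y, hy⟩ := h g hg
    rw [hn _ _ g y hy, ab_map_comp, ← op_comp, hn _ _ (g ≫ f) y]
    rwa [op_comp, Functor.map_comp_apply, Functor.map_comp_apply]
  obtain ⟨e, he, he'⟩ := exists_primitive I P hP n hnm (fun V z z' z'' => by
    obtain ⟨Z, hZ, h⟩ := hex z z'
    obtain ⟨Z', hZ', h'⟩ := hex z' z''
    obtain ⟨Z'', hZ'', h''⟩ := hex z z''
    refine ab_ext I _ (J.intersection_covering hZ (J.intersection_covering hZ' hZ''))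
      fun W f hf => ?_
    obtain ⟨y, hy⟩ := h f hf.1
    obtain ⟨y', hy'⟩ := h' f hf.2.1
    obtain ⟨y'', hy''⟩ := h'' f hf.2.2
    rw [map_add, hn _ _ f y hy, hn _ _ f y' hy', hn _ _ f y'' hy'']
    exact hadd _ _ _ _ _ _ hy hy' hy'')
  exact ⟨e, he, fun V z z' y h => by rw [← hn' z z' y h, he']⟩

/-- Sections that depend naturally on the sections of a presheaf `P` of sets with sections locally,
and that take only one value over each object, come from one global section. -/
lemma exists_globalSection (G : Sheaf J AddCommGrpCat.{max u v}) (P : Cᵒᵖ ⥤ Type (max u v))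
    (hP : ∀ U, ∃ Z ∈ J U, ∀ ⦃V : C⦄ (f : V ⟶ U), Z f → Nonempty (P.obj (op V)))
    (x : ∀ ⦃V : C⦄, P.obj (op V) → G.obj.obj (op V))
    (hmap : ∀ ⦃V W : C⦄ (f : W ⟶ V) (z : P.obj (op V)), x (P.map f.op z) = G.obj.map f.op (x z))
    (hx : ∀ ⦃V : C⦄ (z z' : P.obj (op V)), x z = x z') :
    ∃ τ : GlobalSection G, ∀ ⦃V : C⦄ (z : P.obj (op V)), x z = τ.1 (op V) := by
  have h (V : C) := ab_glue G (V := V) (fun W _ y => ∃ z : P.obj (op W), x z = y)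
    (by
      rintro W W' f g y ⟨z, rfl⟩
      exact ⟨P.map g.op z, hmap g z⟩)
    (by
      rintro W f y y' ⟨z, rfl⟩ ⟨z', rfl⟩
      exact hx z z')
    (hP V).choose (hP V).choose_spec.1 (fun W f hf => by
      obtain ⟨z⟩ := (hP V).choose_spec.2 f hf
      exact ⟨_, z, rfl⟩)
  choose τ hτ using h
  refine ⟨⟨fun V => τ V.unop, fun {V W} f => ?_⟩, fun V z => ?_⟩
  · change G.obj.map f (τ V.unop) = τ W.unop
    obtain ⟨Z, hZ, h⟩ := hP W.unop
    refine ab_ext G Z hZ fun T g hg => ?_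
    obtain ⟨z⟩ := h g hg
    rw [hτ W.unop g _ ⟨z, rfl⟩, ← hτ V.unop (g ≫ f.unop) _ ⟨z, rfl⟩]
    exact ab_map_comp G f g.op _
  · have := hτ V (𝟙 V) _ ⟨z, rfl⟩
    rw [op_id, ab_map_id] at this
    exact this.symm

end LocalCocycle

/-! ### Sections of families of pairs -/

namespace TorsorOver
variable {C : Type u} [Category.{v} C] {J : GrothendieckTopology C}
  {E : Sheaf J AddCommGrpCat.{max u v}} {X : ActionSheaf E} {U U₁ U₂ U₃ V W T S : C}

section
variable {I : Type (max u v)} {U : I → C} (Q : ∀ i, TorsorOver (X.over (U i)))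

/-- The presheaf of all sections of the members of a family of pairs. -/
def sectionPresheaf : Cᵒᵖ ⥤ Type (max u v) where
  obj T := Σ (i : I) (a : T.unop ⟶ U i), (Q i).Sec a
  map f := ↾fun z => ⟨z.1, f.unop ≫ z.2.1, (Q z.1).res f.unop rfl z.2.2⟩
  map_id T := by
    refine ConcreteCategory.hom_ext _ _ fun z => ?_
    obtain ⟨i, a, q⟩ := z
    have key (b : T.unop ⟶ U i) (h : 𝟙 _ ≫ a = b) :
      (⟨i, b, (Q i).res (𝟙 _) h q⟩ : Σ (i : I) (a : T.unop ⟶ U i), (Q i).Sec a) = ⟨i, a, q⟩ := by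
      obtain rfl : b = a := by rw [← h, Category.id_comp]
      rw [res_id]
    exact key _ rfl
  map_comp {T T' T''} f g := by
    refine ConcreteCategory.hom_ext _ _ fun z => ?_
    obtain ⟨i, a, q⟩ := z
    have key (b : T''.unop ⟶ U i) (h : g.unop ≫ f.unop ≫ a = b) :
      (⟨i, _, (Q i).res (g.unop ≫ f.unop) rfl q⟩ : Σ (i : I) (a : T''.unop ⟶ U i), (Q i).Sec a) =
        ⟨i, b, (Q i).res g.unop h ((Q i).res f.unop rfl q)⟩ := by
      obtain rfl : b = (g.unop ≫ f.unop) ≫ a := by rw [← h, Category.assoc]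
      rw [res_res]
    exact key _ rfl

lemma exists_cover_sectionPresheaf (hU : J.CoversTop U) (V : C) :
    ∃ Z ∈ J V, ∀ ⦃W : C⦄ (f : W ⟶ V), Z f → Nonempty ((sectionPresheaf Q).obj (op W)) := by
  refine ⟨sieveOf V (fun W _ => Nonempty ((sectionPresheaf Q).obj (op W))) ?_, ?_, fun _ _ h => h⟩
  · rintro W W' f g ⟨z⟩
    exact ⟨(sectionPresheaf Q).map g.op z⟩
  · refine J.transitive (hU V) _ ?_
    rintro W f ⟨i, ⟨a⟩⟩
    obtain ⟨Z, hZ, h⟩ := (Q i).exists_cover a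
    refine J.superset_covering (fun W' g hg => ?_) hZ
    obtain ⟨q⟩ := h g hg
    exact ⟨⟨i, g ≫ a, q⟩⟩

end

section
variable {Q : TorsorOver (X.over U₁)} {R : TorsorOver (X.over U₂)}
  {f₁ : T ⟶ U₁} {f₂ : T ⟶ U₂}

lemma onSec_pullPull (φ : (pull X f₁).obj Q ⟶ (pull X f₂).obj R)
    (g : V ⟶ T) (gf₁ : V ⟶ U₁) (gf₂ : V ⟶ U₂) (hgf₁ : g ≫ f₁ = gf₁) (hgf₂ : g ≫ f₂ = gf₂)
    (x : Q.Sec gf₁) :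
    onSec (pullPull φ g gf₁ gf₂ hgf₁ hgf₂) x = pullSec φ g hgf₁ hgf₂ x := by
  have key (k : V ⟶ T) (h : k = g) (h₁ h₂) : pullSec φ k h₁ h₂ x = pullSec φ g hgf₁ hgf₂ x := by
    subst h; rfl
  exact (pullSec_pullPull φ g gf₁ gf₂ hgf₁ hgf₂ (𝟙 V) (Category.id_comp _) (Category.id_comp _) x).trans
    (key _ (Category.id_comp g) _ _)

lemma onSec_translate (e : E.obj.obj (op T))
    (he : ∀ ⦃V : C⦄ (f : V ⟶ T) (x : X.carrier.obj.obj (op V)), X.act (E.obj.map f.op e) x = x)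
    (x : Q.Sec f₁) : onSec (Q := Q) (R := Q) (f₁ := f₁) (f₂ := f₁)
      (((pull X f₁).obj Q).translate e he) x = Q.act e x := by
  have h := pullSec_rfl (Q := Q) (R := Q) (f₁ := f₁) (f₂ := f₁)
    (((pull X f₁).obj Q).translate e he) (𝟙 T) (Q.res (𝟙 T) (by simp) x)
  have h₂ : onSec (Q := Q) (R := Q) (f₁ := f₁) (f₂ := f₁)
      (((pull X f₁).obj Q).translate e he) x = Q.res (𝟙 T) (by simp)
        (appSec (Q := Q) (R := Q) (f₁ := f₁) (f₂ := f₁)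
          (((pull X f₁).obj Q).translate e he) (𝟙 T) (Q.res (𝟙 T) (by simp) x)) := rfl
  have h₃ : appSec (Q := Q) (R := Q) (f₁ := f₁) (f₂ := f₁)
      (((pull X f₁).obj Q).translate e he) (𝟙 T) (Q.res (𝟙 T) (by simp) x) =
      Q.act (E.obj.map (𝟙 T).op e) (Q.res (𝟙 T) (by simp) x) := rfl
  rw [h₂, h₃, res_act, res_res, op_id, ab_map_id, ab_map_id]
  simp

end

end TorsorOver

/-! ### The class of the fibre -/

section FiberClass
variable {C : Type u} [Category.{v} C] {J : GrothendieckTopology C}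
  {A L₁ L₀ B : Sheaf J AddCommGrpCat.{max u v}} (S : FourTermExact A L₁ L₀ B) (β : GlobalSection B)
open TorsorOver

namespace FourTermExact

variable {β}

/-- The pair underlying an object of the fibre over `β`. -/
abbrev fiberPair {U : C} (M : (S.fiber β).obj (.mk (op U))) :
    TorsorOver ((ActionSheaf.ofHom S.d).over U) :=
  M.obj

/-- A section of `L₀` underlying a section of an object of the fibre. -/
def fiberSec {U V : C} {M : (S.fiber β).obj (.mk (op U))} {f : V ⟶ U} (q : (S.fiberPair M).Sec f) :
    L₀.obj.obj (op V) :=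
  (S.fiberPair M).toSec q

lemma p_fiberSec {U V : C} {M : (S.fiber β).obj (.mk (op U))} {f : V ⟶ U}
    (q : (S.fiberPair M).Sec f) : S.p.hom.app (op V) (S.fiberSec q) = β.1 (op V) :=
  (M.2 f q).trans (β.2 f.op)

lemma fiberSec_act {U V : C} {M : (S.fiber β).obj (.mk (op U))} {f : V ⟶ U}
    (h : L₁.obj.obj (op V)) (q : (S.fiberPair M).Sec f) :
    S.fiberSec ((S.fiberPair M).act h q) = S.d.hom.app (op V) h + S.fiberSec q :=
  (S.fiberPair M).toSec_act h q

lemma fiberSec_res {U V W : C} {M : (S.fiber β).obj (.mk (op U))} {f : V ⟶ U}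
    (q : (S.fiberPair M).Sec f) (g : W ⟶ V) {f' : W ⟶ U} (h : g ≫ f = f') :
    S.fiberSec ((S.fiberPair M).res g h q) = L₀.obj.map g.op (S.fiberSec q) :=
  (S.fiberPair M).toSec_res q g h

/-- The morphism of pairs underlying a morphism in the fibre over `β`. -/
abbrev fiberHom {U V T : C} {M : (S.fiber β).obj (.mk (op U))} {N : (S.fiber β).obj (.mk (op V))}
    {f : T ⟶ U} {g : T ⟶ V}
    (α : ((S.fiber β).map g.op.toLoc).toFunctor.obj N ⟶
      ((S.fiber β).map f.op.toLoc).toFunctor.obj M) :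
    (pull (ActionSheaf.ofHom S.d) g).obj (S.fiberPair N) ⟶
      (pull (ActionSheaf.ofHom S.d) f).obj (S.fiberPair M) :=
  α.hom

section
variable {U V T : C} {M : (S.fiber β).obj (.mk (op U))} {N : (S.fiber β).obj (.mk (op V))}
    {f : T ⟶ U} {g : T ⟶ V}
    (α : ((S.fiber β).map g.op.toLoc).toFunctor.obj N ⟶
      ((S.fiber β).map f.op.toLoc).toFunctor.obj M)

/-- The morphism `α`, pulled back along `m`, sends the section `q'` of `N` to the translate by `h` of
the section `q` of `M`. -/
def Transition {W : C} (m : W ⟶ T) {a : W ⟶ U} {b : W ⟶ V} (ha : m ≫ f = a) (hb : m ≫ g = b)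
    (q : (S.fiberPair M).Sec a) (q' : (S.fiberPair N).Sec b) (h : L₁.obj.obj (op W)) : Prop :=
  pullSec (S.fiberHom α) m hb ha q' = (S.fiberPair M).act h q

variable {W : C} {m : W ⟶ T} {a : W ⟶ U} {b : W ⟶ V} {ha : m ≫ f = a} {hb : m ≫ g = b}
  {q : (S.fiberPair M).Sec a} {q' : (S.fiberPair N).Sec b} {h : L₁.obj.obj (op W)}

variable (m ha hb q q') in
lemma exists_transition : ∃ h, S.Transition α m ha hb q q' h := by
  obtain ⟨h, hh⟩ := (S.fiberPair M).exists_act q (pullSec (S.fiberHom α) m hb ha q')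
  exact ⟨h, hh.symm⟩

variable {S α}

lemma Transition.res (H : S.Transition α m ha hb q q' h) {W' : C} (k : W' ⟶ W) {a' : W' ⟶ U}
    {b' : W' ⟶ V} (ha' : k ≫ a = a') (hb' : k ≫ b = b') :
    S.Transition α (k ≫ m) (by rw [Category.assoc, ha, ha']) (by rw [Category.assoc, hb, hb'])
      ((S.fiberPair M).res k ha' q) ((S.fiberPair N).res k hb' q') (L₁.obj.map k.op h) := by
  have h₁ := pullSec_res (S.fiberHom α) m hb ha q' k hb' ha' rfl
    (by rw [Category.assoc, hb, hb']) (by rw [Category.assoc, ha, ha'])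
  refine h₁.symm.trans ?_
  rw [show pullSec (S.fiberHom α) m hb ha q' = _ from H, res_act]

lemma Transition.d_eq (H : S.Transition α m ha hb q q' h) :
    S.d.hom.app (op W) h = S.fiberSec q' - S.fiberSec q := by
  have h₁ : S.fiberSec (pullSec (S.fiberHom α) m hb ha q') = S.fiberSec q' :=
    toSec_pullSec (S.fiberHom α) m hb ha q'
  rw [show pullSec (S.fiberHom α) m hb ha q' = _ from H, fiberSec_act] at h₁
  exact eq_sub_of_add_eq h₁

end

/-- The cocycle relation between three morphisms of the fibre, in terms of the translations that
describe them on sections. -/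
lemma comp_eq_comp_band_iff {Ui Uj Ul V V' V'' T : C} {Mi : (S.fiber β).obj (.mk (op Ui))}
    {Mj : (S.fiber β).obj (.mk (op Uj))} {Ml : (S.fiber β).obj (.mk (op Ul))}
    {f : V ⟶ Ui} {g : V ⟶ Uj} {f' : V' ⟶ Uj} {g' : V' ⟶ Ul} {f'' : V'' ⟶ Ui} {g'' : V'' ⟶ Ul}
    (α : ((S.fiber β).map g.op.toLoc).toFunctor.obj Mj ⟶
      ((S.fiber β).map f.op.toLoc).toFunctor.obj Mi)
    (α' : ((S.fiber β).map g'.op.toLoc).toFunctor.obj Ml ⟶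
      ((S.fiber β).map f'.op.toLoc).toFunctor.obj Mj)
    (α'' : ((S.fiber β).map g''.op.toLoc).toFunctor.obj Ml ⟶
      ((S.fiber β).map f''.op.toLoc).toFunctor.obj Mi)
    {fi : T ⟶ Ui} {fj : T ⟶ Uj} {fl : T ⟶ Ul} (m : T ⟶ V) (m' : T ⟶ V') (m'' : T ⟶ V'')
    (h₁ : m ≫ f = fi) (h₂ : m ≫ g = fj) (h₃ : m' ≫ f' = fj) (h₄ : m' ≫ g' = fl)
    (h₅ : m'' ≫ f'' = fi) (h₆ : m'' ≫ g'' = fl)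
    (q : (S.fiberPair Mi).Sec fi) (q' : (S.fiberPair Mj).Sec fj) (q'' : (S.fiberPair Ml).Sec fl)
    {h h' h'' : L₁.obj.obj (op T)} (H : S.Transition α m h₁ h₂ q q' h)
    (H' : S.Transition α' m' h₃ h₄ q' q'' h') (H'' : S.Transition α'' m'' h₅ h₆ q q'' h'')
    (c : A.obj.obj (op T)) :
    Pseudofunctor.LocallyDiscreteOpToCat.pullHom α' m' fl fj h₄ h₃ ≫
        Pseudofunctor.LocallyDiscreteOpToCat.pullHom α m fj fi h₂ h₁ =
      Pseudofunctor.LocallyDiscreteOpToCat.pullHom α'' m'' fl fi h₆ h₅ ≫ S.fiberBand β _ c ↔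
    S.ι.hom.app (op T) c = h + h' - h'' := by
  let he : ∀ ⦃V : C⦄ (f : V ⟶ T) (x : (ActionSheaf.ofHom S.d).carrier.obj.obj (op V)),
      (ActionSheaf.ofHom S.d).act (L₁.obj.map f.op (S.ι.hom.app (op T) c)) x = x := fun V f x => by
    rw [← ab_naturality]; exact S.ofHom_act_ι _ x
  let Φ := pullPull (S.fiberHom α') m' fl fj h₄ h₃ ≫ pullPull (S.fiberHom α) m fj fi h₂ h₁
  let Ψ := pullPull (S.fiberHom α'') m'' fl fi h₆ h₅ ≫
    ((pull (ActionSheaf.ofHom S.d) fi).obj (S.fiberPair Mi)).translate (S.ι.hom.app (op T) c) he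
  have hΦ : onSec Φ q'' = (S.fiberPair Mi).act (h + h') q := by
    refine (pullSec_comp (pullPull (S.fiberHom α') m' fl fj h₄ h₃)
      (pullPull (S.fiberHom α) m fj fi h₂ h₁) (𝟙 T) _ (Category.id_comp _) _ q'').trans ?_
    refine (congrArg (onSec _) ((onSec_pullPull _ _ _ _ _ _ q'').trans H')).trans ?_
    refine (onSec_pullPull _ _ _ _ _ _ _).trans ?_
    rw [pullSec_act, show pullSec (S.fiberHom α) m h₂ h₁ q' = _ from H, add_comm, add_act]
  have hΨ : onSec Ψ q'' = (S.fiberPair Mi).act (S.ι.hom.app (op T) c + h'') q := by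
    refine (pullSec_comp (pullPull (S.fiberHom α'') m'' fl fi h₆ h₅)
      (translate _ _ he) (𝟙 T) _ (Category.id_comp _) _ q'').trans ?_
    refine (congrArg (onSec _) ((onSec_pullPull _ _ _ _ _ _ q'').trans H'')).trans ?_
    rw [onSec_translate, add_act]
  have hleft : (Pseudofunctor.LocallyDiscreteOpToCat.pullHom α' m' fl fj h₄ h₃ ≫
      Pseudofunctor.LocallyDiscreteOpToCat.pullHom α m fj fi h₂ h₁).hom = Φ :=
    congr (congrArg CategoryStruct.comp (fullsubcategory_pullHom (S.fiberProperty β) α' m' fl fj h₄ h₃))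
      (fullsubcategory_pullHom (S.fiberProperty β) α m fj fi h₂ h₁)
  have hright : (Pseudofunctor.LocallyDiscreteOpToCat.pullHom α'' m'' fl fi h₆ h₅ ≫
      S.fiberBand β _ c).hom = Ψ :=
    congrArg (fun χ => CategoryStruct.comp χ _)
      (fullsubcategory_pullHom (S.fiberProperty β) α'' m'' fl fi h₆ h₅)
  have key : (Φ = Ψ) ↔ S.ι.hom.app (op T) c = h + h' - h'' := by
    rw [eq_sub_iff_add_eq]
    constructor
    · intro e
      refine ((S.fiberPair Mi).act_injective q ?_).symm
      rw [← hΦ, ← hΨ, e]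
    · intro e
      refine pull_hom_ext_of_sec q'' ?_
      rw [hΦ, hΨ, e]
  rw [← key, ← hleft, ← hright]
  exact ⟨fun e => congrArg InducedCategory.Hom.hom e, fun e => ObjectProperty.hom_ext _ e⟩

end FourTermExact
end FiberClass

section ClassOfFiber
variable {C : Type u} [Category.{v} C] {J : GrothendieckTopology C}
  {A L₁ L₀ B : Sheaf J AddCommGrpCat.{max u v}} (S : FourTermExact A L₁ L₀ B) {β : GlobalSection B}
open TorsorOver

namespace FourTermExact

/-- The zero section of the trivial pair of `g`, as a section of an object of the fibre. -/
def fiberTrivialSec {U V : C} (g : L₀.obj.obj (op U)) (hg : S.p.hom.app (op U) g = β.1 (op U))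
    (f : V ⟶ U) : (S.fiberPair (S.fiberTrivial β g hg)).Sec f :=
  trivSec (X := ActionSheaf.ofHom S.d) g 0

lemma fiberSec_fiberTrivialSec {U V : C} (g : L₀.obj.obj (op U))
    (hg : S.p.hom.app (op U) g = β.1 (op U)) (f : V ⟶ U) :
    S.fiberSec (S.fiberTrivialSec g hg f) = L₀.obj.map f.op g := by
  have h : S.d.hom.app (op V) 0 + L₀.obj.map f.op g = L₀.obj.map f.op g := by
    rw [map_zero, zero_add]
  exact h

lemma res_fiberTrivialSec {U V W : C} (g : L₀.obj.obj (op U))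
    (hg : S.p.hom.app (op U) g = β.1 (op U)) (f : V ⟶ U) (k : W ⟶ V) {f' : W ⟶ U}
    (h : k ≫ f = f') : (S.fiberPair (S.fiberTrivial β g hg)).res k h (S.fiberTrivialSec g hg f) =
      S.fiberTrivialSec g hg f' :=
  map_zero (L₁.obj.map k.op).hom

/-- A section `h` of `L₁` whose image is the difference of two sections of `(L₀)_β` gives a morphism
between their trivial pairs. -/
lemma exists_fiberTrivial_hom {U U' V : C} (g : L₀.obj.obj (op U))
    (hg : S.p.hom.app (op U) g = β.1 (op U)) (g' : L₀.obj.obj (op U'))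
    (hg' : S.p.hom.app (op U') g' = β.1 (op U')) (f : V ⟶ U) (f' : V ⟶ U') (h : L₁.obj.obj (op V))
    (hh : S.d.hom.app (op V) h = L₀.obj.map f'.op g' - L₀.obj.map f.op g) :
    ∃ α : ((S.fiber β).map f'.op.toLoc).toFunctor.obj (S.fiberTrivial β g' hg') ⟶
        ((S.fiber β).map f.op.toLoc).toFunctor.obj (S.fiberTrivial β g hg),
      ∀ ⦃W : C⦄ (m : W ⟶ V) (a : W ⟶ U) (b : W ⟶ U') (ha : m ≫ f = a) (hb : m ≫ f' = b),
        S.Transition α m ha hb (S.fiberTrivialSec g hg a) (S.fiberTrivialSec g' hg' b)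
          (L₁.obj.map m.op h) := by
  have h₁ : S.fiberSec (S.fiberTrivialSec g' hg' f') = S.fiberSec
      ((S.fiberPair (S.fiberTrivial β g hg)).act h (S.fiberTrivialSec g hg f)) := by
    rw [fiberSec_act, fiberSec_fiberTrivialSec, fiberSec_fiberTrivialSec, hh, sub_add_cancel]
  obtain ⟨α, hα⟩ := exists_pull_hom (S.fiberTrivialSec g' hg' f')
    ((S.fiberPair (S.fiberTrivial β g hg)).act h (S.fiberTrivialSec g hg f)) h₁
  refine ⟨ObjectProperty.homMk α, fun W m a b ha hb => ?_⟩
  have h₂ := pullSec_res α (𝟙 V) (Category.id_comp _) (Category.id_comp _)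
    (S.fiberTrivialSec g' hg' f') m hb ha (Category.comp_id m) hb ha
  rw [res_fiberTrivialSec] at h₂
  refine h₂.symm.trans ((congrArg _ hα).trans ?_)
  rw [res_act, res_fiberTrivialSec]

variable (β) in
/-- The covering family of all sections of `(L₀)_β` over objects of the site, with all the sections of
`L₁` whose image is the difference of two of them. -/
def sectionCover : CechCover.{max u v} J where
  I := Σ U : C, {g : L₀.obj.obj (op U) // S.p.hom.app (op U) g = β.1 (op U)}
  U := fun i => i.1
  coversTop := fun U => by
    obtain ⟨Z, hZ, h⟩ := S.exists_local_p (β.1 (op U))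
    refine J.superset_covering (fun V f hf => ?_) hZ
    obtain ⟨g, hg⟩ := h f hf
    exact ⟨⟨V, g, hg.trans (β.2 f.op)⟩, ⟨𝟙 V⟩⟩
  K := fun i j => Σ (V : C) (f : V ⟶ i.1) (g : V ⟶ j.1), {h : L₁.obj.obj (op V) //
    S.d.hom.app (op V) h = L₀.obj.map g.op j.2.1 - L₀.obj.map f.op i.2.1}
  V := fun k => k.1
  fst := fun k => k.2.1
  snd := fun k => k.2.2.1
  covers := fun {i j T} f g => by
    have hi : S.p.hom.app (op T) (L₀.obj.map f.op i.2.1) = β.1 (op T) := by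
      rw [ab_naturality, i.2.2]; exact β.2 f.op
    have hj : S.p.hom.app (op T) (L₀.obj.map g.op j.2.1) = β.1 (op T) := by
      rw [ab_naturality, j.2.2]; exact β.2 g.op
    obtain ⟨Z, hZ, h⟩ := S.exists_local_d (x := L₀.obj.map g.op j.2.1 - L₀.obj.map f.op i.2.1)
      (by rw [map_sub, hi, hj, sub_self])
    refine ⟨Z, hZ, fun T' t ht => ?_⟩
    obtain ⟨e, he⟩ := h t ht
    exact ⟨⟨T', t ≫ f, t ≫ g, e, by rw [he, map_sub, ab_map_comp, ab_map_comp]; rfl⟩, 𝟙 T',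
      Category.id_comp _, Category.id_comp _⟩

variable [HasExt.{t} (Sheaf J AddCommGrpCat.{max u v})]

lemma iteratedBoundary_toH_map {I₀ I₁ R : Sheaf J AddCommGrpCat.{max u v}}
    (S' : FourTermExact A I₀ I₁ R) (φ₁ : L₁ ⟶ I₀) (φ₀ : L₀ ⟶ I₁) (φ : B ⟶ R)
    (hι : S.ι ≫ φ₁ = S'.ι) (hd : S.d ≫ φ₀ = φ₁ ≫ S'.d) (hp : S.p ≫ φ = φ₀ ≫ S'.p) :
    S'.iteratedBoundary (GlobalSection.toH (GlobalSection.map φ β)) =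
      S.iteratedBoundary (GlobalSection.toH β) := by
  rw [GlobalSection.toH_map, S.iteratedBoundary_map S' φ₁ φ₀ φ hι hd hp]

/-- Global sections of `B` that differ by the image of a global section of `L₀` have the same iterated
boundary. -/
lemma iteratedBoundary_toH_eq (ρ ρ' : GlobalSection B) (τ : GlobalSection L₀)
    (h : ∀ V, (ρ'.1 V : B.obj.obj V) = (ρ.1 V : B.obj.obj V) + S.p.hom.app V (τ.1 V)) :
    S.iteratedBoundary (GlobalSection.toH ρ') = S.iteratedBoundary (GlobalSection.toH ρ) := by
  rw [GlobalSection.toH_add ρ (GlobalSection.map S.p τ) ρ' h, map_add, GlobalSection.toH_map,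
    iteratedBoundary_comp_p, add_zero]

/-- A class of the fibre is the iterated boundary of `β`: its data differ from the images of the fibre
under the comparison with the injective resolution by a coboundary and a global section of `I₁`. -/
lemma eq_of_isGerbeClass {ξ : Sheaf.H A 2} (hξ : IsGerbeClass (S.fiberBand β) ξ) :
    ξ = S.iteratedBoundary (GlobalSection.toH β) := by
  obtain ⟨H, x, α, I₀, I₁, R, S', γ, s, ρ, hI₀, hI₁, hc, hγ, hs, rfl⟩ := hξ
  obtain ⟨φ₁, φ₀, φ, hι, hd, hp⟩ := S.exists_map_of_injective S'
  have hι' (V : Cᵒᵖ) (a : A.obj.obj V) : φ₁.hom.app V (S.ι.hom.app V a) = S'.ι.hom.app V a :=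
    congrArg (fun ψ : A ⟶ I₀ => ψ.hom.app V a) hι
  have hd' (V : Cᵒᵖ) (h : L₁.obj.obj V) :
      φ₀.hom.app V (S.d.hom.app V h) = S'.d.hom.app V (φ₁.hom.app V h) :=
    congrArg (fun ψ : L₁ ⟶ I₁ => ψ.hom.app V h) hd
  have hp' (V : Cᵒᵖ) (g : L₀.obj.obj V) :
      φ.hom.app V (S.p.hom.app V g) = S'.p.hom.app V (φ₀.hom.app V g) :=
    congrArg (fun ψ : L₀ ⟶ R => ψ.hom.app V g) hp
  -- all sections of the pairs `x i`, and the difference between the translations by which the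
  -- `α k` act on them and the cochain `γ`
  let P : Cᵒᵖ ⥤ Type (max u v) := sectionPresheaf fun i => S.fiberPair (x i)
  have hP := exists_cover_sectionPresheaf (fun i => S.fiberPair (x i)) H.coversTop
  let r ⦃V : C⦄ (z z' : P.obj (op V)) (y : I₀.obj.obj (op V)) : Prop :=
    ∃ (k : H.K z.1 z'.1) (m : V ⟶ H.V k) (h₁ : m ≫ H.fst k = z.2.1) (h₂ : m ≫ H.snd k = z'.2.1)
      (h : L₁.obj.obj (op V)), S.Transition (α k) m h₁ h₂ z.2.2 z'.2.2 h ∧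
        y = φ₁.hom.app (op V) h - I₀.obj.map m.op (γ k)
  have hex ⦃V : C⦄ (z z' : P.obj (op V)) : ∃ Z ∈ J V, ∀ ⦃W : C⦄ (f : W ⟶ V), Z f →
      ∃ y, r (P.map f.op z) (P.map f.op z') y := by
    obtain ⟨Z, hZ, h⟩ := H.covers z.2.1 z'.2.1
    refine ⟨Z, hZ, fun W f hf => ?_⟩
    obtain ⟨k, m, h₁, h₂⟩ := h f hf
    obtain ⟨h, hh⟩ := S.exists_transition (α k) m h₁ h₂ (P.map f.op z).2.2 (P.map f.op z').2.2
    exact ⟨_, k, m, h₁, h₂, h, hh, rfl⟩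
  obtain ⟨e, he, hre⟩ := exists_primitive_of_local I₀ P hP r
    (by
      rintro V W f z z' y ⟨k, m, h₁, h₂, h, hh, rfl⟩
      refine ⟨k, f ≫ m, _, _, _, hh.res f rfl rfl, ?_⟩
      rw [map_sub, ab_naturality, ab_map_comp, ← op_comp]
      rfl)
    (by
      rintro V z z' z'' y y' y'' ⟨k, m, h₁, h₂, h, hh, rfl⟩ ⟨k', m', h₁', h₂', h', hh', rfl⟩
        ⟨k'', m'', h₁'', h₂'', h'', hh'', rfl⟩
      obtain ⟨c, hιc⟩ := S.exists_ι (x := h + h' - h'')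
        (by rw [map_sub, map_add, hh.d_eq, hh'.d_eq, hh''.d_eq]; abel)
      have h₀ := hc k k' k'' z.2.1 z'.2.1 z''.2.1 m m' m'' h₁ h₂ h₁' h₂' h₁'' h₂'' c
        ((S.comp_eq_comp_band_iff (α k) (α k') (α k'') m m' m'' h₁ h₂ h₁' h₂' h₁'' h₂''
          _ _ _ hh hh' hh'' c).2 hιc)
      rw [← hι', hιc, map_sub, map_add] at h₀
      rw [← sub_eq_zero] at h₀ ⊢
      rw [← h₀]
      abel)
    hex
  -- the images of the sections in `I₁`, relative to the cochain `s`
  let w ⦃V : C⦄ (z : P.obj (op V)) : I₁.obj.obj (op V) :=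
    φ₀.hom.app (op V) (S.fiberSec z.2.2) - I₁.obj.map z.2.1.op (s z.1)
  have hw ⦃V W : C⦄ (f : W ⟶ V) (z : P.obj (op V)) : w (P.map f.op z) = I₁.obj.map f.op (w z) := by
    dsimp only [w]
    rw [map_sub, ab_map_comp, ← op_comp, ← ab_naturality, ← fiberSec_res _ _ f rfl]
    rfl
  have hrw ⦃V : C⦄ (z z' : P.obj (op V)) (y : I₀.obj.obj (op V)) (h : r z z' y) :
      S'.d.hom.app (op V) y = w z' - w z := by
    obtain ⟨k, m, h₁, h₂, h, hh, rfl⟩ := h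
    dsimp only [w]
    rw [map_sub, ← hd', hh.d_eq, ab_naturality, hγ, map_sub, map_sub, ab_map_comp, ab_map_comp,
      ← op_comp, ← op_comp, h₁, h₂]
    abel
  have hw' ⦃V : C⦄ (z : P.obj (op V)) : w z =
      φ₀.hom.app (op V) (S.fiberSec z.2.2) - I₁.obj.map z.2.1.op (s z.1) := rfl
  clear_value w
  obtain ⟨τ, hτ⟩ := exists_globalSection I₁ P hP (fun V z => w z - S'.d.hom.app (op V) (e z))
    (fun V W f z => by rw [hw, he, ab_naturality, map_sub])
    (fun V z z' => by
      obtain ⟨Z, hZ, h⟩ := hex z z'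
      refine ab_ext I₁ Z hZ fun W f hf => ?_
      obtain ⟨y, hy⟩ := h f hf
      have h₁ := hrw _ _ _ hy
      rw [hre _ _ _ hy, map_sub, hw, hw, he, he] at h₁
      rw [map_sub, map_sub, ← ab_naturality, ← ab_naturality, ← sub_eq_zero]
      rw [← sub_eq_zero] at h₁
      rw [← h₁]
      abel)
  rw [← S.iteratedBoundary_toH_map S' φ₁ φ₀ φ hι hd hp]
  refine (S'.iteratedBoundary_toH_eq ρ _ τ fun V => ?_).symm
  obtain ⟨Z, hZ, h⟩ := hP V.unop
  refine ab_ext R Z hZ fun W f hf => ?_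
  obtain ⟨z⟩ := h f hf
  have hβ : R.obj.map f.op (φ.hom.app V (β.1 V : B.obj.obj V)) =
      φ.hom.app (op W) (β.1 (op W) : B.obj.obj (op W)) :=
    (GlobalSection.map φ β).2 f.op
  have hρ : R.obj.map f.op (ρ.1 V : R.obj.obj V) = ρ.1 (op W) := ρ.2 f.op
  have hρ' : R.obj.map z.2.1.op (ρ.1 (op (H.U z.1)) : R.obj.obj (op (H.U z.1))) = ρ.1 (op W) :=
    ρ.2 z.2.1.op
  have hτ' : I₁.obj.map f.op (τ.1 V : I₁.obj.obj V) = τ.1 (op W) := τ.2 f.op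
  refine hβ.trans ?_
  rw [map_add, hρ, ← ab_naturality, hτ', ← hτ z, map_sub, p_d, sub_zero, hw', map_sub,
    ab_naturality S'.p, hs, hρ', ← hp', p_fiberSec, add_sub_cancel]

/-- The class of the fibre, computed from sections `g i` of `(L₀)_β` and sections `h k` of `L₁` whose
images are their differences. -/
lemma isGerbeClass_iteratedBoundary_of_cover (H : CechCover.{max u v} J)
    (g : ∀ i, L₀.obj.obj (op (H.U i))) (hg : ∀ i, S.p.hom.app _ (g i) = β.1 (op (H.U i)))
    (h : ∀ ⦃i j⦄ (k : H.K i j), L₁.obj.obj (op (H.V k)))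
    (hh : ∀ ⦃i j⦄ (k : H.K i j), S.d.hom.app _ (h k) =
      L₀.obj.map (H.snd k).op (g j) - L₀.obj.map (H.fst k).op (g i)) :
    IsGerbeClass (S.fiberBand β) (S.iteratedBoundary (GlobalSection.toH β)) := by
  obtain ⟨I₀, I₁, R, S', hI₀, hI₁⟩ := exists_injective_resolution A
  obtain ⟨φ₁, φ₀, φ, hι, hd, hp⟩ := S.exists_map_of_injective S'
  have hι' (V : Cᵒᵖ) (a : A.obj.obj V) : φ₁.hom.app V (S.ι.hom.app V a) = S'.ι.hom.app V a :=
    congrArg (fun ψ : A ⟶ I₀ => ψ.hom.app V a) hι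
  have hd' (V : Cᵒᵖ) (h : L₁.obj.obj V) :
      φ₀.hom.app V (S.d.hom.app V h) = S'.d.hom.app V (φ₁.hom.app V h) :=
    congrArg (fun ψ : L₁ ⟶ I₁ => ψ.hom.app V h) hd
  have hp' (V : Cᵒᵖ) (g : L₀.obj.obj V) :
      φ.hom.app V (S.p.hom.app V g) = S'.p.hom.app V (φ₀.hom.app V g) :=
    congrArg (fun ψ : L₀ ⟶ R => ψ.hom.app V g) hp
  choose α hα using fun ⦃i j : H.I⦄ (k : H.K i j) =>
    S.exists_fiberTrivial_hom (g i) (hg i) (g j) (hg j) (H.fst k) (H.snd k) (h k) (hh k)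
  refine ⟨H, fun i => S.fiberTrivial β (g i) (hg i), α, I₀, I₁, R, S',
    fun i j k => φ₁.hom.app _ (h k), fun i => φ₀.hom.app _ (g i),
    GlobalSection.map φ β, hI₀, hI₁, ?_, fun i j k => ?_, fun i => ?_,
    (S.iteratedBoundary_toH_map S' φ₁ φ₀ φ hι hd hp).symm⟩
  · intro i j l k k' k'' T fi fj fl m m' m'' h₁ h₂ h₃ h₄ h₅ h₆ c hc
    have h₀ := (S.comp_eq_comp_band_iff (α k) (α k') (α k'') m m' m'' h₁ h₂ h₃ h₄ h₅ h₆
      _ _ _ (hα k m fi fj h₁ h₂) (hα k' m' fj fl h₃ h₄) (hα k'' m'' fi fl h₅ h₆) c).1 hc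
    rw [← hι', h₀, map_sub, map_add, ab_naturality, ab_naturality, ab_naturality]
  · rw [← hd', hh, map_sub, ab_naturality, ab_naturality]
  · rw [← hp', hg]
    rfl

/-- The iterated boundary of `β` is a class of the fibre, as the covering `sectionCover` comes with the
sections of `L₀` and `L₁` that are needed. -/
lemma isGerbeClass_iteratedBoundary :
    IsGerbeClass (S.fiberBand β) (S.iteratedBoundary (GlobalSection.toH β)) :=
  S.isGerbeClass_iteratedBoundary_of_cover (S.sectionCover β) (fun i => i.2.1) (fun i => i.2.2)
    (fun _ _ k => k.2.2.2.1) (fun _ _ k => k.2.2.2.2)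

end FourTermExact
end ClassOfFiber

end PicardGerbe

theorem mainTheorem5 {C : Type u} [Category.{v} C] {J : GrothendieckTopology C}
    [HasExt.{t} (Sheaf J AddCommGrpCat.{max u v})]
    {A L₁ L₀ B : Sheaf J AddCommGrpCat.{max u v}} (S : PicardGerbe.FourTermExact A L₁ L₀ B)
    (β : PicardGerbe.GlobalSection B) :
    (∃ η : Pseudofunctor.StrongTrans (PicardGerbe.prestack S.d) S.picardStack,
      PicardGerbe.IsAssociatedStack J η ∧
        ∀ ⦃U : C⦄ (g : PicardGerbe.PreObj S.d U), S.LiesOver ((η.app (.mk (op U))).toFunctor.obj g)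
          (S.p.hom.app (op U) g.val)) ∧
    PicardGerbe.IsAbelianGerbe (S.fiberBand β) ∧
    (∃ η : Pseudofunctor.StrongTrans (S.prestackFiber β) (S.fiber β),
      PicardGerbe.IsAssociatedStack J η ∧
        PicardGerbe.PreservesBand η (S.prestackBand β) (S.fiberBand β)) ∧
    (∀ ξ : Sheaf.H A 2, PicardGerbe.IsGerbeClass (S.fiberBand β) ξ ↔
      ξ = S.iteratedBoundary (PicardGerbe.GlobalSection.toH β)) ∧
    (S.fiberTorsor β).IsTorsor ∧
    PicardGerbe.IsAbelianGerbe (PicardGerbe.liftingBand S.ι S.π S.ι_π (S.fiberTorsor β)) ∧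
    PicardGerbe.AbelianGerbeEquiv (S.fiberBand β)
      (PicardGerbe.liftingBand S.ι S.π S.ι_π (S.fiberTorsor β)) := by
  refine ⟨⟨PicardGerbe.prestackMap S.d, PicardGerbe.isAssociatedStack_prestackMap S.d,
    fun U g => S.liesOver_trivialPair g.val⟩, S.isAbelianGerbe_fiberBand β,
    ⟨S.prestackFiberMap β, S.isAssociatedStack_prestackFiberMap β,
      S.preservesBand_prestackFiberMap β⟩, fun ξ => ⟨S.eq_of_isGerbeClass, ?_⟩,
    S.isTorsor_fiberTorsor β, S.isAbelianGerbe_liftingBand β, S.abelianGerbeEquiv_liftingBand β⟩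
  rintro rfl
  exact S.isGerbeClass_iteratedBoundary
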